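/- For an integer $m$ write $[m]=\{1,\dots,m\}$. A $k$-shortest graph is a finite graph $G$ together with $k$ partitions $(V^i_1,\dots,V^i_{m_i})$, $i\in[k]$, of its vertex set into ordered non-empty parts such that (a) for every edge $xy$ of $G$ there is $i\in[k]$ such that $x$ and $y$ lie in two consecutive parts $V^i_j,V^i_{j+1}$ of the $i$-th partition, and (b) for every $i\in[k]$, if $x\in V^i_j$, $y\in V^i_r$ and $|j-r|>1$, then $xy$ is not an edge. An edge joining $V^i_j$ and $V^i_{j+1}$ for some $j$ has colour $i$ (an edge may have several colours), and $x\le_i y$ means $x\in V^i_j$, $y\in V^i_r$ with $j\le r$. A path of colour $i$ is a path $x_1,\dots,x_r$ such that, for every $j\in[r-1]$, $x_jx_{j+1}$ is an edge of colour $i$ and $x_j\le_i x_{j+1}$; it is a path of colour $i$ between $x$ and $y$ if $\{x_1,x_r\}=\{x,y\}$. Paths are internally vertex-disjoint if no internal vertex of one of them lies on another one. Theorem. There is an algorithm that, given a $k$-shortest graph $G$ with $n$ vertices (with its $k$ partitions), $l$ pairs of vertices $(s_1,t_1),\dots,(s_l,t_l)$ and a function $c:[l]\to[k]$, decides in time $n^{O(l^{5^k})}$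 whether there are pairwise internally vertex-disjoint paths $P_1,\dots,P_l$ such that, for every $i\in[l]$, $P_i$ is a path of colour $c(i)$ between $s_i$ and $t_i$. Here the algorithm and the constant in the $O$-notation do not depend on $n$, $k$, $l$ or the instance; precisely, a single random access machine program (with addition and truncated subtraction as its arithmetic operations, one step per operation) and a single constant $C$ exist such that the program makes at most $C\cdot n^{C\,l^{5^k}}$ steps. -/

import Mathlib

/-! ### Shortest graphs, coloured paths and the disjoint paths problem -/

/-- A `k`-shortest graph on the vertex set `V`: a graph together with `k` ordered partitions
`(V^i_0, …, V^i_{m_i - 1})` of `V` into non-empty parts, given by the maps `level i` sending a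
vertex to the index of its part, such that every edge joins two consecutive parts of at least one
of the partitions, and no edge joins two parts of the same partition whose indices differ by more
than one. -/
structure KShortestGraph (V : Type) (k : ℕ) where
  graph : SimpleGraph V
  numParts : Fin k → ℕ
  level : (i : Fin k) → V → Fin (numParts i)
  level_surjective : ∀ i, Function.Surjective (level i)
  exists_consecutive : ∀ x y, graph.Adj x y →
    ∃ i, (level i y : ℕ) = level i x + 1 ∨ (level i x : ℕ) = level i y + 1
  not_adj_of_far : ∀ i x y, 1 < |((level i x : ℕ) : ℤ) - ((level i y : ℕ) : ℤ)| →
    ¬ graph.Adj x y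

namespace KShortestGraph

variable {V : Type} {k : ℕ} (G : KShortestGraph V k)

/-- `xy` is an edge of colour `i`: it joins two consecutive parts of the `i`-th partition. -/
def IsColourEdge (i : Fin k) (x y : V) : Prop :=
  G.graph.Adj x y ∧
    ((G.level i y : ℕ) = G.level i x + 1 ∨ (G.level i x : ℕ) = G.level i y + 1)

/-- The order `x ≤_i y` defined by the `i`-th partition. -/
def ColourLE (i : Fin k) (x y : V) : Prop := G.level i x ≤ G.level i y

/-- The path `p`, traversed from `u` to `v`, is a path of colour `i`: all its edges have colour `i`
and are traversed in the direction of `≤_i`. -/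
def IsColourPath (i : Fin k) {u v : V} (p : G.graph.Walk u v) : Prop :=
  p.IsPath ∧ ∀ d ∈ p.darts, G.IsColourEdge i d.fst d.snd ∧ G.ColourLE i d.fst d.snd

/-- The `k`-DSP problem defined by `G`, the requests `(s j, t j)` and the colouring `c` of the
requests has a solution: there are paths `P j` between `s j` and `t j`, each being (in one of its
two directions) a path of colour `c j`, that are pairwise internally vertex-disjoint, i.e. no
internal vertex of one of them lies on another one. -/
def HasDSPSolution {l : ℕ} (s t : Fin l → V) (c : Fin l → Fin k) : Prop :=
  ∃ P : (j : Fin l) → G.graph.Walk (s j) (t j),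
    (∀ j, G.IsColourPath (c j) (P j) ∨ G.IsColourPath (c j) (P j).reverse) ∧
    ∀ i j, i ≠ j → ∀ x ∈ (P i).support, x ≠ s i → x ≠ t i → x ∉ (P j).support

end KShortestGraph

/-! ### Random access machines

Programs of a random access machine with a read-only input array, registers and a working memory,
all holding natural numbers.  The arithmetic operations are addition and truncated subtraction
only, so that counting one step per operation is polynomially related to Turing machine time. -/

namespace RAM

/-- Programs; register numbers and constants are fixed in the program text. -/
inductive Prog : Type
  /-- `R[d] := m` -/
  | const (d m : ℕ) : Prog
  /-- `R[d] := R[a] + R[b]` -/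
  | add (d a b : ℕ) : Prog
  /-- `R[d] := R[a] - R[b]` (truncated at zero) -/
  | sub (d a b : ℕ) : Prog
  /-- `R[d] := input[R[a]]` -/
  | read (d a : ℕ) : Prog
  /-- `R[d] := M[R[a]]` -/
  | load (d a : ℕ) : Prog
  /-- `M[R[a]] := R[b]` -/
  | store (a b : ℕ) : Prog
  /-- first `p`, then `q` -/
  | seq (p q : Prog) : Prog
  /-- if `R[a] ≠ 0` then `p` else `q` -/
  | cond (a : ℕ) (p q : Prog) : Prog
  /-- while `R[a] ≠ 0` do `p` -/
  | loop (a : ℕ) (p : Prog) : Prog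

/-- The contents of the registers and of the working memory. -/
structure State where
  reg : ℕ → ℕ
  mem : ℕ → ℕ

/-- Initially all registers and all memory cells hold `0`. -/
def State.init : State := ⟨fun _ => 0, fun _ => 0⟩

/-- The state after writing `m` into register `d`. -/
def State.setReg (σ : State) (d m : ℕ) : State := ⟨Function.update σ.reg d m, σ.mem⟩

/-- The state after writing `m` into memory cell `a`. -/
def State.setMem (σ : State) (a m : ℕ) : State := ⟨σ.reg, Function.update σ.mem a m⟩

/-- `Exec inp p σ T τ`: on the input array `inp`, the program `p` started in the state `σ` halts
after exactly `T` steps in the state `τ`.  Each elementary operation and each test of a branch or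
of a loop is one step. -/
inductive Exec (inp : ℕ → ℕ) : Prog → State → ℕ → State → Prop
  | const (d m : ℕ) (σ : State) : Exec inp (.const d m) σ 1 (σ.setReg d m)
  | add (d a b : ℕ) (σ : State) : Exec inp (.add d a b) σ 1 (σ.setReg d (σ.reg a + σ.reg b))
  | sub (d a b : ℕ) (σ : State) : Exec inp (.sub d a b) σ 1 (σ.setReg d (σ.reg a - σ.reg b))
  | read (d a : ℕ) (σ : State) : Exec inp (.read d a) σ 1 (σ.setReg d (inp (σ.reg a)))
  | load (d a : ℕ) (σ : State) : Exec inp (.load d a) σ 1 (σ.setReg d (σ.mem (σ.reg a)))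
  | store (a b : ℕ) (σ : State) : Exec inp (.store a b) σ 1 (σ.setMem (σ.reg a) (σ.reg b))
  | seq {p q : Prog} {σ τ ρ : State} {T₁ T₂ : ℕ} :
      Exec inp p σ T₁ τ → Exec inp q τ T₂ ρ → Exec inp (.seq p q) σ (T₁ + T₂) ρ
  | cond_true {a : ℕ} {p q : Prog} {σ τ : State} {T : ℕ} :
      σ.reg a ≠ 0 → Exec inp p σ T τ → Exec inp (.cond a p q) σ (T + 1) τ
  | cond_false {a : ℕ} {p q : Prog} {σ τ : State} {T : ℕ} :
      σ.reg a = 0 → Exec inp q σ T τ → Exec inp (.cond a p q) σ (T + 1) τ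
  | loop_done {a : ℕ} {p : Prog} {σ : State} :
      σ.reg a = 0 → Exec inp (.loop a p) σ 1 σ
  | loop_step {a : ℕ} {p : Prog} {σ τ ρ : State} {T₁ T₂ : ℕ} :
      σ.reg a ≠ 0 → Exec inp p σ T₁ τ → Exec inp (.loop a p) τ T₂ ρ →
      Exec inp (.loop a p) σ (T₁ + T₂ + 1) ρ

/-- On the input `w` (followed by zeros), the program `p` halts within `T` steps and answers the
question whether `Q` holds: register `0` finally holds `1` if `Q` is true and `0` otherwise. -/
def DecidesWithin (p : Prog) (w : List ℕ) (T : ℕ) (Q : Prop) : Prop :=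
  ∃ T' ≤ T, ∃ τ : State, Exec (fun j => w.getD j 0) p State.init T' τ ∧
    (Q → τ.reg 0 = 1) ∧ (¬ Q → τ.reg 0 = 0)

end RAM

open Classical in
/-- The encoding of an instance of the `k`-DSP problem with vertex set `{0, …, n - 1}`: the numbers
`n`, `k`, `l`, the adjacency matrix row by row, the lists of the sources, of the targets and of the
colours of the requests, and for each of the `k` partitions the list of the part indices of all
vertices. -/
noncomputable def encodeDSP {n k l : ℕ} (G : KShortestGraph (Fin n) k) (s t : Fin l → Fin n)
    (c : Fin l → Fin k) : List ℕ :=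
  [n, k, l] ++
  List.ofFn (fun j : Fin (n * n) => if G.graph.Adj j.divNat j.modNat then 1 else 0) ++
  List.ofFn (fun j => (s j : ℕ)) ++
  List.ofFn (fun j => (t j : ℕ)) ++
  List.ofFn (fun j => (c j : ℕ)) ++
  List.ofFn (fun j : Fin (k * n) => (G.level j.divNat j.modNat : ℕ))

/-! Along a path of colour `i` the level of colour `i` rises by one per edge, while every other
level changes by at most one. If two stretches of paths both change the level of the same colour `r`
by exactly one per step, they can be swept simultaneously: at time `τ` a pebble on each stands at
the vertex of `r`-level `τ`. A common vertex `x` is then occupied by both pebbles at the same time,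
namely its `r`-level. So `r` serves as a common clock, and disjointness can be checked from the
current pebble positions alone, with no record of the vertices already visited.

The combinatorial heart is `PathSystem.exists_cuts`: the paths of a solution can be cut at no more
than `4 * l ^ (2 * k)` places each, and every piece given a clock, so that pieces of different paths
with different clocks cannot meet for reasons visible in the levels of their ends. For two paths
`a`, `b` take the sum and the difference of their levels as plane coordinates. One path is then
monotone in both coordinates, the other monotone in one and antitone in the other. By
`exists_cut_pair`, two cuts on each confine common points of boxes to one axis-parallel line, that
is, to a relation `L_a = ± L_b + d`. The relations that hold at a vertex `x` make the colours into a
graph. The component of the colour of `a` is determined by the compositions of at most `k`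
relations, of which there are at most `l ^ (2 * k)`. For each composition `L_a = e * L_j + d` the
function `L_a - e * L_j` is monotone along `a`, so two more cuts make its truth constant on the box
of every piece. Now the component is constant on each box, and pieces of different paths with
intersecting boxes have the same component. A clock chosen as a function of the component therefore
agrees on them, and being linked to `a` by signs `±1` it changes by one per step.

Conversely, guessed ends, clocks and pebble moves obeying these local rules (`IsCertificate`)
assemble to a solution (`hasDSPSolution`). A sequence of adjacent vertices whose length equals the
net gain of a level must climb at every step, so each assembled walk is automatically a path of the
right colour, and pieces of one path need not be compared with each other.

Levels are smaller than `n`, hence a certificate is a sequence of `n` configurations, each coded by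
`4 * l * J` digits in base `n + l + 1`, where `J = 8 * l ^ (2 * k)`. Reachability between
configurations is settled by filling a table over all times and codes. The transition rule is a
formula with bounded quantifiers, and every such formula is evaluated in time polynomial in a bound
on its variables and on the memory (`Fm.exists_polyTime`). The total is a fixed power of the number
of codes, and `2 * k + 2 ≤ 5 ^ k` yields the stated bound. -/

namespace RAM

/-! ### Total correctness with a time bound -/

/-- The program `p` started in `σ` halts within `T` steps in a state satisfying `Q`. -/
def Halts (inp : ℕ → ℕ) (p : Prog) (σ : State) (T : ℕ) (Q : State → Prop) : Prop :=
  ∃ T' ≤ T, ∃ τ, Exec inp p σ T' τ ∧ Q τ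

variable {inp : ℕ → ℕ}

theorem Halts.mono {p : Prog} {σ : State} {T T' : ℕ} {Q Q' : State → Prop}
    (h : Halts inp p σ T Q) (hT : T ≤ T') (hQ : ∀ τ, Q τ → Q' τ) : Halts inp p σ T' Q' := by
  obtain ⟨t, ht, τ, he, hq⟩ := h
  exact ⟨t, ht.trans hT, τ, he, hQ τ hq⟩

theorem Halts.seq {p q : Prog} {σ : State} {T₁ T₂ : ℕ} {Q : State → Prop}
    (h : Halts inp p σ T₁ fun τ => Halts inp q τ T₂ Q) : Halts inp (.seq p q) σ (T₁ + T₂) Q := by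
  obtain ⟨t, ht, τ, he, t', ht', τ', he', hq⟩ := h
  exact ⟨t + t', by omega, τ', .seq he he', hq⟩

theorem Halts.seq' {p q : Prog} {σ : State} {T₁ T₂ : ℕ} {Q R : State → Prop}
    (h : Halts inp p σ T₁ R) (h' : ∀ τ, R τ → Halts inp q τ T₂ Q) :
    Halts inp (.seq p q) σ (T₁ + T₂) Q :=
  .seq (h.mono le_rfl h')

theorem Halts.const {d m : ℕ} {σ : State} {Q : State → Prop} (h : Q (σ.setReg d m)) :
    Halts inp (.const d m) σ 1 Q := ⟨1, le_rfl, _, .const d m σ, h⟩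

theorem Halts.add {d a b : ℕ} {σ : State} {Q : State → Prop}
    (h : Q (σ.setReg d (σ.reg a + σ.reg b))) :
    Halts inp (.add d a b) σ 1 Q := ⟨1, le_rfl, _, .add d a b σ, h⟩

theorem Halts.sub {d a b : ℕ} {σ : State} {Q : State → Prop}
    (h : Q (σ.setReg d (σ.reg a - σ.reg b))) :
    Halts inp (.sub d a b) σ 1 Q := ⟨1, le_rfl, _, .sub d a b σ, h⟩

theorem Halts.read {d a : ℕ} {σ : State} {Q : State → Prop}
    (h : Q (σ.setReg d (inp (σ.reg a)))) :
    Halts inp (.read d a) σ 1 Q := ⟨1, le_rfl, _, .read d a σ, h⟩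

theorem Halts.load {d a : ℕ} {σ : State} {Q : State → Prop}
    (h : Q (σ.setReg d (σ.mem (σ.reg a)))) :
    Halts inp (.load d a) σ 1 Q := ⟨1, le_rfl, _, .load d a σ, h⟩

theorem Halts.store {a b : ℕ} {σ : State} {Q : State → Prop}
    (h : Q (σ.setMem (σ.reg a) (σ.reg b))) :
    Halts inp (.store a b) σ 1 Q := ⟨1, le_rfl, _, .store a b σ, h⟩

theorem Halts.cond {a : ℕ} {p q : Prog} {σ : State} {T : ℕ} {Q : State → Prop}
    (h₁ : σ.reg a ≠ 0 → Halts inp p σ T Q) (h₂ : σ.reg a = 0 → Halts inp q σ T Q) :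
    Halts inp (.cond a p q) σ (T + 1) Q := by
  by_cases h : σ.reg a = 0
  · obtain ⟨t, ht, τ, he, hq⟩ := h₂ h
    exact ⟨t + 1, by omega, τ, .cond_false h he, hq⟩
  · obtain ⟨t, ht, τ, he, hq⟩ := h₁ h
    exact ⟨t + 1, by omega, τ, .cond_true h he, hq⟩

/-- A loop whose invariant `I i` determines the number `i` of remaining rounds. -/
theorem Halts.loop {a : ℕ} {p : Prog} {T : ℕ} (I : ℕ → State → Prop)
    (h₀ : ∀ σ, I 0 σ → σ.reg a = 0) (h₁ : ∀ i σ, I (i + 1) σ → σ.reg a ≠ 0)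
    (hstep : ∀ i σ, I (i + 1) σ → Halts inp p σ T (I i)) :
    ∀ i σ, I i σ → Halts inp (.loop a p) σ (i * (T + 1) + 1) (I 0) := by
  intro i
  induction i with
  | zero => exact fun σ h => ⟨1, by omega, σ, .loop_done (h₀ σ h), h⟩
  | succ i ih =>
    intro σ h
    obtain ⟨t, ht, τ, he, hq⟩ := hstep i σ h
    obtain ⟨t', ht', τ', he', hq'⟩ := ih τ hq
    exact ⟨t + t' + 1, by rw [Nat.succ_mul]; omega, τ', .loop_step (h₁ i σ h) he he', hq'⟩

@[simp] theorem State.setReg_mem (σ : State) (d m : ℕ) : (σ.setReg d m).mem = σ.mem := rfl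

@[simp] theorem State.setMem_reg (σ : State) (d m : ℕ) : (σ.setMem d m).reg = σ.reg := rfl

@[simp] theorem State.setReg_reg (σ : State) (d m j : ℕ) :
    (σ.setReg d m).reg j = if j = d then m else σ.reg j := by
  simp [State.setReg, Function.update_apply]

@[simp] theorem State.setMem_mem (σ : State) (d m j : ℕ) :
    (σ.setMem d m).mem j = if j = d then m else σ.mem j := by
  simp [State.setMem, Function.update_apply]

/-- `τ` arises from `σ` by writing `v` into register `d` and changing registers after `d` only. -/
def Writes (σ : State) (d v : ℕ) (τ : State) : Prop :=
  τ.reg d = v ∧ (∀ j < d, τ.reg j = σ.reg j) ∧ τ.mem = σ.mem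

/-! ### Arithmetic terms -/

/-- Arithmetic terms over registers, the working memory and the input. -/
inductive Tm : Type
  | var (x : ℕ) : Tm
  | const (m : ℕ) : Tm
  | add (a b : Tm) : Tm
  | sub (a b : Tm) : Tm
  | mul (a b : Tm) : Tm
  /-- the digit at position `i` of `y` in base `b + 1` -/
  | digit (b y i : Tm) : Tm
  /-- the minimum of `c` and `input[v + w * input[e]]` -/
  | lookup (c e w v : Tm) : Tm
  | load (a : Tm) : Tm

/-- The digit at position `i` of `y` in base `b`. -/
def digit (b y i : ℕ) : ℕ := y / b ^ i % b

namespace Tm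

/-- The value of a term. -/
def eval (inp mem reg : ℕ → ℕ) : Tm → ℕ
  | var x => reg x
  | const m => m
  | add a b => a.eval inp mem reg + b.eval inp mem reg
  | sub a b => a.eval inp mem reg - b.eval inp mem reg
  | mul a b => a.eval inp mem reg * b.eval inp mem reg
  | digit b y i => RAM.digit (b.eval inp mem reg + 1) (y.eval inp mem reg) (i.eval inp mem reg)
  | lookup c e w v => min (c.eval inp mem reg)
      (inp (v.eval inp mem reg + w.eval inp mem reg * inp (e.eval inp mem reg)))
  | load a => mem (a.eval inp mem reg)

/-- All variables of a term are smaller than this number. -/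
def bd : Tm → ℕ
  | var x => x + 1
  | const _ => 0
  | add a b => max a.bd b.bd
  | sub a b => max a.bd b.bd
  | mul a b => max a.bd b.bd
  | digit b y i => max b.bd (max y.bd i.bd)
  | lookup c e w v => max (max c.bd e.bd) (max w.bd v.bd)
  | load a => a.bd

theorem eval_congr {mem reg reg' : ℕ → ℕ} (t : Tm) (h : ∀ j < t.bd, reg' j = reg j) :
    t.eval inp mem reg' = t.eval inp mem reg := by
  induction t with
  | var x => exact h x (Nat.lt_succ_self x)
  | const m => rfl
  | add a b iha ihb | sub a b iha ihb | mul a b iha ihb =>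
    simp only [bd, lt_sup_iff] at h
    simp only [eval, iha fun j hj => h j (.inl hj), ihb fun j hj => h j (.inr hj)]
  | digit b y i ihb ihy ihi =>
    simp only [bd, lt_sup_iff] at h
    simp only [eval, ihb fun j hj => h j (.inl hj), ihy fun j hj => h j (.inr (.inl hj)),
      ihi fun j hj => h j (.inr (.inr hj))]
  | lookup c e w v ihc ihe ihw ihv =>
    simp only [bd, lt_sup_iff] at h
    simp only [eval, ihc fun j hj => h j (.inl (.inl hj)), ihe fun j hj => h j (.inl (.inr hj)),
      ihw fun j hj => h j (.inr (.inl hj)), ihv fun j hj => h j (.inr (.inr hj))]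
  | load a iha => simp only [eval, iha h]

end Tm

/-- `R[d + 2] += R[d] * R[d + 1]`, counting `R[d]` down; `R[d + 3]` must be `1`. -/
def mulLoop (d : ℕ) : Prog :=
  .loop d (.seq (.add (d + 2) (d + 2) (d + 1)) (.sub d d (d + 3)))

theorem halts_mulLoop (d : ℕ) (σ : State) (h : σ.reg (d + 3) = 1) :
    Halts inp (mulLoop d) σ (σ.reg d * 3 + 1) fun τ =>
      τ.reg d = 0 ∧ τ.reg (d + 2) = σ.reg (d + 2) + σ.reg d * σ.reg (d + 1) ∧
      (∀ j, j ≠ d → j ≠ d + 2 → τ.reg j = σ.reg j) ∧ τ.mem = σ.mem := by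
  let I : ℕ → State → Prop := fun i τ => i ≤ σ.reg d ∧ τ.reg d = i ∧
    τ.reg (d + 2) = σ.reg (d + 2) + (σ.reg d - i) * σ.reg (d + 1) ∧
    (∀ j, j ≠ d → j ≠ d + 2 → τ.reg j = σ.reg j) ∧ τ.mem = σ.mem
  refine (Halts.loop (T := 1 + 1) I (fun τ h => h.2.1) (fun i τ h => by have := h.2.1; omega)
    ?_ (σ.reg d) σ ?_).mono (by omega) ?_
  · rintro i τ ⟨hi, h1, h2, h3, h4⟩
    refine .seq (.add (.sub ⟨by omega, ?_, ?_, ?_, h4⟩))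
    · simp [h1, h3, h]
    · have : σ.reg d - i = (σ.reg d - (i + 1)) + 1 := by omega
      simp [h2, h3, this, Nat.succ_mul]; ring
    · intro j hj hj'
      simp [hj, hj', h3]
  · exact ⟨le_rfl, rfl, by simp, fun _ _ _ => rfl, rfl⟩
  · rintro τ ⟨h1, h2, h3, h4, h5⟩
    exact ⟨h2, by simpa using h3, h4, h5⟩

/-- Divides `R[d + 1]` by `R[d]`: the remainder is left in `R[d + 1]`, the quotient added to
`R[d + 4]`; `R[d + 5]` must be `R[d + 1] + 1 - R[d]` and `R[d + 3]` must be `1`. -/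
def divLoop (d : ℕ) : Prog :=
  .loop (d + 5) (.seq (.sub (d + 1) (d + 1) d) (.seq (.add (d + 4) (d + 4) (d + 3))
    (.seq (.add (d + 5) (d + 1) (d + 3)) (.sub (d + 5) (d + 5) d))))

/-- The guard `R[d + 1] + 1 - R[d]` is nonzero exactly while the divisor still fits. The number of
remaining rounds is the quotient of the current remainder, which is the index of the invariant. -/
theorem halts_divLoop (d : ℕ) (σ : State) (h : σ.reg (d + 3) = 1) (hb : 0 < σ.reg d)
    (hf : σ.reg (d + 5) = σ.reg (d + 1) + 1 - σ.reg d) :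
    Halts inp (divLoop d) σ (σ.reg (d + 1) * 5 + 1) fun τ =>
      τ.reg (d + 1) = σ.reg (d + 1) % σ.reg d ∧
      τ.reg (d + 4) = σ.reg (d + 4) + σ.reg (d + 1) / σ.reg d ∧ τ.reg (d + 5) = 0 ∧
      (∀ j, j ≠ d + 1 → j ≠ d + 4 → j ≠ d + 5 → τ.reg j = σ.reg j) ∧ τ.mem = σ.mem := by
  let I : ℕ → State → Prop := fun i τ => τ.reg (d + 1) / σ.reg d = i ∧
    τ.reg (d + 1) % σ.reg d = σ.reg (d + 1) % σ.reg d ∧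
    τ.reg (d + 4) + i = σ.reg (d + 4) + σ.reg (d + 1) / σ.reg d ∧
    τ.reg (d + 5) = τ.reg (d + 1) + 1 - σ.reg d ∧
    (∀ j, j ≠ d + 1 → j ≠ d + 4 → j ≠ d + 5 → τ.reg j = σ.reg j) ∧ τ.mem = σ.mem
  refine (Halts.loop (T := 1 + (1 + (1 + 1))) I ?_ ?_
    ?_ (σ.reg (d + 1) / σ.reg d) σ ?_).mono ?_ ?_
  · rintro τ ⟨h1, h2, h3, h4, h5, h6⟩
    have := (Nat.div_eq_zero_iff_lt hb).1 h1
    omega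
  · rintro i τ ⟨h1, h2, h3, h4, h5, h6⟩ h0
    rw [Nat.div_eq_of_lt (by omega)] at h1
    omega
  · rintro i τ ⟨h1, h2, h3, h4, h5, h6⟩
    have hle : σ.reg d ≤ τ.reg (d + 1) := by
      by_contra hlt
      rw [Nat.div_eq_of_lt (by omega)] at h1
      omega
    have hd : τ.reg d = σ.reg d := h5 _ (by omega) (by omega) (by omega)
    have h3' : τ.reg (d + 3) = 1 := by rw [h5 _ (by omega) (by omega) (by omega), h]
    refine .seq (.sub (.seq (.add (.seq (.add (.sub ⟨?_, ?_, ?_, ?_, ?_, h6⟩))))))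
    · simp [hd, h3']
      have := Nat.div_eq_sub_div hb hle
      omega
    · simp [hd, h3', ← h2, Nat.mod_eq_sub_mod hle]
    · simp [hd, h3']; omega
    · simp [hd, h3']
    · intro j h1 h2 h3
      simp [h1, h2, h3, h5]
  · exact ⟨rfl, rfl, rfl, hf, fun _ _ _ _ => rfl, rfl⟩
  · have := Nat.div_le_self (σ.reg (d + 1)) (σ.reg d)
    omega
  · rintro τ ⟨h1, h2, h3, h4, h5, h6⟩
    have hlt := (Nat.div_eq_zero_iff_lt hb).1 h1
    refine ⟨?_, h3, by omega, h5, h6⟩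
    rwa [Nat.mod_eq_of_lt hlt] at h2

/-- Divides `R[d + 1]` by `R[d]` as often as `R[d + 2]` says, leaving the last remainder in
`R[d + 6]`; `R[d + 3]` must be `1`. -/
def digitLoop (d : ℕ) : Prog :=
  .loop (d + 2) (.seq (.const (d + 4) 0) (.seq (.add (d + 5) (d + 1) (d + 3))
    (.seq (.sub (d + 5) (d + 5) d) (.seq (divLoop d) (.seq (.add (d + 6) (d + 1) (d + 5))
      (.seq (.const (d + 1) 0) (.seq (.add (d + 1) (d + 1) (d + 4))
        (.sub (d + 2) (d + 2) (d + 3)))))))))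

/-- After `r` divisions the running quotient is `y / b ^ r` and the last remainder is the digit at
position `r - 1`. The quotient never exceeds `y`, which bounds the time of each division. -/
theorem halts_digitLoop (d : ℕ) (σ : State) (h : σ.reg (d + 3) = 1) (hb : 0 < σ.reg d)
    (hc : 0 < σ.reg (d + 2)) :
    Halts inp (digitLoop d) σ (σ.reg (d + 2) * (σ.reg (d + 1) * 5 + 9) + 1) fun τ =>
      τ.reg (d + 6) = digit (σ.reg d) (σ.reg (d + 1)) (σ.reg (d + 2) - 1) ∧
      (∀ j ≤ d, τ.reg j = σ.reg j) ∧ τ.mem = σ.mem := by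
  set b := σ.reg d with hbd
  set y := σ.reg (d + 1) with hy
  set c := σ.reg (d + 2) with hcd
  let I : ℕ → State → Prop := fun i τ => i ≤ c ∧ τ.reg (d + 2) = i ∧ τ.reg (d + 3) = 1 ∧
    τ.reg (d + 1) = y / b ^ (c - i) ∧ (i < c → τ.reg (d + 6) = digit b y (c - i - 1)) ∧
    (∀ j ≤ d, τ.reg j = σ.reg j) ∧ τ.mem = σ.mem
  refine (Halts.loop (T := 1 + (1 + (1 + ((y * 5 + 1) + (1 + (1 + (1 + 1))))))) I ?_ ?_
    ?_ c σ ?_).mono (by ring_nf; omega) ?_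
  · exact fun τ h => h.2.1
  · exact fun i τ h => by have := h.2.1; omega
  · rintro i τ ⟨hi, h2, h3, h1, h6, hj, hm⟩
    have hd : τ.reg d = b := hj d le_rfl
    refine .seq (.const (.seq (.add (.seq (.sub (.seq' (R := fun ρ =>
        ρ.reg (d + 1) = τ.reg (d + 1) % b ∧ ρ.reg (d + 4) = τ.reg (d + 1) / b ∧
        ρ.reg (d + 5) = 0 ∧ (∀ j, j ≠ d + 1 → j ≠ d + 4 → j ≠ d + 5 → ρ.reg j = τ.reg j) ∧
        ρ.mem = τ.mem) ?_ ?_))))))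
    · refine (halts_divLoop d _ ?_ ?_ ?_).mono ?_ ?_
      · simp [h3]
      · simpa [hd] using hb
      · simp [hd, h3]
      · simp [h1, Nat.div_le_self]
      · rintro ρ ⟨r1, r2, r3, r4, r5⟩
        refine ⟨by simpa [hd] using r1, by simpa [hd] using r2, r3, fun j j1 j2 j3 => ?_, r5⟩
        rw [r4 j j1 j2 j3]
        simp [j2, j3]
    · rintro ρ ⟨r1, r2, r3, r4, r5⟩
      have e : c - i = (c - (i + 1)) + 1 := by omega
      refine .seq (.add (.seq (.const (.seq (.add (.sub ⟨by omega, ?_, ?_, ?_, ?_, ?_, ?_⟩))))))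
      · simp [r4, h2, h3]
      · simp [r4, h3]
      · simp [r2, h1]
        rw [Nat.div_div_eq_div_mul, ← pow_succ, ← e]
      · intro _
        simp [r1, r3, h1]
        rw [digit, show c - (i + 1) = c - i - 1 by omega]
      · intro j hjd
        have e1 : j ≠ d + 1 := by omega
        have e2 : j ≠ d + 2 := by omega
        have e3 : j ≠ d + 4 := by omega
        have e4 : j ≠ d + 5 := by omega
        have e5 : j ≠ d + 6 := by omega
        simp [e1, e2, e3, e4, e5, r4, hj j hjd]
      · simp [r5, hm]
  · exact ⟨le_rfl, rfl, h, by simp [hy], fun h => (lt_irrefl _ h).elim, fun _ _ => rfl, rfl⟩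
  · rintro τ ⟨h1, h2, h3, h4, h5, h6, h7⟩
    exact ⟨by simpa using h5 hc, h6, h7⟩

/-- `R[d + 3] += R[d + 2] * R[d + 1]`, counting `R[d + 2]` down; `R[d + 4]` must be `1`. -/
def lookupLoop (d : ℕ) : Prog :=
  .loop (d + 2) (.seq (.add (d + 3) (d + 3) (d + 1)) (.sub (d + 2) (d + 2) (d + 4)))

/-- The factor counted down is `R[d + 2]`, not the one read from the input. The time thus stays
bounded however large the input entry is. -/
theorem halts_lookupLoop (d : ℕ) (σ : State) (h : σ.reg (d + 4) = 1) :
    Halts inp (lookupLoop d) σ (σ.reg (d + 2) * 3 + 1) fun τ =>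
      τ.reg (d + 3) = σ.reg (d + 3) + σ.reg (d + 2) * σ.reg (d + 1) ∧
      (∀ j ≤ d, τ.reg j = σ.reg j) ∧ τ.mem = σ.mem := by
  let I : ℕ → State → Prop := fun i τ => i ≤ σ.reg (d + 2) ∧ τ.reg (d + 2) = i ∧
    τ.reg (d + 3) = σ.reg (d + 3) + (σ.reg (d + 2) - i) * σ.reg (d + 1) ∧
    (∀ j, j ≠ d + 2 → j ≠ d + 3 → τ.reg j = σ.reg j) ∧ τ.mem = σ.mem
  refine (Halts.loop (T := 1 + 1) I (fun τ h => h.2.1) (fun i τ h => by have := h.2.1; omega)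
    ?_ (σ.reg (d + 2)) σ ?_).mono (by omega) ?_
  · rintro i τ ⟨hi, h1, h2, h3, h4⟩
    refine .seq (.add (.sub ⟨by omega, ?_, ?_, ?_, h4⟩))
    · simp [h1, h3, h]
    · have : σ.reg (d + 2) - i = (σ.reg (d + 2) - (i + 1)) + 1 := by omega
      simp [h2, h3, this, Nat.succ_mul]; ring
    · intro j hj hj'
      simp [hj, hj', h3]
  · exact ⟨le_rfl, rfl, by simp, fun _ _ _ => rfl, rfl⟩
  · rintro τ ⟨h1, h2, h3, h4, h5⟩
    exact ⟨by simpa using h3, fun j hj => h4 j (by omega) (by omega), h5⟩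

end RAM

/-! ### Evaluation of arithmetic terms in polynomial time -/

namespace RAM

variable {inp : ℕ → ℕ}

namespace Tm

/-- The program evaluating a term into register `d`, with the registers after `d` as scratch. -/
def comp : Tm → ℕ → Prog
  | var x, d => .seq (.const d 0) (.add d x d)
  | const m, d => .const d m
  | add a b, d => .seq (a.comp d) (.seq (b.comp (d + 1)) (.add d d (d + 1)))
  | sub a b, d => .seq (a.comp d) (.seq (b.comp (d + 1)) (.sub d d (d + 1)))
  | mul a b, d => .seq (a.comp d) (.seq (b.comp (d + 1)) (.seq (.const (d + 2) 0)
      (.seq (.const (d + 3) 1) (.seq (mulLoop d) (.add d d (d + 2))))))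
  | digit b y i, d => .seq (b.comp d) (.seq (y.comp (d + 1)) (.seq (i.comp (d + 2))
      (.seq (.const (d + 3) 1) (.seq (.add d d (d + 3)) (.seq (.add (d + 2) (d + 2) (d + 3))
      (.seq (digitLoop d) (.seq (.const d 0) (.add d d (d + 6)))))))))
  | lookup c e w v, d => .seq (c.comp d) (.seq (e.comp (d + 1)) (.seq (w.comp (d + 2))
      (.seq (v.comp (d + 3)) (.seq (.const (d + 4) 1) (.seq (.read (d + 1) (d + 1))
      (.seq (lookupLoop d) (.seq (.read (d + 3) (d + 3)) (.seq (.sub (d + 4) d (d + 3))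
      (.sub d d (d + 4))))))))))
  | load a, d => .seq (a.comp d) (.load d d)

/-- Under bounds `X` on the variables and the memory, a term is evaluated in polynomial time and
has a polynomially bounded value. -/
def PolyTime (t : Tm) (K : ℕ) : Prop :=
  ∀ (inp : ℕ → ℕ) (X : ℕ) (σ : State), 2 ≤ X → (∀ j < t.bd, σ.reg j ≤ X) → (∀ a, σ.mem a ≤ X) →
    t.eval inp σ.mem σ.reg ≤ X ^ K ∧ ∀ d, t.bd ≤ d →
      Halts inp (t.comp d) σ (X ^ K) (Writes σ d (t.eval inp σ.mem σ.reg))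

theorem pow_le_pow_sum {X a b : ℕ} (hX : 2 ≤ X) (h : a ≤ b) : X ^ a ≤ X ^ b :=
  Nat.pow_le_pow_right (by omega) h

/-- Evaluating a term after another one has been evaluated below. -/
theorem PolyTime.after {t : Tm} {K : ℕ} (h : t.PolyTime K) {X : ℕ} {σ τ : State}
    (hX : 2 ≤ X) {d : ℕ} (hd : t.bd ≤ d) (hreg : ∀ j < t.bd, σ.reg j ≤ X)
    (hmem : ∀ a, σ.mem a ≤ X) (hτ : ∀ j < d, τ.reg j = σ.reg j) (hτm : τ.mem = σ.mem)
    {d' : ℕ} (hdd : d ≤ d') :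
    Halts inp (t.comp d') τ (X ^ K) (Writes τ d' (t.eval inp σ.mem σ.reg)) := by
  have hr : ∀ j < t.bd, τ.reg j = σ.reg j := fun j hj => hτ j (by omega)
  have := (h inp X τ hX (fun j hj => by rw [hr j hj]; exact hreg j hj)
    (fun a => by rw [hτm]; exact hmem a)).2 d' (by omega)
  rwa [eval_congr t hr, hτm] at this

theorem PolyTime.var (x : ℕ) : (var x).PolyTime 1 := by
  intro inp X σ hX hreg hmem
  have := hreg x (Nat.lt_succ_self x)
  refine ⟨by simpa [eval] using this, fun d hd => ?_⟩
  simp only [bd] at hd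
  refine (Halts.seq (.const (.add ⟨?_, ?_, rfl⟩))).mono (by simpa using hX) fun _ h => h
  · have : x ≠ d := by omega
    simp [eval, this]
  · intro j hj
    have : j ≠ d := by omega
    simp [this]

theorem PolyTime.const (m : ℕ) : (const m).PolyTime (m + 1) := by
  intro inp X σ hX hreg hmem
  have h1 : m < 2 ^ m := Nat.lt_two_pow_self
  have h2 : 2 ^ m ≤ X ^ m := Nat.pow_le_pow_left hX m
  have h3 : X ^ m ≤ X ^ (m + 1) := pow_le_pow_sum hX (by omega)
  refine ⟨by simp only [eval]; omega, fun d hd => ?_⟩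
  refine (Halts.const ⟨?_, ?_, rfl⟩).mono (by omega) fun _ h => h
  · simp [eval]
  · intro j hj
    have : j ≠ d := by omega
    simp [this]

theorem PolyTime.add {a b : Tm} {K L : ℕ} (ha : a.PolyTime K) (hb : b.PolyTime L) :
    (add a b).PolyTime (K + L + 3) := by
  intro inp X σ hX hreg hmem
  simp only [bd, lt_sup_iff] at hreg
  obtain ⟨ea, ra⟩ := ha inp X σ hX (fun j hj => hreg j (.inl hj)) hmem
  obtain ⟨eb, -⟩ := hb inp X σ hX (fun j hj => hreg j (.inr hj)) hmem
  have hK : 1 ≤ X ^ K := Nat.one_le_pow _ _ (by omega)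
  have hL : 1 ≤ X ^ L := Nat.one_le_pow _ _ (by omega)
  -- As `2 ≤ X`, a constant factor is absorbed by a few additional powers of `X`; this explains the
  -- numerals in all the exponents.
  have h3 : 2 ^ 3 ≤ X ^ 3 := Nat.pow_le_pow_left hX 3
  have hB : X ^ K + (X ^ L + 1) ≤ X ^ (K + L + 3) := by
    rw [pow_add, pow_add]
    calc _ ≤ X ^ K * X ^ L * 2 ^ 3 := by nlinarith
      _ ≤ _ := by gcongr
  refine ⟨by simp only [eval]; omega, fun d hd => ?_⟩
  simp only [bd, sup_le_iff] at hd
  refine (Halts.seq' (ra d hd.1) fun τ hτ => .seq' (hb.after hX hd.2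
    (fun j hj => hreg j (.inr hj)) hmem hτ.2.1 hτ.2.2 (Nat.le_succ d)) fun ρ hρ =>
      .add ⟨?_, ?_, ?_⟩).mono hB fun _ h => h
  · simp [hρ.1, hρ.2.1 d (Nat.lt_succ_self d), hτ.1, eval]
  · intro j hj
    have : j ≠ d := by omega
    simp [this, hρ.2.1 j (by omega), hτ.2.1 j hj]
  · simp [hρ.2.2, hτ.2.2]

theorem PolyTime.sub {a b : Tm} {K L : ℕ} (ha : a.PolyTime K) (hb : b.PolyTime L) :
    (sub a b).PolyTime (K + L + 3) := by
  intro inp X σ hX hreg hmem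
  simp only [bd, lt_sup_iff] at hreg
  obtain ⟨ea, ra⟩ := ha inp X σ hX (fun j hj => hreg j (.inl hj)) hmem
  have hK : 1 ≤ X ^ K := Nat.one_le_pow _ _ (by omega)
  have hL : 1 ≤ X ^ L := Nat.one_le_pow _ _ (by omega)
  have h3 : 2 ^ 3 ≤ X ^ 3 := Nat.pow_le_pow_left hX 3
  have hB : X ^ K + (X ^ L + 1) ≤ X ^ (K + L + 3) := by
    rw [pow_add, pow_add]
    calc _ ≤ X ^ K * X ^ L * 2 ^ 3 := by nlinarith
      _ ≤ _ := by gcongr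
  refine ⟨by simp only [eval]; omega, fun d hd => ?_⟩
  simp only [bd, sup_le_iff] at hd
  refine (Halts.seq' (ra d hd.1) fun τ hτ => .seq' (hb.after hX hd.2
    (fun j hj => hreg j (.inr hj)) hmem hτ.2.1 hτ.2.2 (Nat.le_succ d)) fun ρ hρ =>
      .sub ⟨?_, ?_, ?_⟩).mono hB fun _ h => h
  · simp [hρ.1, hρ.2.1 d (Nat.lt_succ_self d), hτ.1, eval]
  · intro j hj
    have : j ≠ d := by omega
    simp [this, hρ.2.1 j (by omega), hτ.2.1 j hj]
  · simp [hρ.2.2, hτ.2.2]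

theorem PolyTime.load {a : Tm} {K : ℕ} (ha : a.PolyTime K) : (load a).PolyTime (K + 1) := by
  intro inp X σ hX hreg hmem
  obtain ⟨ea, ra⟩ := ha inp X σ hX hreg hmem
  have hK : 1 ≤ X ^ K := Nat.one_le_pow _ _ (by omega)
  have hB : X ^ K + 1 ≤ X ^ (K + 1) := by rw [pow_succ]; nlinarith
  have hB' : X ≤ X ^ (K + 1) := by rw [pow_succ]; nlinarith
  refine ⟨(hmem _).trans hB', fun d hd => ?_⟩
  refine (Halts.seq' (ra d hd) fun τ hτ => .load ⟨?_, ?_, ?_⟩).mono hB fun _ h => h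
  · simp [hτ.1, hτ.2.2, eval]
  · intro j hj
    have : j ≠ d := by omega
    simp [this, hτ.2.1 j hj]
  · simp [hτ.2.2]

theorem PolyTime.mul {a b : Tm} {K L : ℕ} (ha : a.PolyTime K) (hb : b.PolyTime L) :
    (mul a b).PolyTime (K + L + 4) := by
  intro inp X σ hX hreg hmem
  simp only [bd, lt_sup_iff] at hreg
  obtain ⟨ea, ra⟩ := ha inp X σ hX (fun j hj => hreg j (.inl hj)) hmem
  obtain ⟨eb, -⟩ := hb inp X σ hX (fun j hj => hreg j (.inr hj)) hmem
  have hK : 1 ≤ X ^ K := Nat.one_le_pow _ _ (by omega)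
  have hL : 1 ≤ X ^ L := Nat.one_le_pow _ _ (by omega)
  have h3 : 2 ^ 4 ≤ X ^ 4 := Nat.pow_le_pow_left hX 4
  have hB : X ^ K + (X ^ L + (1 + (1 + ((X ^ K * 3 + 1) + 1)))) ≤ X ^ (K + L + 4) := by
    rw [pow_add, pow_add]
    calc _ ≤ X ^ K * X ^ L * 2 ^ 4 := by nlinarith
      _ ≤ _ := by gcongr
  refine ⟨?_, fun d hd => ?_⟩
  · rw [pow_add, pow_add]
    calc _ ≤ X ^ K * X ^ L := Nat.mul_le_mul ea eb
      _ ≤ _ := Nat.le_mul_of_pos_right _ (by omega)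
  simp only [bd, sup_le_iff] at hd
  refine (Halts.seq' (ra d hd.1) fun τ hτ => .seq' (hb.after hX hd.2
    (fun j hj => hreg j (.inr hj)) hmem hτ.2.1 hτ.2.2 (Nat.le_succ d)) fun ρ hρ =>
      .seq (.const (.seq (.const (.seq' ((halts_mulLoop d _ ?_).mono ?_ fun _ h => h)
        fun π hπ => .add ⟨?_, ?_, ?_⟩))))).mono hB fun _ h => h
  · simp
  · simp [hρ.2.1 d (Nat.lt_succ_self d), hτ.1, ea]
  · obtain ⟨h1, h2, h3, h4⟩ := hπ
    simp [h1, h2, hρ.2.1 d (Nat.lt_succ_self d), hτ.1, hρ.1, eval]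
  · intro j hj
    obtain ⟨h1, h2, h3, h4⟩ := hπ
    have e1 : j ≠ d := by omega
    have e2 : j ≠ d + 2 := by omega
    have e3 : j ≠ d + 3 := by omega
    simp [e1, e2, e3, h3, hρ.2.1 j (by omega), hτ.2.1 j hj]
  · simp [hπ.2.2.2, hρ.2.2, hτ.2.2]

theorem PolyTime.digit {b y i : Tm} {K L M : ℕ} (hb : b.PolyTime K) (hy : y.PolyTime L)
    (hi : i.PolyTime M) : (digit b y i).PolyTime (K + L + M + 6) := by
  intro inp X σ hX hreg hmem
  simp only [bd, lt_sup_iff] at hreg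
  obtain ⟨eb, rb⟩ := hb inp X σ hX (fun j hj => hreg j (.inl hj)) hmem
  obtain ⟨ey, -⟩ := hy inp X σ hX (fun j hj => hreg j (.inr (.inl hj))) hmem
  obtain ⟨ei, -⟩ := hi inp X σ hX (fun j hj => hreg j (.inr (.inr hj))) hmem
  have hK : 1 ≤ X ^ K := Nat.one_le_pow _ _ (by omega)
  have hL : 1 ≤ X ^ L := Nat.one_le_pow _ _ (by omega)
  have hM : 1 ≤ X ^ M := Nat.one_le_pow _ _ (by omega)
  have h3 : 2 ^ 6 ≤ X ^ 6 := Nat.pow_le_pow_left hX 6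
  have hLM : 1 ≤ X ^ L * X ^ M := Nat.one_le_iff_ne_zero.2 (by positivity)
  have hB : X ^ K + (X ^ L + (X ^ M + (1 + (1 + (1 + (((X ^ M + 1) * (X ^ L * 5 + 9) + 1) +
      (1 + 1))))))) ≤ X ^ (K + L + M + 6) := by
    rw [pow_add, pow_add, pow_add]
    have e1 : X ^ L ≤ X ^ L * X ^ M := Nat.le_mul_of_pos_right _ hM
    have e2 : X ^ M ≤ X ^ L * X ^ M := Nat.le_mul_of_pos_left _ hL
    have e3 : X ^ L * X ^ M ≤ X ^ K * (X ^ L * X ^ M) := Nat.le_mul_of_pos_left _ hK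
    have e4 : X ^ K ≤ X ^ K * (X ^ L * X ^ M) := Nat.le_mul_of_pos_right _ hLM
    calc _ ≤ X ^ K * (X ^ L * X ^ M) * 2 ^ 6 := by nlinarith
      _ = X ^ K * X ^ L * X ^ M * 2 ^ 6 := by ring
      _ ≤ _ := by gcongr
  refine ⟨?_, fun d hd => ?_⟩
  · refine le_trans ?_ hB
    have := Nat.mod_lt (y.eval inp σ.mem σ.reg / (b.eval inp σ.mem σ.reg + 1) ^
      (i.eval inp σ.mem σ.reg)) (Nat.succ_pos (b.eval inp σ.mem σ.reg))
    simp only [eval, RAM.digit]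
    simp only [Nat.succ_eq_add_one] at this
    omega
  simp only [bd, sup_le_iff] at hd
  refine (Halts.seq' (rb d hd.1) fun τ hτ => .seq' (hy.after hX hd.2.1
    (fun j hj => hreg j (.inr (.inl hj))) hmem hτ.2.1 hτ.2.2 (Nat.le_succ d)) fun ρ hρ =>
      .seq' (hi.after hX (d' := d + 2) hd.2.2 (fun j hj => hreg j (.inr (.inr hj))) hmem (τ := ρ)
        (fun j hj => ?_) ?_ (by omega)) fun π hπ => ?_).mono hB fun _ h => h
  · rw [hρ.2.1 j (by omega), hτ.2.1 j hj]
  · rw [hρ.2.2, hτ.2.2]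
  have p0 : π.reg d = b.eval inp σ.mem σ.reg := by
    rw [hπ.2.1 d (by omega), hρ.2.1 d (by omega), hτ.1]
  have p1 : π.reg (d + 1) = y.eval inp σ.mem σ.reg := by
    rw [hπ.2.1 (d + 1) (by omega), hρ.1]
  have p2 : π.reg (d + 2) = i.eval inp σ.mem σ.reg := hπ.1
  refine .seq (.const (.seq (.add (.seq (.add (.seq' ((halts_digitLoop d _ ?_ ?_ ?_).mono ?_
    fun _ h => h) fun κ hκ => .seq (.const (.add ⟨?_, ?_, ?_⟩))))))))
  · simp
  · simp
  · simp
  · simp [p1, p2]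
    gcongr
  · obtain ⟨h1, h2, h3⟩ := hκ
    simp [h1, p0, p1, p2, eval]
  · intro j hj
    obtain ⟨h1, h2, h3⟩ := hκ
    have e1 : j ≠ d := by omega
    have e2 : j ≠ d + 2 := by omega
    have e3 : j ≠ d + 3 := by omega
    simp [e1, e2, e3, h2 j (by omega), hπ.2.1 j (by omega), hρ.2.1 j (by omega), hτ.2.1 j hj]
  · simp [hκ.2.2, hπ.2.2, hρ.2.2, hτ.2.2]

/-- Input entries are not bounded by `X`: with a single request the number of colours is unrelated
to the size of the table. The entry used as an address is multiplied by counting down `w`, and the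
entry returned is cut off at `c`, so neither spoils the bounds. -/
theorem PolyTime.lookup {c e w v : Tm} {K L M N : ℕ} (hc : c.PolyTime K) (he : e.PolyTime L)
    (hw : w.PolyTime M) (hv : v.PolyTime N) : (lookup c e w v).PolyTime (K + L + M + N + 5) := by
  intro inp X σ hX hreg hmem
  simp only [bd, lt_sup_iff] at hreg
  obtain ⟨ec, rc⟩ := hc inp X σ hX (fun j hj => hreg j (.inl (.inl hj))) hmem
  obtain ⟨ew, -⟩ := hw inp X σ hX (fun j hj => hreg j (.inr (.inl hj))) hmem
  have hK : 1 ≤ X ^ K := Nat.one_le_pow _ _ (by omega)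
  have hL : 1 ≤ X ^ L := Nat.one_le_pow _ _ (by omega)
  have hM : 1 ≤ X ^ M := Nat.one_le_pow _ _ (by omega)
  have hN : 1 ≤ X ^ N := Nat.one_le_pow _ _ (by omega)
  have h3 : 2 ^ 5 ≤ X ^ 5 := Nat.pow_le_pow_left hX 5
  have hKL : 1 ≤ X ^ K * X ^ L := Nat.one_le_iff_ne_zero.2 (by positivity)
  have hMN : 1 ≤ X ^ M * X ^ N := Nat.one_le_iff_ne_zero.2 (by positivity)
  have hB : X ^ K + (X ^ L + (X ^ M + (X ^ N + (1 + (1 + ((X ^ M * 3 + 1) + (1 + (1 + 1)))))))) ≤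
      X ^ (K + L + M + N + 5) := by
    rw [pow_add, pow_add, pow_add, pow_add]
    have e1 : X ^ K ≤ X ^ K * X ^ L := Nat.le_mul_of_pos_right _ hL
    have e2 : X ^ L ≤ X ^ K * X ^ L := Nat.le_mul_of_pos_left _ hK
    have e3 : X ^ M ≤ X ^ M * X ^ N := Nat.le_mul_of_pos_right _ hN
    have e4 : X ^ N ≤ X ^ M * X ^ N := Nat.le_mul_of_pos_left _ hM
    have e5 : X ^ K * X ^ L ≤ (X ^ K * X ^ L) * (X ^ M * X ^ N) := Nat.le_mul_of_pos_right _ hMN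
    have e6 : X ^ M * X ^ N ≤ (X ^ K * X ^ L) * (X ^ M * X ^ N) := Nat.le_mul_of_pos_left _ hKL
    calc _ ≤ (X ^ K * X ^ L) * (X ^ M * X ^ N) * 2 ^ 5 := by omega
      _ = X ^ K * X ^ L * X ^ M * X ^ N * 2 ^ 5 := by ring
      _ ≤ _ := by gcongr
  refine ⟨?_, fun d hd => ?_⟩
  · refine le_trans ?_ hB
    simp only [eval]
    omega
  simp only [bd, sup_le_iff] at hd
  refine (Halts.seq' (rc d hd.1.1) fun τ hτ => .seq' (he.after hX hd.1.2
    (fun j hj => hreg j (.inl (.inr hj))) hmem hτ.2.1 hτ.2.2 (Nat.le_succ d)) fun ρ hρ =>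
      .seq' (hw.after hX (d' := d + 2) hd.2.1 (fun j hj => hreg j (.inr (.inl hj))) hmem (τ := ρ)
        (fun j hj => ?_) ?_ (by omega)) fun π hπ =>
      .seq' (hv.after hX (d' := d + 3) hd.2.2 (fun j hj => hreg j (.inr (.inr hj))) hmem (τ := π)
        (fun j hj => ?_) ?_ (by omega)) fun κ hκ => ?_).mono hB fun _ h => h
  · rw [hρ.2.1 j (by omega), hτ.2.1 j hj]
  · rw [hρ.2.2, hτ.2.2]
  · rw [hπ.2.1 j (by omega), hρ.2.1 j (by omega), hτ.2.1 j hj]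
  · rw [hπ.2.2, hρ.2.2, hτ.2.2]
  have p0 : κ.reg d = c.eval inp σ.mem σ.reg := by
    rw [hκ.2.1 d (by omega), hπ.2.1 d (by omega), hρ.2.1 d (by omega), hτ.1]
  have p1 : κ.reg (d + 1) = e.eval inp σ.mem σ.reg := by
    rw [hκ.2.1 (d + 1) (by omega), hπ.2.1 (d + 1) (by omega), hρ.1]
  have p2 : κ.reg (d + 2) = w.eval inp σ.mem σ.reg := by
    rw [hκ.2.1 (d + 2) (by omega), hπ.1]
  have p3 : κ.reg (d + 3) = v.eval inp σ.mem σ.reg := hκ.1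
  refine .seq (.const (.seq (.read (.seq' ((halts_lookupLoop d _ ?_).mono ?_
    fun _ h => h) fun χ hχ => .seq (.read (.seq (.sub (.sub ⟨?_, ?_, ?_⟩))))))))
  · simp
  · simp [p2, ew]
  · obtain ⟨h1, h2, h3⟩ := hχ
    -- With truncated subtraction, `c - (c - z)` is the minimum of `c` and `z`.
    simp [h1, h2, p0, p1, p2, p3, eval, Nat.sub_sub_eq_min]
  · intro j hj
    obtain ⟨h1, h2, h3⟩ := hχ
    have e1 : j ≠ d := by omega
    have e2 : j ≠ d + 1 := by omega
    have e3 : j ≠ d + 3 := by omega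
    have e4 : j ≠ d + 4 := by omega
    simp [e1, e2, e3, e4, h2 j (by omega), hκ.2.1 j (by omega), hπ.2.1 j (by omega),
      hρ.2.1 j (by omega), hτ.2.1 j hj]
  · simp [hχ.2.2, hκ.2.2, hπ.2.2, hρ.2.2, hτ.2.2]

theorem exists_polyTime (t : Tm) : ∃ K, t.PolyTime K := by
  induction t with
  | var x => exact ⟨_, .var x⟩
  | const m => exact ⟨_, .const m⟩
  | add a b iha ihb =>
    obtain ⟨K, hK⟩ := iha
    obtain ⟨L, hL⟩ := ihb
    exact ⟨_, hK.add hL⟩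
  | sub a b iha ihb =>
    obtain ⟨K, hK⟩ := iha
    obtain ⟨L, hL⟩ := ihb
    exact ⟨_, hK.sub hL⟩
  | mul a b iha ihb =>
    obtain ⟨K, hK⟩ := iha
    obtain ⟨L, hL⟩ := ihb
    exact ⟨_, hK.mul hL⟩
  | digit b y i ihb ihy ihi =>
    obtain ⟨K, hK⟩ := ihb
    obtain ⟨L, hL⟩ := ihy
    obtain ⟨M, hM⟩ := ihi
    exact ⟨_, hK.digit hL hM⟩
  | lookup c e w v ihc ihe ihw ihv =>
    obtain ⟨K, hK⟩ := ihc
    obtain ⟨L, hL⟩ := ihe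
    obtain ⟨M, hM⟩ := ihw
    obtain ⟨N, hN⟩ := ihv
    exact ⟨_, hK.lookup hL hM hN⟩
  | load a iha =>
    obtain ⟨K, hK⟩ := iha
    exact ⟨_, hK.load⟩

end Tm

end RAM

namespace RAM

variable {inp : ℕ → ℕ}

/-! ### Formulas with bounded quantifiers -/

/-- Formulas over arithmetic terms with bounded quantification over register variables. -/
inductive Fm : Type
  | le (a b : Tm) : Fm
  | neg (φ : Fm) : Fm
  | and (φ ψ : Fm) : Fm
  /-- there is a value of the register `x` below `t` such that `φ` -/
  | ex (x : ℕ) (t : Tm) (φ : Fm) : Fm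

namespace Fm

/-- The meaning of a formula. -/
def Holds (inp mem : ℕ → ℕ) : Fm → (ℕ → ℕ) → Prop
  | le a b, reg => a.eval inp mem reg ≤ b.eval inp mem reg
  | neg φ, reg => ¬ φ.Holds inp mem reg
  | and φ ψ, reg => φ.Holds inp mem reg ∧ ψ.Holds inp mem reg
  | ex x t φ, reg => ∃ v < t.eval inp mem reg, φ.Holds inp mem (Function.update reg x v)

/-- All variables of a formula are smaller than this number. -/
def bd : Fm → ℕ
  | le a b => max a.bd b.bd
  | neg φ => φ.bd
  | and φ ψ => max φ.bd ψ.bd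
  | ex x t φ => max (x + 1) (max t.bd φ.bd)

theorem holds_congr {mem : ℕ → ℕ} (φ : Fm) : ∀ {reg reg' : ℕ → ℕ},
    (∀ j < φ.bd, reg' j = reg j) → (φ.Holds inp mem reg' ↔ φ.Holds inp mem reg) := by
  induction φ with
  | le a b =>
    intro reg reg' h
    simp only [bd, lt_sup_iff] at h
    simp only [Holds, a.eval_congr fun j hj => h j (.inl hj), b.eval_congr fun j hj => h j (.inr hj)]
  | neg φ ih => exact fun h => not_congr (ih h)
  | and φ ψ ihφ ihψ =>
    intro reg reg' h
    simp only [bd, lt_sup_iff] at h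
    exact and_congr (ihφ fun j hj => h j (.inl hj)) (ihψ fun j hj => h j (.inr hj))
  | ex x t φ ih =>
    intro reg reg' h
    simp only [bd, lt_sup_iff] at h
    simp only [Holds, t.eval_congr fun j hj => h j (.inr (.inl hj))]
    refine exists_congr fun v => and_congr_right fun _ => ih fun j hj => ?_
    by_cases hx : j = x
    · subst hx; simp
    · simp [hx, h j (.inr (.inr hj))]

/-- The program computing the truth value of a formula in register `d`, with the registers after
`d` as scratch. -/
def comp : Fm → ℕ → Prog
  | le a b, d => .seq (a.comp d) (.seq (b.comp (d + 1)) (.seq (.sub d d (d + 1))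
      (.seq (.const (d + 1) 1) (.sub d (d + 1) d))))
  | neg φ, d => .seq (φ.comp d) (.seq (.const (d + 1) 1) (.sub d (d + 1) d))
  | and φ ψ, d => .seq (φ.comp d) (.cond d (ψ.comp d) (.const d 0))
  | ex x t φ, d => .seq (t.comp (d + 1)) (.seq (.const (d + 2) 0) (.seq (.add (d + 2) x (d + 2))
      (.seq (.const x 0) (.seq (.const (d + 3) 1) (.seq (.const d 0) (.seq
      (.loop (d + 1) (.seq (φ.comp (d + 4)) (.seq (.cond (d + 4) (.const d 1) (.const (d + 4) 0))
        (.seq (.add x x (d + 3)) (.sub (d + 1) (d + 1) (d + 3))))))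
      (.seq (.const (d + 4) 0) (.add x (d + 2) (d + 4)))))))))

open Classical in
/-- The truth value of a formula as a number. -/
noncomputable def val (φ : Fm) (inp mem reg : ℕ → ℕ) : ℕ := if φ.Holds inp mem reg then 1 else 0

theorem val_eq_one {φ : Fm} {inp mem reg : ℕ → ℕ} (h : φ.Holds inp mem reg) :
    φ.val inp mem reg = 1 := if_pos h

theorem val_eq_zero {φ : Fm} {inp mem reg : ℕ → ℕ} (h : ¬ φ.Holds inp mem reg) :
    φ.val inp mem reg = 0 := if_neg h

theorem val_ne_zero {φ : Fm} {inp mem reg : ℕ → ℕ} :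
    φ.val inp mem reg ≠ 0 ↔ φ.Holds inp mem reg := by
  by_cases h : φ.Holds inp mem reg <;> simp [val_eq_one, val_eq_zero, h]

/-- Under bounds `X` on the variables and the memory, a formula is evaluated in polynomial time. -/
def PolyTime (φ : Fm) (K : ℕ) : Prop :=
  ∀ (inp : ℕ → ℕ) (X : ℕ) (σ : State), 2 ≤ X → (∀ j < φ.bd, σ.reg j ≤ X) → (∀ a, σ.mem a ≤ X) →
    ∀ d, φ.bd ≤ d → Halts inp (φ.comp d) σ (X ^ K) (Writes σ d (φ.val inp σ.mem σ.reg))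

theorem val_congr {mem reg reg' : ℕ → ℕ} (φ : Fm) (h : ∀ j < φ.bd, reg' j = reg j) :
    φ.val inp mem reg' = φ.val inp mem reg := by
  by_cases h' : φ.Holds inp mem reg
  · rw [val_eq_one h', val_eq_one ((φ.holds_congr h).2 h')]
  · rw [val_eq_zero h', val_eq_zero (mt (φ.holds_congr h).1 h')]

theorem PolyTime.neg {φ : Fm} {K : ℕ} (h : φ.PolyTime K) : (neg φ).PolyTime (K + 2) := by
  intro inp X σ hX hreg hmem d hd
  have hK : 1 ≤ X ^ K := Nat.one_le_pow _ _ (by omega)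
  have hB : X ^ K + (1 + 1) ≤ X ^ (K + 2) := by
    rw [pow_add]
    have h3 : 2 ^ 2 ≤ X ^ 2 := Nat.pow_le_pow_left hX 2
    nlinarith
  refine (Halts.seq' (h inp X σ hX hreg hmem d hd) fun τ hτ => .seq (.const (.sub
    ⟨?_, ?_, ?_⟩))).mono hB fun _ h => h
  · by_cases hφ : φ.Holds inp σ.mem σ.reg
    · rw [val_eq_zero (φ := .neg φ) (not_not_intro hφ)]
      simp [hτ.1, val_eq_one hφ]
    · rw [val_eq_one (φ := .neg φ) hφ]
      simp [hτ.1, val_eq_zero hφ]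
  · intro j hj
    have e1 : j ≠ d := by omega
    have e2 : j ≠ d + 1 := by omega
    simp [e1, e2, hτ.2.1 j hj]
  · simp [hτ.2.2]

theorem PolyTime.and {φ ψ : Fm} {K L : ℕ} (h : φ.PolyTime K) (h' : ψ.PolyTime L) :
    (and φ ψ).PolyTime (K + L + 2) := by
  intro inp X σ hX hreg hmem d hd
  simp only [bd, lt_sup_iff] at hreg
  simp only [bd, sup_le_iff] at hd
  have hK : 1 ≤ X ^ K := Nat.one_le_pow _ _ (by omega)
  have hL : 1 ≤ X ^ L := Nat.one_le_pow _ _ (by omega)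
  have h3 : 2 ^ 2 ≤ X ^ 2 := Nat.pow_le_pow_left hX 2
  have hB : X ^ K + (X ^ L + 1) ≤ X ^ (K + L + 2) := by
    rw [pow_add, pow_add]
    calc _ ≤ X ^ K * X ^ L * 2 ^ 2 := by nlinarith
      _ ≤ _ := by gcongr
  refine (Halts.seq' (h inp X σ hX (fun j hj => hreg j (.inl hj)) hmem d hd.1) fun τ hτ =>
    .cond (fun h0 => ?_) (fun h0 => ?_)).mono hB fun _ h => h
  · have hφ : φ.Holds inp σ.mem σ.reg := by
      by_contra hφ
      exact h0 (by rw [hτ.1, val_eq_zero hφ])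
    have hr : ∀ j < ψ.bd, τ.reg j = σ.reg j := fun j hj => hτ.2.1 j (by omega)
    refine (h' inp X τ hX (fun j hj => by rw [hr j hj]; exact hreg j (.inr hj))
      (fun a => by rw [hτ.2.2]; exact hmem a) d hd.2).mono le_rfl fun ρ hρ => ⟨?_, ?_, ?_⟩
    · rw [hρ.1, hτ.2.2, ψ.val_congr hr]
      by_cases hψ : ψ.Holds inp σ.mem σ.reg
      · rw [val_eq_one hψ, val_eq_one (φ := .and φ ψ) ⟨hφ, hψ⟩]
      · rw [val_eq_zero hψ, val_eq_zero (φ := .and φ ψ) fun h => hψ h.2]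
    · intro j hj
      rw [hρ.2.1 j hj, hτ.2.1 j hj]
    · rw [hρ.2.2, hτ.2.2]
  · have hφ : ¬ φ.Holds inp σ.mem σ.reg := by
      intro hφ
      rw [hτ.1, val_eq_one hφ] at h0
      exact one_ne_zero h0
    refine (Halts.const ⟨?_, ?_, hτ.2.2⟩).mono hL fun _ h => h
    · rw [val_eq_zero (φ := .and φ ψ) fun h => hφ h.1]
      simp
    · intro j hj
      have e1 : j ≠ d := by omega
      simp [e1, hτ.2.1 j hj]

theorem PolyTime.le {a b : Tm} {K L : ℕ} (ha : a.PolyTime K) (hb : b.PolyTime L) :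
    (le a b).PolyTime (K + L + 3) := by
  intro inp X σ hX hreg hmem d hd
  simp only [bd, lt_sup_iff] at hreg
  simp only [bd, sup_le_iff] at hd
  obtain ⟨ea, ra⟩ := ha inp X σ hX (fun j hj => hreg j (.inl hj)) hmem
  have hK : 1 ≤ X ^ K := Nat.one_le_pow _ _ (by omega)
  have hL : 1 ≤ X ^ L := Nat.one_le_pow _ _ (by omega)
  have h3 : 2 ^ 3 ≤ X ^ 3 := Nat.pow_le_pow_left hX 3
  have hB : X ^ K + (X ^ L + (1 + (1 + 1))) ≤ X ^ (K + L + 3) := by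
    rw [pow_add, pow_add]
    calc _ ≤ X ^ K * X ^ L * 2 ^ 3 := by nlinarith
      _ ≤ _ := by gcongr
  refine (Halts.seq' (ra d hd.1) fun τ hτ => .seq' (hb.after hX hd.2
    (fun j hj => hreg j (.inr hj)) hmem hτ.2.1 hτ.2.2 (Nat.le_succ d)) fun ρ hρ =>
      .seq (.sub (.seq (.const (.sub ⟨?_, ?_, ?_⟩))))).mono hB fun _ h => h
  · have hd' := hρ.2.1 d (Nat.lt_succ_self d)
    by_cases hab : a.eval inp σ.mem σ.reg ≤ b.eval inp σ.mem σ.reg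
    · rw [val_eq_one (φ := .le a b) hab]
      simp [hρ.1, hd', hτ.1]
      omega
    · rw [val_eq_zero (φ := .le a b) hab]
      simp [hρ.1, hd', hτ.1]
      omega
  · intro j hj
    have e1 : j ≠ d := by omega
    have e2 : j ≠ d + 1 := by omega
    simp [e1, e2, hρ.2.1 j (by omega), hτ.2.1 j hj]
  · simp [hρ.2.2, hτ.2.2]

/-- There are at most `X ^ K` rounds. The quantified variable may itself grow to `X ^ K`, so the
body is run under the bound `X ^ (K + 1)` and costs `X ^ ((K + 1) * L)`. The register `x` doubles as
loop variable: its old value is kept in `d + 2` and restored at the end. -/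
theorem PolyTime.ex {x : ℕ} {t : Tm} {φ : Fm} {K L : ℕ} (ht : t.PolyTime K) (h : φ.PolyTime L) :
    (ex x t φ).PolyTime (K + (K + 1) * L + 5) := by
  intro inp X σ hX hreg hmem d hd
  simp only [bd, lt_sup_iff] at hreg
  simp only [bd, sup_le_iff] at hd
  obtain ⟨hdx, hdt, hdφ⟩ := hd
  obtain ⟨et, rt⟩ := ht inp X σ hX (fun j hj => hreg j (.inr (.inl hj))) hmem
  have hK : 1 ≤ X ^ K := Nat.one_le_pow _ _ (by omega)
  have hL : 1 ≤ X ^ ((K + 1) * L) := Nat.one_le_pow _ _ (by omega)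
  have h3 : 2 ^ 5 ≤ X ^ 5 := Nat.pow_le_pow_left hX 5
  have hB : X ^ K + (1 + (1 + (1 + (1 + (1 + ((X ^ K *
      ((X ^ ((K + 1) * L) + ((1 + 1) + (1 + 1))) + 1) + 1) + (1 + 1))))))) ≤
      X ^ (K + (K + 1) * L + 5) := by
    rw [pow_add, pow_add]
    have e1 : X ^ K ≤ X ^ K * X ^ ((K + 1) * L) := Nat.le_mul_of_pos_right _ hL
    calc _ ≤ X ^ K * X ^ ((K + 1) * L) * 2 ^ 5 := by nlinarith
      _ ≤ _ := by gcongr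
  generalize hc : t.eval inp σ.mem σ.reg = c at et rt
  have hXX : X ≤ X ^ (K + 1) := by rw [pow_succ]; nlinarith
  have hKX : X ^ K ≤ X ^ (K + 1) := Tm.pow_le_pow_sum hX (by omega)
  let I : ℕ → State → Prop := fun i τ => i ≤ c ∧ τ.reg (d + 1) = i ∧ τ.reg x = c - i ∧
    τ.reg (d + 2) = σ.reg x ∧ τ.reg (d + 3) = 1 ∧
    (τ.reg d = 1 ∧ (∃ v < c - i, φ.Holds inp σ.mem (Function.update σ.reg x v)) ∨
      τ.reg d = 0 ∧ ¬ (∃ v < c - i, φ.Holds inp σ.mem (Function.update σ.reg x v))) ∧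
    (∀ j < d, j ≠ x → τ.reg j = σ.reg j) ∧ τ.mem = σ.mem
  have hx1 : x ≠ d := by omega
  have hx2 : x ≠ d + 1 := by omega
  have hx3 : x ≠ d + 2 := by omega
  have hx4 : x ≠ d + 3 := by omega
  have hx5 : x ≠ d + 4 := by omega
  refine (Halts.seq' (rt (d + 1) (by omega)) fun τ hτ => .seq (.const (.seq (.add (.seq (.const
    (.seq (.const (.seq (.const (.seq' (R := I 0) ((Halts.loop (T := X ^ ((K + 1) * L) + ((1 + 1) + (1 + 1))) I ?_ ?_ ?_ c _ ?_).mono ?_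
    fun _ h => h) fun ρ hρ => .seq (.const (.add ⟨?_, ?_, ?_⟩))))))))))))).mono hB fun _ h => h
  · exact fun τ h => h.2.1
  · exact fun i τ h => by have := h.2.1; omega
  · rintro i ρ ⟨hi, h1, h2, h3, h4, h5, h6, h7⟩
    have hr : ∀ j < φ.bd, ρ.reg j = Function.update σ.reg x (c - (i + 1)) j := by
      intro j hj
      by_cases hjx : j = x
      · subst hjx; simp [h2]
      · simp [hjx, h6 j (hj.trans_le hdφ) hjx]
    have hex : (∃ v < c - i, φ.Holds inp σ.mem (Function.update σ.reg x v)) ↔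
        (∃ v < c - (i + 1), φ.Holds inp σ.mem (Function.update σ.reg x v)) ∨
          φ.Holds inp σ.mem (Function.update σ.reg x (c - (i + 1))) := by
      have hci : c - i = c - (i + 1) + 1 := by clear h5; omega
      rw [hci]
      simp only [Nat.lt_succ_iff_lt_or_eq, or_and_right, exists_or, exists_eq_left]
    refine .seq' (R := Writes ρ (d + 4) (φ.val inp ρ.mem ρ.reg)) ?_ fun π hπ =>
      .seq' (R := fun κ => (κ.reg d = 1 ∧ (∃ v < c - i, φ.Holds inp σ.mem
        (Function.update σ.reg x v)) ∨ κ.reg d = 0 ∧ ¬ (∃ v < c - i, φ.Holds inp σ.mem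
        (Function.update σ.reg x v))) ∧ (∀ j < d + 4, j ≠ d → κ.reg j = π.reg j) ∧
        κ.mem = π.mem) ?_ fun κ hκ => .seq (.add (.sub ?_))
    · refine (h inp (X ^ (K + 1)) ρ (by omega) ?_ ?_ (d + 4) (by omega)).mono
        (by rw [← pow_mul]) fun _ h => h
      · intro j hj
        rw [hr j hj]
        by_cases hjx : j = x
        · subst hjx
          simpa using (Nat.sub_le _ _).trans (et.trans hKX)
        · simp [hjx]
          exact (hreg j (.inr (.inr hj))).trans hXX
      · intro a
        rw [h7]
        exact (hmem a).trans hXX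
    · have hv : φ.val inp ρ.mem ρ.reg ≠ 0 ↔
          φ.Holds inp σ.mem (Function.update σ.reg x (c - (i + 1))) := by
        rw [val_ne_zero, h7, φ.holds_congr hr]
      refine .cond (fun h0 => .const ?_) fun h0 => .const ?_
      · rw [hπ.1, hv] at h0
        refine ⟨.inl ⟨by simp, hex.2 (.inr h0)⟩, fun j _ hjd => by simp [hjd], rfl⟩
      · rw [hπ.1, ← not_not (a := _ = 0), ← ne_eq, hv] at h0
        rw [hex, or_iff_left h0]
        refine ⟨by simpa [hπ.2.1 d (by omega)] using h5, fun j hj _ => ?_, rfl⟩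
        have : j ≠ d + 4 := by omega
        simp [this]
    · obtain ⟨k1, k2, k3⟩ := hκ
      have q : ∀ j < d + 4, j ≠ d → κ.reg j = ρ.reg j := fun j hj hjd => by
        rw [k2 j hj hjd, hπ.2.1 j hj]
      have q1 := q (d + 1) (by omega) (by omega)
      have q2 := q (d + 2) (by omega) (by omega)
      have q3 := q (d + 3) (by omega) (by omega)
      have qx := q x (by omega) hx1
      refine ⟨by omega, ?_, ?_, ?_, ?_, ?_, ?_, ?_⟩
      · simp [hx2.symm, hx4.symm, q1, h1, q3, h4]
      · simp only [State.setReg_reg, hx2, if_false, if_true, qx, h2, q3, h4]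
        clear h5 k1 hex
        omega
      · simp [hx3.symm, q2, h3]
      · simp [hx4.symm, q3, h4]
      · simpa [hx1.symm] using k1
      · intro j hj hjx
        have : j ≠ d + 1 := by omega
        simp [this, hjx, q j (by omega) (by omega), h6 j hj hjx]
      · simp [k3, hπ.2.2, h7]
  · refine ⟨le_rfl, ?_, ?_, ?_, ?_, .inr ⟨?_, by simp⟩, ?_, ?_⟩
    · simp [hx2.symm, hτ.1]
    · simp [hx1, hx4]
    · simp [hx3.symm, hx3, hτ.2.1 x (by omega)]
    · simp
    · simp
    · intro j hj hjx
      have e1 : j ≠ d := by omega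
      have e2 : j ≠ d + 2 := by omega
      have e3 : j ≠ d + 3 := by omega
      simp [e1, e2, e3, hjx, hτ.2.1 j (by omega)]
    · simp [hτ.2.2]
  · gcongr
  · obtain ⟨h0, h1, h2, h3, h4, h5, h6, h7⟩ := hρ
    rw [Nat.sub_zero] at h5
    rcases h5 with ⟨h5, h8⟩ | ⟨h5, h8⟩
    · rw [val_eq_one (φ := .ex x t φ) (by rwa [Holds, hc])]
      simp [h5, hx1.symm]
    · rw [val_eq_zero (φ := .ex x t φ) (by rwa [Holds, hc])]
      simp [h5, hx1.symm]
  · intro j hj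
    obtain ⟨h0, h1, h2, h3, h4, h5, h6, h7⟩ := hρ
    have e1 : j ≠ d + 4 := by omega
    by_cases hjx : j = x
    · subst hjx
      simp [h3]
    · simp [hjx, e1, h6 j hj hjx]
  · simp [hρ.2.2.2.2.2.2.2]

/-- This reduces all running time estimates for the certificate check to writing it as one formula
of bounded arithmetic; the exponent depends on the formula only. -/
theorem exists_polyTime (φ : Fm) : ∃ K, φ.PolyTime K := by
  induction φ with
  | le a b =>
    obtain ⟨K, hK⟩ := a.exists_polyTime
    obtain ⟨L, hL⟩ := b.exists_polyTime
    exact ⟨_, .le hK hL⟩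
  | neg φ ih =>
    obtain ⟨K, hK⟩ := ih
    exact ⟨_, hK.neg⟩
  | and φ ψ ih ih' =>
    obtain ⟨K, hK⟩ := ih
    obtain ⟨L, hL⟩ := ih'
    exact ⟨_, hK.and hL⟩
  | ex x t φ ih =>
    obtain ⟨K, hK⟩ := t.exists_polyTime
    obtain ⟨L, hL⟩ := ih
    exact ⟨_, .ex hK hL⟩

/-! #### Derived connectives -/

/-- Disjunction. -/
def or (φ ψ : Fm) : Fm := neg (and (neg φ) (neg ψ))

/-- Implication. -/
def imp (φ ψ : Fm) : Fm := neg (and φ (neg ψ))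

/-- Bounded universal quantification. -/
def all (x : ℕ) (t : Tm) (φ : Fm) : Fm := neg (ex x t (neg φ))

/-- Equality. -/
def eq (a b : Tm) : Fm := and (le a b) (le b a)

/-- Strict inequality. -/
def lt (a b : Tm) : Fm := neg (le b a)

variable {mem reg : ℕ → ℕ}

theorem holds_le (a b : Tm) :
    (le a b).Holds inp mem reg ↔ a.eval inp mem reg ≤ b.eval inp mem reg := Iff.rfl

theorem holds_neg (φ : Fm) : (neg φ).Holds inp mem reg ↔ ¬ φ.Holds inp mem reg := Iff.rfl

theorem holds_and (φ ψ : Fm) :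
    (and φ ψ).Holds inp mem reg ↔ φ.Holds inp mem reg ∧ ψ.Holds inp mem reg := Iff.rfl

theorem holds_ex (x : ℕ) (t : Tm) (φ : Fm) : (ex x t φ).Holds inp mem reg ↔
    ∃ v < t.eval inp mem reg, φ.Holds inp mem (Function.update reg x v) := Iff.rfl

theorem holds_or (φ ψ : Fm) :
    (or φ ψ).Holds inp mem reg ↔ φ.Holds inp mem reg ∨ ψ.Holds inp mem reg := by
  simp only [or, holds_neg, holds_and]; tauto

theorem holds_imp (φ ψ : Fm) :
    (imp φ ψ).Holds inp mem reg ↔ (φ.Holds inp mem reg → ψ.Holds inp mem reg) := by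
  simp only [imp, holds_neg, holds_and]; tauto

theorem holds_all (x : ℕ) (t : Tm) (φ : Fm) : (all x t φ).Holds inp mem reg ↔
    ∀ v < t.eval inp mem reg, φ.Holds inp mem (Function.update reg x v) := by
  simp only [all, holds_neg, holds_ex]; push Not; rfl

theorem holds_eq (a b : Tm) :
    (eq a b).Holds inp mem reg ↔ a.eval inp mem reg = b.eval inp mem reg := by
  simp only [eq, holds_and, holds_le, le_antisymm_iff]

theorem holds_lt (a b : Tm) :
    (lt a b).Holds inp mem reg ↔ a.eval inp mem reg < b.eval inp mem reg := by
  simp only [lt, holds_neg, holds_le, not_le]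

end Fm

end RAM

/-! ### Certificates -/

/-- The data of an instance as seen by the machine: `n` vertices, `l` requests, the adjacency
matrix, the terminals, and for every request the levels of the vertices in the partition belonging
to the colour of that request.  Every solution path is to be cut into `J` pieces. -/
structure Inst where
  n : ℕ
  l : ℕ
  J : ℕ
  adj : ℕ → ℕ → ℕ
  src : ℕ → ℕ
  tgt : ℕ → ℕ
  lev : ℕ → ℕ → ℕ

namespace Inst

variable (I : Inst)

/-- The base of the positional system in which certificates are written. -/
def base : ℕ := I.n + I.l + 1

/-- The first vertex of the `m`-th piece of the `a`-th path. -/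
def entry (y a m : ℕ) : ℕ := RAM.digit I.base y (4 * (a * I.J + m))

/-- The last vertex of the `m`-th piece of the `a`-th path. -/
def exit (y a m : ℕ) : ℕ := RAM.digit I.base y (4 * (a * I.J + m) + 1)

/-- The request whose level function measures the time along the `m`-th piece of the `a`-th path. -/
def clock (y a m : ℕ) : ℕ := RAM.digit I.base y (4 * (a * I.J + m) + 2)

/-- The current position of the pebble on the `m`-th piece of the `a`-th path. -/
def pebble (y a m : ℕ) : ℕ := RAM.digit I.base y (4 * (a * I.J + m) + 3)

/-- The pebble of the piece is on its way at time `t`. -/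
def Active (y t a m : ℕ) : Prop :=
  (I.lev (I.clock y a m) (I.entry y a m) ≤ t ∧ t ≤ I.lev (I.clock y a m) (I.exit y a m)) ∨
  (I.lev (I.clock y a m) (I.exit y a m) ≤ t ∧ t ≤ I.lev (I.clock y a m) (I.entry y a m))

/-- The vertex `x` may, judging by its levels, lie between the ends of the piece. -/
def InBox (y a m x : ℕ) : Prop := ∀ h < I.l,
  I.lev h x + I.lev a (I.entry y a m) ≤ I.lev h (I.entry y a m) + I.lev a x ∧
  I.lev h (I.entry y a m) + I.lev a (I.entry y a m) ≤ I.lev h x + I.lev a x ∧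
  I.lev h (I.exit y a m) + I.lev a x ≤ I.lev h x + I.lev a (I.exit y a m) ∧
  I.lev h x + I.lev a x ≤ I.lev h (I.exit y a m) + I.lev a (I.exit y a m)

/-- The pieces of the `a`-th path begin and end in the right terminals. -/
def Ends (y a : ℕ) : Prop :=
  (I.entry y a 0 = I.src a ∧ I.exit y a (I.J - 1) = I.tgt a) ∨
  (I.entry y a 0 = I.tgt a ∧ I.exit y a (I.J - 1) = I.src a)

/-- The data of a piece are meaningful. -/
def InRange (y a m : ℕ) : Prop :=
  I.entry y a m < I.n ∧ I.exit y a m < I.n ∧ I.clock y a m < I.l ∧ I.pebble y a m < I.n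

/-- The level of the clock changes along the piece as much as the level of the path does. -/
def Uniform (y a m : ℕ) : Prop :=
  I.lev a (I.entry y a m) ≤ I.lev a (I.exit y a m) ∧
  (I.lev (I.clock y a m) (I.exit y a m) + I.lev a (I.entry y a m) =
    I.lev (I.clock y a m) (I.entry y a m) + I.lev a (I.exit y a m) ∨
  I.lev (I.clock y a m) (I.exit y a m) + I.lev a (I.exit y a m) =
    I.lev (I.clock y a m) (I.entry y a m) + I.lev a (I.entry y a m))

/-- The next piece starts where this one ends or after one more edge. -/
def Linked (y a m : ℕ) : Prop := m + 1 < I.J →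
  I.exit y a m = I.entry y a (m + 1) ∨ (I.adj (I.exit y a m) (I.entry y a (m + 1)) = 1 ∧
    I.lev a (I.entry y a (m + 1)) = I.lev a (I.exit y a m) + 1)

/-- The pebble is at a place that fits the time. -/
def OnTime (y t a m : ℕ) : Prop := I.Active y t a m →
  I.lev (I.clock y a m) (I.pebble y a m) = t ∧
  (t = I.lev (I.clock y a m) (I.entry y a m) → I.pebble y a m = I.entry y a m) ∧
  (t = I.lev (I.clock y a m) (I.exit y a m) → I.pebble y a m = I.exit y a m)

/-- Two pieces of different paths with the same clock have their pebbles at different vertices,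
and with different clocks they can never meet. -/
def Apart (y t a m a' m' : ℕ) : Prop :=
  (I.clock y a m = I.clock y a' m' → I.Active y t a m → I.Active y t a' m' →
    I.pebble y a m = I.pebble y a' m' → I.pebble y a m = I.src a ∨ I.pebble y a m = I.tgt a) ∧
  (I.clock y a m ≠ I.clock y a' m' → ∀ x < I.n, ¬ (I.InBox y a m x ∧ I.InBox y a' m' x))

/-- The code `y` is admissible at time `t`. -/
def Good (t y : ℕ) : Prop := ∀ a < I.l, I.Ends y a ∧ ∀ m < I.J,
  I.InRange y a m ∧ I.Uniform y a m ∧ I.Linked y a m ∧ I.OnTime y t a m ∧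
  ∀ a' < I.l, a' ≠ a → ∀ m' < I.J, I.Apart y t a m a' m'

/-- The code `y` at time `t` may follow the code `y'` at time `t - 1`. -/
def Step (t y' y : ℕ) : Prop := ∀ a < I.l, ∀ m < I.J,
  I.entry y' a m = I.entry y a m ∧ I.exit y' a m = I.exit y a m ∧
  I.clock y' a m = I.clock y a m ∧ (I.Active y (t - 1) a m → I.Active y t a m →
    I.adj (I.pebble y' a m) (I.pebble y a m) = 1)

/-- The code `y` can be reached at time `t`, all codes being smaller than `D`. -/
def Reached (D : ℕ) : ℕ → ℕ → Prop
  | 0, y => I.Good 0 y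
  | t + 1, y => I.Good (t + 1) y ∧ ∃ y' < D, Reached D t y' ∧ I.Step (t + 1) y' y

/-- Unrolls the recursion into a whole history `Y`, the form in which it is compared with
certificates. -/
theorem reached_iff (D : ℕ) : ∀ t y, y < D → (I.Reached D t y ↔ ∃ Y : ℕ → ℕ, Y t = y ∧
    (∀ i ≤ t, Y i < D ∧ I.Good i (Y i)) ∧ ∀ i < t, I.Step (i + 1) (Y i) (Y (i + 1))) := by
  intro t
  induction t with
  | zero =>
    intro y hy
    refine ⟨fun h => ⟨fun _ => y, rfl, fun i hi => ?_, fun i hi => by omega⟩, ?_⟩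
    · obtain rfl : i = 0 := by omega
      exact ⟨hy, h⟩
    · rintro ⟨Y, rfl, h, -⟩
      exact (h 0 le_rfl).2
  | succ t ih =>
    intro y hy
    constructor
    · rintro ⟨hg, y', hy', hr, hs⟩
      obtain ⟨Y, rfl, h1, h2⟩ := (ih y' hy').1 hr
      refine ⟨fun i => if i ≤ t then Y i else y, by simp, fun i hi => ?_, fun i hi => ?_⟩
      · by_cases hit : i ≤ t
        · simpa [hit] using h1 i hit
        · obtain rfl : i = t + 1 := by omega
          simpa [hy] using hg
      · by_cases hit : i + 1 ≤ t
        · simpa [hit, show i ≤ t by omega] using h2 i hit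
        · obtain rfl : i = t := by omega
          simpa using hs
    · rintro ⟨Y, rfl, h1, h2⟩
      exact ⟨(h1 _ le_rfl).2, Y t, (h1 t (by omega)).1, (ih _ (h1 t (by omega)).1).2
        ⟨Y, rfl, fun i hi => h1 i (by omega), fun i hi => h2 i (by omega)⟩, h2 t (by omega)⟩

/-- The instance stored in the input array. -/
def ofInput (inp : ℕ → ℕ) (n l J : ℕ) : Inst where
  n := n
  l := l
  J := J
  adj x y := min n (inp (3 + (x * n + y)))
  src a := min n (inp (3 + n * n + a))
  tgt a := min n (inp (3 + n * n + l + a))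
  lev a x := min n (inp (3 + n * n + 3 * l + x + n * inp (3 + n * n + 2 * l + a)))

end Inst

/-! ### The certificate check as a formula -/

namespace CheckFormula

open RAM

/-- Registers: the number of vertices. -/
def vN : Tm := .var 1
/-- Registers: the number of requests. -/
def vL : Tm := .var 2
/-- Registers: the number of pieces of each path. -/
def vJ : Tm := .var 3
/-- Registers: the number of codes. -/
def vD : Tm := .var 4
/-- Registers: the current time. -/
def vT : Tm := .var 5
/-- Registers: the current code. -/
def vY : Tm := .var 6

/-- The index of the first digit of a piece. -/
def pieceIndex (a m : Tm) : Tm := .mul (.const 4) (.add (.mul a vJ) m)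

/-- See `Inst.entry`. -/
def entry (y a m : Tm) : Tm := .digit (.add vN vL) y (pieceIndex a m)
/-- See `Inst.exit`. -/
def exit (y a m : Tm) : Tm := .digit (.add vN vL) y (.add (pieceIndex a m) (.const 1))
/-- See `Inst.clock`. -/
def clock (y a m : Tm) : Tm := .digit (.add vN vL) y (.add (pieceIndex a m) (.const 2))
/-- See `Inst.pebble`. -/
def pebble (y a m : Tm) : Tm := .digit (.add vN vL) y (.add (pieceIndex a m) (.const 3))

/-- The entry of the input at a given position, cut off at `n`. -/
def input (e : Tm) : Tm := .lookup vN (.const 0) (.const 0) e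

/-- See `Inst.adj`. -/
def adj (x y : Tm) : Tm := input (.add (.const 3) (.add (.mul x vN) y))
/-- See `Inst.src`. -/
def src (a : Tm) : Tm := input (.add (.add (.const 3) (.mul vN vN)) a)
/-- See `Inst.tgt`. -/
def tgt (a : Tm) : Tm := input (.add (.add (.add (.const 3) (.mul vN vN)) vL) a)
/-- See `Inst.lev`. -/
def lev (a x : Tm) : Tm :=
  .lookup vN (.add (.add (.add (.const 3) (.mul vN vN)) (.mul (.const 2) vL)) a) vN
    (.add (.add (.add (.const 3) (.mul vN vN)) (.mul (.const 3) vL)) x)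

/-- See `Inst.Active`. -/
def active (y t a m : Tm) : Fm :=
  .or (.and (.le (lev (clock y a m) (entry y a m)) t) (.le t (lev (clock y a m) (exit y a m))))
    (.and (.le (lev (clock y a m) (exit y a m)) t) (.le t (lev (clock y a m) (entry y a m))))

/-- See `Inst.InBox`. -/
def inBox (y a m x : Tm) : Fm := .all 13 vL (
  .and (.le (.add (lev (.var 13) x) (lev a (entry y a m)))
    (.add (lev (.var 13) (entry y a m)) (lev a x))) (
  .and (.le (.add (lev (.var 13) (entry y a m)) (lev a (entry y a m)))
    (.add (lev (.var 13) x) (lev a x))) (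
  .and (.le (.add (lev (.var 13) (exit y a m)) (lev a x))
    (.add (lev (.var 13) x) (lev a (exit y a m))))
  (.le (.add (lev (.var 13) x) (lev a x))
    (.add (lev (.var 13) (exit y a m)) (lev a (exit y a m)))))))

/-- See `Inst.Ends`. -/
def ends (y a : Tm) : Fm :=
  .or (.and (.eq (entry y a (.const 0)) (src a)) (.eq (exit y a (.sub vJ (.const 1))) (tgt a)))
    (.and (.eq (entry y a (.const 0)) (tgt a)) (.eq (exit y a (.sub vJ (.const 1))) (src a)))

/-- See `Inst.InRange`. -/
def inRange (y a m : Tm) : Fm :=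
  .and (.lt (entry y a m) vN) (.and (.lt (exit y a m) vN) (.and (.lt (clock y a m) vL)
    (.lt (pebble y a m) vN)))

/-- See `Inst.Uniform`. -/
def uniform (y a m : Tm) : Fm :=
  .and (.le (lev a (entry y a m)) (lev a (exit y a m)))
    (.or (.eq (.add (lev (clock y a m) (exit y a m)) (lev a (entry y a m)))
      (.add (lev (clock y a m) (entry y a m)) (lev a (exit y a m))))
    (.eq (.add (lev (clock y a m) (exit y a m)) (lev a (exit y a m)))
      (.add (lev (clock y a m) (entry y a m)) (lev a (entry y a m)))))

/-- See `Inst.Linked`. -/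
def linked (y a m : Tm) : Fm := .imp (.lt (.add m (.const 1)) vJ)
  (.or (.eq (exit y a m) (entry y a (.add m (.const 1))))
    (.and (.eq (adj (exit y a m) (entry y a (.add m (.const 1)))) (.const 1))
      (.eq (lev a (entry y a (.add m (.const 1)))) (.add (lev a (exit y a m)) (.const 1)))))

/-- See `Inst.OnTime`. -/
def onTime (y t a m : Tm) : Fm := .imp (active y t a m)
  (.and (.eq (lev (clock y a m) (pebble y a m)) t)
  (.and (.imp (.eq t (lev (clock y a m) (entry y a m))) (.eq (pebble y a m) (entry y a m)))
  (.imp (.eq t (lev (clock y a m) (exit y a m))) (.eq (pebble y a m) (exit y a m)))))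

/-- See `Inst.Apart`. -/
def apart (y t a m a' m' : Tm) : Fm :=
  .and (.imp (.eq (clock y a m) (clock y a' m')) (.imp (active y t a m) (.imp (active y t a' m')
    (.imp (.eq (pebble y a m) (pebble y a' m'))
      (.or (.eq (pebble y a m) (src a)) (.eq (pebble y a m) (tgt a)))))))
  (.imp (.neg (.eq (clock y a m) (clock y a' m')))
    (.all 12 vN (.neg (.and (inBox y a m (.var 12)) (inBox y a' m' (.var 12))))))

/-- See `Inst.Good`. -/
def good : Fm := .all 8 vL (.and (ends vY (.var 8)) (.all 9 vJ (
  .and (inRange vY (.var 8) (.var 9)) (.and (uniform vY (.var 8) (.var 9))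
  (.and (linked vY (.var 8) (.var 9)) (.and (onTime vY vT (.var 8) (.var 9))
  (.all 10 vL (.imp (.neg (.eq (.var 10) (.var 8))) (.all 11 vJ
    (apart vY vT (.var 8) (.var 9) (.var 10) (.var 11)))))))))))

/-- See `Inst.Step`. -/
def step : Fm := .all 8 vL (.all 9 vJ (
  .and (.eq (entry (.var 7) (.var 8) (.var 9)) (entry vY (.var 8) (.var 9)))
  (.and (.eq (exit (.var 7) (.var 8) (.var 9)) (exit vY (.var 8) (.var 9)))
  (.and (.eq (clock (.var 7) (.var 8) (.var 9)) (clock vY (.var 8) (.var 9)))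
  (.imp (active vY (.sub vT (.const 1)) (.var 8) (.var 9)) (.imp (active vY vT (.var 8) (.var 9))
    (.eq (adj (pebble (.var 7) (.var 8) (.var 9)) (pebble vY (.var 8) (.var 9)))
      (.const 1))))))))

/-- The truth value to be stored for the current time and code; that for time `t` and code `y` is
kept in the memory cell `t * D + y`. -/
def update : Fm := .and good (.or (.eq vT (.const 0)) (.ex 7 vD (.and
  (.eq (.load (.add (.mul (.sub vT (.const 1)) vD) (.var 7))) (.const 1)) step)))

/-- Some code is reached at the end. -/
def final : Fm := .ex 6 vD (.eq (.load (.add (.mul (.sub vN (.const 1)) vD) vY)) (.const 1))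

variable {inp mem reg : ℕ → ℕ}

/-- The instance described by the registers and the input. -/
def inst (inp reg : ℕ → ℕ) : Inst := .ofInput inp (reg 1) (reg 2) (reg 3)

theorem eval_entry (y a m : Tm) : (entry y a m).eval inp mem reg =
    (inst inp reg).entry (y.eval inp mem reg) (a.eval inp mem reg) (m.eval inp mem reg) := rfl

theorem eval_exit (y a m : Tm) : (exit y a m).eval inp mem reg =
    (inst inp reg).exit (y.eval inp mem reg) (a.eval inp mem reg) (m.eval inp mem reg) := rfl

theorem eval_clock (y a m : Tm) : (clock y a m).eval inp mem reg =
    (inst inp reg).clock (y.eval inp mem reg) (a.eval inp mem reg) (m.eval inp mem reg) := rfl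

theorem eval_pebble (y a m : Tm) : (pebble y a m).eval inp mem reg =
    (inst inp reg).pebble (y.eval inp mem reg) (a.eval inp mem reg) (m.eval inp mem reg) := rfl

theorem eval_adj (x y : Tm) : (adj x y).eval inp mem reg =
    (inst inp reg).adj (x.eval inp mem reg) (y.eval inp mem reg) := by
  simp [adj, input, Tm.eval, inst, Inst.ofInput, vN]

theorem eval_src (a : Tm) : (src a).eval inp mem reg =
    (inst inp reg).src (a.eval inp mem reg) := by
  simp [src, input, Tm.eval, inst, Inst.ofInput, vN]

theorem eval_tgt (a : Tm) : (tgt a).eval inp mem reg =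
    (inst inp reg).tgt (a.eval inp mem reg) := by
  simp [tgt, input, Tm.eval, inst, Inst.ofInput, vN, vL]

theorem eval_lev (a x : Tm) : (lev a x).eval inp mem reg =
    (inst inp reg).lev (a.eval inp mem reg) (x.eval inp mem reg) := rfl

theorem holds_active (y t a m : Tm) : (active y t a m).Holds inp mem reg ↔
    (inst inp reg).Active (y.eval inp mem reg) (t.eval inp mem reg) (a.eval inp mem reg)
      (m.eval inp mem reg) := by
  simp only [active, Fm.holds_or, Fm.holds_and, Fm.holds_le, eval_lev, eval_clock, eval_entry,
    eval_exit, Inst.Active]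

theorem inst_update (x v : ℕ) (h : 3 < x) : inst inp (Function.update reg x v) = inst inp reg := by
  simp [inst, Function.update_of_ne, show 1 ≠ x by omega, show 2 ≠ x by omega,
    show 3 ≠ x by omega]

theorem eval_var_update (x v j : ℕ) : (Tm.var j).eval inp mem (Function.update reg x v) =
    if j = x then v else reg j := by
  simp [Tm.eval, Function.update_apply]

theorem holds_inBox (i j k m : ℕ) (hi : i < 13) (hj : j < 13) (hk : k < 13) (hm : m < 13) :
    (inBox (.var i) (.var j) (.var k) (.var m)).Holds inp mem reg ↔
    (inst inp reg).InBox (reg i) (reg j) (reg k) (reg m) := by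
  simp only [inBox, Fm.holds_all, Fm.holds_and, Fm.holds_le, Tm.eval.eq_3, eval_lev,
    eval_entry, eval_exit, Inst.InBox, inst_update _ _ (show 3 < 13 by omega), eval_var_update,
    hi.ne, hj.ne, hk.ne, hm.ne, if_false, if_true]
  rfl

/-- Quantifiers overwrite only the registers `8` to `13`, whereas the instance is read from the
registers `1` to `3`; hence it survives all the updates. -/
theorem holds_good : good.Holds inp mem reg ↔ (inst inp reg).Good (reg 5) (reg 6) := by
  simp only [good, ends, inRange, uniform, linked, onTime, apart, vT, vY,
    Fm.holds_all, Fm.holds_and, Fm.holds_le, Fm.holds_lt, Fm.holds_eq, Fm.holds_neg,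
    Fm.holds_imp, Fm.holds_or, eval_lev, eval_clock, holds_active,
    eval_entry, eval_exit, eval_pebble, eval_adj, eval_src, eval_tgt]
  simp (disch := omega) only [holds_inBox, inst_update, eval_var_update, Tm.eval.eq_2,
    Tm.eval.eq_3, Tm.eval.eq_4]
  simp [Inst.Good, Inst.Ends, Inst.InRange, Inst.Uniform, Inst.Linked, Inst.OnTime, Inst.Apart]
  rfl

theorem holds_step : step.Holds inp mem reg ↔
    (inst inp reg).Step (reg 5) (reg 7) (reg 6) := by
  simp only [step, vT, vY, Fm.holds_all, Fm.holds_and, Fm.holds_eq,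
    Fm.holds_imp, eval_clock, holds_active, eval_entry, eval_exit, eval_pebble, eval_adj]
  simp (disch := omega) only [inst_update, eval_var_update, Tm.eval.eq_2,
    Tm.eval.eq_4]
  simp [Inst.Step]
  rfl

end CheckFormula

/-! ### The table of reachable codes -/

namespace Inst

open Classical in
/-- The table of the codes reached at the various times, row by row. -/
noncomputable def table (I : Inst) (D z : ℕ) : ℕ := if I.Reached D (z / D) (z % D) then 1 else 0

theorem table_eq_one {I : Inst} {D t y : ℕ} (hy : y < D) :
    I.table D (t * D + y) = 1 ↔ I.Reached D t y := by
  have h1 : (t * D + y) / D = t := by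
    rw [mul_comm, Nat.mul_add_div (by omega), Nat.div_eq_of_lt hy, add_zero]
  have h2 : (t * D + y) % D = y := by
    rw [mul_comm, Nat.mul_add_mod, Nat.mod_eq_of_lt hy]
  simp only [table, h1, h2]
  split_ifs with h <;> simpa [h1, h2] using h

theorem table_le_one (I : Inst) (D z : ℕ) : I.table D z ≤ 1 := by
  simp only [table]
  split_ifs <;> omega

end Inst

namespace CheckFormula

open RAM

variable {inp mem reg : ℕ → ℕ}

/-- Only the row of the previous time is consulted, and it ends before the cell `t * D`, so it is
already complete when row `t` is being filled. -/
theorem holds_update (hmem : ∀ z, mem z =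
    if z < reg 5 * reg 4 + reg 6 then (inst inp reg).table (reg 4) z else 0) :
    update.Holds inp mem reg ↔ (inst inp reg).Reached (reg 4) (reg 5) (reg 6) := by
  simp only [update, Fm.holds_and, Fm.holds_or, Fm.holds_eq, Fm.holds_ex, holds_good, holds_step,
    vT, vD, Tm.eval.eq_1, Tm.eval.eq_2, Tm.eval.eq_3, Tm.eval.eq_4, Tm.eval.eq_5, Tm.eval.eq_8]
  simp (disch := omega) only [inst_update, Function.update_self, Function.update_of_ne]
  rcases h : reg 5 with _ | t
  · simp [Inst.Reached]
  · simp only [Nat.succ_ne_zero, false_or, Inst.Reached, Nat.add_sub_cancel]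
    refine and_congr_right fun _ => exists_congr fun y => and_congr_right fun hlt =>
      and_congr_left fun _ => ?_
    rw [hmem, if_pos, Inst.table_eq_one hlt]
    rw [h, Nat.succ_mul]
    omega

theorem holds_final (h1 : 1 ≤ reg 1) (hmem : ∀ z, mem z =
    if z < reg 1 * reg 4 then (inst inp reg).table (reg 4) z else 0) :
    final.Holds inp mem reg ↔ ∃ y < reg 4, (inst inp reg).Reached (reg 4) (reg 1 - 1) y := by
  simp only [final, Fm.holds_eq, Fm.holds_ex, vN, vD, vY, Tm.eval.eq_1, Tm.eval.eq_2,
    Tm.eval.eq_3, Tm.eval.eq_4, Tm.eval.eq_5, Tm.eval.eq_8]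
  simp (disch := omega) only [Function.update_self, Function.update_of_ne]
  refine exists_congr fun y => and_congr_right fun hlt => ?_
  rw [hmem, if_pos, Inst.table_eq_one hlt]
  have : reg 1 * reg 4 = (reg 1 - 1) * reg 4 + reg 4 := by
    rw [← Nat.succ_mul, Nat.succ_eq_add_one, Nat.sub_add_cancel h1]
  omega

end CheckFormula

/-! ### The program -/

namespace DSPProgram

open RAM

/-- `R[x] := t` -/
def assign (x : ℕ) (t : Tm) : Prog := .seq (t.comp 30) (.seq (.const x 0) (.add x x 30))

/-- Some term is computable in time `X ^ K` with a result of size at most `X ^ K`. -/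
theorem halts_assign {t : Tm} {K : ℕ} (ht : t.PolyTime K) (hb : t.bd ≤ 30) {inp : ℕ → ℕ} {X : ℕ}
    {σ : State} (hX : 2 ≤ X) (hreg : ∀ j < t.bd, σ.reg j ≤ X) (hmem : ∀ a, σ.mem a ≤ X) {x : ℕ}
    (hx : x < 30) : Halts inp (assign x t) σ (X ^ K + (1 + 1)) fun τ =>
      τ.reg x = t.eval inp σ.mem σ.reg ∧ (∀ j < 30, j ≠ x → τ.reg j = σ.reg j) ∧
      τ.mem = σ.mem := by
  refine .seq' ((ht inp X σ hX hreg hmem).2 30 hb) fun τ hτ => .seq (.const (.add ⟨?_, ?_, ?_⟩))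
  · simp [hx.ne', hτ.1]
  · intro j hj hjx
    simp [hjx, hτ.2.1 j hj]
  · simp [hτ.2.2]

/-- `R[3] * R[2] * R[2]` -/
def tmJ : Tm := .mul (.mul (.var 3) (.var 2)) (.var 2)

/-- `R[4] * (R[1] + R[2] + 1)` -/
def tmD : Tm := .mul (.var 4) (.add (.add (.var 1) (.var 2)) (.const 1))

/-- The number of digits of a code. -/
def tmN : Tm := .mul (.const 4) (.mul (.var 2) (.var 3))

/-- Computes the number of pieces. -/
def progJ : Prog := .seq (.sub 18 2 15) (.seq (.cond 18 (.const 19 0) (.const 16 0))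
  (.seq (.const 3 8) (.loop 16 (.seq (assign 3 tmJ) (.sub 16 16 15)))))

/-- Computes the number of codes. -/
def progD : Prog := .seq (assign 17 tmN) (.seq (.const 4 1)
  (.loop 17 (.seq (assign 4 tmD) (.sub 17 17 15))))

/-- Fills a row of the table. -/
def progRow : Prog := .seq (.const 6 0) (.seq (.const 17 0) (.seq (.add 17 17 4)
  (.loop 17 (.seq (CheckFormula.update.comp 30) (.seq (.store 14 30) (.seq (.add 14 14 15)
    (.seq (.add 6 6 15) (.sub 17 17 15))))))))

/-- Fills the table. -/
def progTable : Prog := .seq (.const 5 0) (.seq (.const 14 0) (.seq (.const 16 0)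
  (.seq (.add 16 16 1) (.loop 16 (.seq progRow (.seq (.add 5 5 15) (.sub 16 16 15)))))))

/-- Reads off the answer. -/
def progAnswer : Prog := .seq (CheckFormula.final.comp 30) (.seq (.const 0 0) (.add 0 0 30))

/-- Decides an instance with at least two vertices and one request. -/
def progMain : Prog := .seq progJ (.seq progD (.seq progTable progAnswer))

/-- Decides an instance. -/
def prog : Prog := .seq (.const 15 1) (.seq (.const 16 0) (.seq (.read 1 16) (.seq (.read 16 15)
  (.seq (.const 17 2) (.seq (.read 2 17) (.cond 2 (.seq (.sub 18 1 15)
    (.cond 18 progMain (.const 0 1))) (.const 0 1)))))))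

variable {inp : ℕ → ℕ}

/-- Multiplies by `l * l` in each of `k` rounds. For `l = 1` the factor is `1` and `k` may exceed
every bound in terms of `n`, so the program then sets the loop counter to `0`; accordingly the
hypothesis bounds `k` only for `l ≠ 1`. -/
theorem halts_progJ {K X : ℕ} (hK : tmJ.PolyTime K) (hX : 2 ≤ X) {σ : State} (h1 : σ.reg 15 = 1)
    (hl : σ.reg 2 ≠ 0) (hX012 : ∀ j < 3, σ.reg j ≤ X) (hkX : σ.reg 2 ≠ 1 → σ.reg 16 ≤ X)
    (hJX : 8 * σ.reg 2 ^ (2 * σ.reg 16) ≤ X) (hm : ∀ a, σ.mem a ≤ X) :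
    Halts inp progJ σ (1 + ((1 + 1) + (1 + (X * (((X ^ K + (1 + 1)) + 1) + 1) + 1)))) fun τ =>
      τ.reg 3 = 8 * σ.reg 2 ^ (2 * σ.reg 16) ∧
      (∀ j < 30, j ≠ 3 → j ≠ 16 → j ≠ 18 → j ≠ 19 → τ.reg j = σ.reg j) ∧ τ.mem = σ.mem := by
  refine .seq (.sub (.seq' (R := fun τ => τ.reg 16 ≤ X ∧
    8 * σ.reg 2 ^ (2 * τ.reg 16) = 8 * σ.reg 2 ^ (2 * σ.reg 16) ∧
    (∀ j < 30, j ≠ 16 → j ≠ 18 → j ≠ 19 → τ.reg j = σ.reg j) ∧ τ.mem = σ.mem) ?_ fun τ hτ =>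
      .seq (.const ?_)))
  · refine .cond (fun h => .const ⟨?_, ?_, ?_, rfl⟩) (fun h => .const ⟨?_, ?_, ?_, rfl⟩)
    · simp [h1] at h
      simpa using hkX (by omega)
    · simp
    · intro j _ j1 j2 j3
      simp [j2, j3]
    · simp
    · simp [h1] at h
      have : σ.reg 2 = 1 := by omega
      simp [this]
    · intro j _ j1 j2 j3
      simp [j1, j2]
  · obtain ⟨h16, hJ, hj, hmem⟩ := hτ
    have hl1 : 1 ≤ σ.reg 2 := by omega
    let I : ℕ → State → Prop := fun i ρ => i ≤ τ.reg 16 ∧ ρ.reg 16 = i ∧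
      ρ.reg 3 = 8 * σ.reg 2 ^ (2 * (τ.reg 16 - i)) ∧
      (∀ j < 30, j ≠ 3 → j ≠ 16 → j ≠ 18 → j ≠ 19 → ρ.reg j = σ.reg j) ∧ ρ.mem = σ.mem
    refine (Halts.loop (T := (X ^ K + (1 + 1)) + 1) I (fun τ h => h.2.1)
      (fun i τ h => by have := h.2.1; omega) ?_ (τ.reg 16) _ ?_).mono ?_ ?_
    · rintro i ρ ⟨hi, h2, h3, h4, h5⟩
      have hle : ρ.reg 3 ≤ X := by
        rw [h3]
        refine le_trans ?_ (hJ.trans_le hJX)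
        exact Nat.mul_le_mul_left _ (Nat.pow_le_pow_right hl1 (by omega))
      refine .seq' (halts_assign hK (by decide) hX (fun j hj => ?_) (fun a => ?_) (by omega))
        fun π hπ => .sub ⟨by omega, ?_, ?_, ?_, ?_⟩
      · have hj : j < 4 := hj
        rcases Nat.lt_succ_iff_lt_or_eq.1 hj with hj | rfl
        · rw [h4 j (by omega) (by omega) (by omega) (by omega) (by omega)]
          exact hX012 j hj
        · exact hle
      · rw [h5]; exact hm a
      · simp [hπ.2.1 15, hπ.2.1 16, h2, h4 15, h1]
      · have e : τ.reg 16 - i = τ.reg 16 - (i + 1) + 1 := by omega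
        simp [hπ.1, tmJ, Tm.eval, h3, h4 2, e]
        ring
      · intro j hj j1 j2 j3 j4
        simp [j2, hπ.2.1 j hj j1, h4 j hj j1 j2 j3 j4]
      · simp [hπ.2.2, h5]
    · refine ⟨le_rfl, by simp, by simp, ?_, by simp [hmem]⟩
      intro j hjj j1 j2 j3 j4
      simp [j1, hj j hjj j2 j3 j4]
    · gcongr
    · rintro ρ ⟨h0, h2, h3, h4, h5⟩
      refine ⟨?_, h4, h5⟩
      rw [h3, Nat.sub_zero, hJ]

theorem halts_progD {K L X : ℕ} (hK : tmN.PolyTime K) (hL : tmD.PolyTime L) (hX : 2 ≤ X)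
    {σ : State} (h1 : σ.reg 15 = 1) (hreg : ∀ j < 4, σ.reg j ≤ X)
    (hNX : 4 * (σ.reg 2 * σ.reg 3) ≤ X)
    (hDX : (σ.reg 1 + σ.reg 2 + 1) ^ (4 * (σ.reg 2 * σ.reg 3)) ≤ X) (hm : ∀ a, σ.mem a ≤ X) :
    Halts inp progD σ ((X ^ K + (1 + 1)) + (1 + (X * (((X ^ L + (1 + 1)) + 1) + 1) + 1))) fun τ =>
      τ.reg 4 = (σ.reg 1 + σ.reg 2 + 1) ^ (4 * (σ.reg 2 * σ.reg 3)) ∧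
      (∀ j < 30, j ≠ 4 → j ≠ 17 → τ.reg j = σ.reg j) ∧ τ.mem = σ.mem := by
  refine .seq' (halts_assign hK (by decide) hX hreg hm (by omega)) fun τ hτ => .seq (.const ?_)
  obtain ⟨h17, hj, hmem⟩ := hτ
  simp only [tmN, Tm.eval] at h17
  set N := 4 * (σ.reg 2 * σ.reg 3) with hN
  set b := σ.reg 1 + σ.reg 2 + 1 with hb
  let I : ℕ → State → Prop := fun i ρ => i ≤ N ∧ ρ.reg 17 = i ∧ ρ.reg 4 = b ^ (N - i) ∧
      (∀ j < 30, j ≠ 4 → j ≠ 17 → ρ.reg j = σ.reg j) ∧ ρ.mem = σ.mem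
  refine (Halts.loop (T := (X ^ L + (1 + 1)) + 1) I (fun τ h => h.2.1)
    (fun i τ h => by have := h.2.1; omega) ?_ N _ ?_).mono ?_ ?_
  · rintro i ρ ⟨hi, h2, h3, h4, h5⟩
    have hle : ρ.reg 4 ≤ X := by
      rw [h3]
      exact le_trans (Nat.pow_le_pow_right (by omega) (by omega)) hDX
    refine .seq' (halts_assign hL (by decide) hX (fun j hj => ?_) (fun a => ?_) (by omega))
      fun π hπ => .sub ⟨by omega, ?_, ?_, ?_, ?_⟩
    · have hj : j < 5 := hj
      rcases Nat.lt_succ_iff_lt_or_eq.1 hj with hj | rfl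
      · rw [h4 j (by omega) (by omega) (by omega)]
        exact hreg j hj
      · exact hle
    · rw [h5]; exact hm a
    · simp [hπ.2.1 15, hπ.2.1 17, h2, h4 15, h1]
    · have e : N - i = N - (i + 1) + 1 := by omega
      simp [hπ.1, tmD, Tm.eval, h3, h4 1, h4 2, e, ← hb, pow_succ]
    · intro j hj j1 j2
      simp [j2, hπ.2.1 j hj j1, h4 j hj j1 j2]
    · simp [hπ.2.2, h5]
  · refine ⟨le_rfl, by simpa using h17, by simp, ?_, by simp [hmem]⟩
    intro j hjj j1 j2
    simp [j1, hj j hjj j2]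
  · gcongr
  · rintro ρ ⟨h0, h2, h3, h4, h5⟩
    exact ⟨by simpa using h3, h4, h5⟩

/-- The first `Z` entries of the table are filled in. -/
def Filled (I : Inst) (D Z : ℕ) (mem : ℕ → ℕ) : Prop :=
  ∀ z, mem z = if z < Z then I.table D z else 0

theorem Filled.le {I : Inst} {D Z X : ℕ} {mem : ℕ → ℕ} (h : Filled I D Z mem) (hX : 2 ≤ X)
    (z : ℕ) : mem z ≤ X := by
  rw [h z]
  have := I.table_le_one D z
  split_ifs <;> omega

open CheckFormula in
theorem halts_progRow {K X : ℕ} (hK : update.PolyTime K) (hX : 2 ≤ X) {σ : State}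
    (h1 : σ.reg 15 = 1) (hreg : ∀ j < 14, σ.reg j ≤ X)
    (hZ : σ.reg 14 = σ.reg 5 * σ.reg 4)
    (hm : Filled (inst inp σ.reg) (σ.reg 4) (σ.reg 5 * σ.reg 4) σ.mem) :
    Halts inp progRow σ (1 + (1 + (1 + (X * ((X ^ K + (1 + (1 + (1 + 1)))) + 1) + 1)))) fun τ =>
      τ.reg 6 = σ.reg 4 ∧ τ.reg 14 = σ.reg 5 * σ.reg 4 + σ.reg 4 ∧
      (∀ j < 30, j ≠ 6 → j ≠ 14 → j ≠ 17 → τ.reg j = σ.reg j) ∧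
      Filled (inst inp σ.reg) (σ.reg 4) (σ.reg 5 * σ.reg 4 + σ.reg 4) τ.mem := by
  set D := σ.reg 4 with hD
  set Z := σ.reg 5 * D with hZd
  let I : ℕ → State → Prop := fun i ρ => i ≤ D ∧ ρ.reg 17 = i ∧ ρ.reg 6 = D - i ∧
    ρ.reg 14 = Z + (D - i) ∧ (∀ j < 30, j ≠ 6 → j ≠ 14 → j ≠ 17 → ρ.reg j = σ.reg j) ∧
    Filled (inst inp σ.reg) D (Z + (D - i)) ρ.mem
  have hDX : D ≤ X := hreg 4 (by omega)
  refine .seq (.const (.seq (.const (.seq (.add ?_)))))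
  refine (Halts.loop (T := X ^ K + (1 + (1 + (1 + 1)))) I (fun τ h => h.2.1)
    (fun i τ h => by have := h.2.1; omega) ?_ D _ ?_).mono ?_ ?_
  · rintro i ρ ⟨hi, h2, h3, h4, h5, h6⟩
    have q4 : ρ.reg 4 = D := h5 4 (by omega) (by omega) (by omega) (by omega)
    have q5 : ρ.reg 5 = σ.reg 5 := h5 5 (by omega) (by omega) (by omega) (by omega)
    have qI : inst inp ρ.reg = inst inp σ.reg := by
      simp [inst, h5 1, h5 2, h5 3]
    have hu : update.Holds inp ρ.mem ρ.reg ↔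
        (inst inp σ.reg).Reached D (σ.reg 5) (D - (i + 1)) := by
      rw [holds_update, qI, q4, q5, h3]
      rw [qI, q4, q5, h3]
      exact h6
    refine .seq' (hK inp X ρ hX (fun j hj => ?_) (fun a => h6.le hX a) 30 (by decide)) fun π hπ =>
      .seq (.store (.seq (.add (.seq (.add (.sub ⟨by omega, ?_, ?_, ?_, ?_, ?_⟩))))))
    · have hj : j < 14 := hj
      by_cases hj6 : j = 6
      · subst hj6; omega
      · rw [h5 j (by omega) hj6 (by omega) (by omega)]; exact hreg j hj
    · simp [hπ.2.1 15, hπ.2.1 17, h2, h5 15, h1]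
    · simp [hπ.2.1 15, hπ.2.1 6, h5 15, h1, h3]; omega
    · simp [hπ.2.1 15, hπ.2.1 14, h5 15, h1, h4]; omega
    · intro j hj j1 j2 j3
      simp [j1, j2, j3, hπ.2.1 j hj, h5 j hj j1 j2 j3]
    -- The truth value just computed is the next entry of the table, because the cell `Z + (D - (i +
    -- 1))` belongs to the current time and the code `D - (i + 1)`.
    · have e : Z + (D - i) = Z + (D - (i + 1)) + 1 := by omega
      have e14 : π.reg 14 = Z + (D - (i + 1)) := by rw [hπ.2.1 14 (by omega), h4]
      have e30 : π.reg 30 = (inst inp σ.reg).table D (Z + (D - (i + 1))) := by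
        rw [hπ.1]
        by_cases hr : (inst inp σ.reg).Reached D (σ.reg 5) (D - (i + 1))
        · rw [Fm.val_eq_one (hu.2 hr),
            (Inst.table_eq_one (t := σ.reg 5) (show D - (i + 1) < D by omega)).2 hr]
        · rw [Fm.val_eq_zero (mt hu.1 hr)]
          have : (inst inp σ.reg).table D (Z + (D - (i + 1))) ≠ 1 :=
            mt (Inst.table_eq_one (t := σ.reg 5) (show D - (i + 1) < D by omega)).1 hr
          have := (inst inp σ.reg).table_le_one D (Z + (D - (i + 1)))
          omega
      intro z
      rw [e]
      simp only [State.setReg_mem, State.setMem_mem, e14, e30, hπ.2.2, h6 z]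
      by_cases hz : z = Z + (D - (i + 1))
      · subst hz; simp
      · simp only [hz, if_false]
        by_cases hz' : z < Z + (D - (i + 1))
        · rw [if_pos hz', if_pos (by omega)]
        · rw [if_neg hz', if_neg (by omega)]
  · refine ⟨le_rfl, by simp [hD], by simp, by simpa using hZ, ?_, ?_⟩
    · intro j _ j1 j2 j3
      simp [j1, j3]
    · simpa using hm
  · gcongr
  · rintro ρ ⟨h0, h2, h3, h4, h5, h6⟩
    rw [Nat.sub_zero] at h3 h4 h6
    exact ⟨h3, h4, h5, h6⟩

open CheckFormula in
theorem halts_progTable {K X : ℕ} (hK : update.PolyTime K) (hX : 2 ≤ X) {σ : State}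
    (h1 : σ.reg 15 = 1) (hreg : ∀ j < 14, σ.reg j ≤ X) (hm : ∀ z, σ.mem z = 0) :
    Halts inp progTable σ (1 + (1 + (1 + (1 + (X * (((1 + (1 + (1 + (X * ((X ^ K + (1 + (1 +
        (1 + 1)))) + 1) + 1)))) + (1 + 1)) + 1) + 1))))) fun τ =>
      (∀ j < 14, τ.reg j ≤ X) ∧ (∀ j < 5, τ.reg j = σ.reg j) ∧
      Filled (inst inp σ.reg) (σ.reg 4) (σ.reg 1 * σ.reg 4) τ.mem := by
  set D := σ.reg 4 with hD
  set n := σ.reg 1 with hn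
  have hDX : D ≤ X := hreg 4 (by omega)
  have hnX : n ≤ X := hreg 1 (by omega)
  let I : ℕ → State → Prop := fun i ρ => i ≤ n ∧ ρ.reg 16 = i ∧ ρ.reg 5 = n - i ∧
    ρ.reg 14 = (n - i) * D ∧ ρ.reg 15 = 1 ∧ (∀ j < 14, ρ.reg j ≤ X) ∧
    (∀ j < 5, ρ.reg j = σ.reg j) ∧ Filled (inst inp σ.reg) D ((n - i) * D) ρ.mem
  refine .seq (.const (.seq (.const (.seq (.const (.seq (.add ?_)))))))
  refine (Halts.loop (T := (1 + (1 + (1 + (X * ((X ^ K + (1 + (1 +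
        (1 + 1)))) + 1) + 1)))) + (1 + 1)) I (fun τ h => h.2.1)
    (fun i τ h => by have := h.2.1; omega) ?_ n _ ?_).mono ?_ ?_
  · rintro i ρ ⟨hi, h2, h3, h4, h5, h6, h7, h8⟩
    have q4 : ρ.reg 4 = D := h7 4 (by omega)
    have qI : inst inp ρ.reg = inst inp σ.reg := by simp [inst, h7 1, h7 2, h7 3]
    have e : n - i = n - (i + 1) + 1 := by omega
    refine .seq' (halts_progRow hK hX h5 h6 (by rw [h4, h3, q4]) (by rw [qI, q4, h3]; exact h8))
      fun π hπ => ?_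
    obtain ⟨p1, p2, p3, p4⟩ := hπ
    rw [h3, q4] at p2 p4
    rw [qI] at p4
    rw [← Nat.succ_mul, Nat.succ_eq_add_one, ← e] at p2 p4
    have r5 : π.reg 5 = n - (i + 1) := by rw [p3 5 (by omega) (by omega) (by omega) (by omega), h3]
    have r15 : π.reg 15 = 1 := by rw [p3 15 (by omega) (by omega) (by omega) (by omega), h5]
    have r16 : π.reg 16 = i + 1 := by rw [p3 16 (by omega) (by omega) (by omega) (by omega), h2]
    refine .seq (.add (.sub ⟨by omega, ?_, ?_, ?_, ?_, ?_, ?_, ?_⟩))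
    · simp [r15, r16]
    · simp [r15, r5]; omega
    · simp [p2]
    · simp [r15]
    · intro j hj
      by_cases j5 : j = 5
      · subst j5
        simp [r5, r15]; omega
      · have j16 : j ≠ 16 := by omega
        simp only [State.setReg_reg, j5, j16, if_false]
        by_cases j6 : j = 6
        · subst j6; omega
        · rw [p3 j (by omega) j6 (by omega) (by omega)]; exact h6 j hj
    · intro j hj
      have j16 : j ≠ 16 := by omega
      have j5 : j ≠ 5 := by omega
      simp only [State.setReg_reg, j5, j16, if_false]
      rw [p3 j (by omega) (by omega) (by omega) (by omega), h7 j hj]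
    · exact p4
  · refine ⟨le_rfl, by simp [hn], by simp, by simp, by simp [h1], fun j hj => ?_, fun j hj => ?_,
      fun z => by simp [hm]⟩
    · have j16 : j ≠ 16 := by omega
      have j14 : j ≠ 14 := by omega
      by_cases j5 : j = 5
      · simp [j5]
      · simp [j16, j14, j5, hreg j hj]
    · have j16 : j ≠ 16 := by omega
      have j14 : j ≠ 14 := by omega
      have j5 : j ≠ 5 := by omega
      simp [j16, j14, j5]
  · gcongr
  · rintro ρ ⟨h0, h2, h3, h4, h5, h6, h7, h8⟩
    rw [Nat.sub_zero] at h8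
    exact ⟨h6, h7, h8⟩

open CheckFormula in
theorem halts_progAnswer {K X : ℕ} (hK : final.PolyTime K) (hX : 2 ≤ X) {σ : State}
    (hn : 1 ≤ σ.reg 1) (hreg : ∀ j < 14, σ.reg j ≤ X)
    (hm : Filled (inst inp σ.reg) (σ.reg 4) (σ.reg 1 * σ.reg 4) σ.mem) :
    Halts inp progAnswer σ (X ^ K + (1 + 1)) fun τ =>
      ((∃ y < σ.reg 4, (inst inp σ.reg).Reached (σ.reg 4) (σ.reg 1 - 1) y) → τ.reg 0 = 1) ∧
      (¬ (∃ y < σ.reg 4, (inst inp σ.reg).Reached (σ.reg 4) (σ.reg 1 - 1) y) → τ.reg 0 = 0) := by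
  rw [← holds_final hn hm]
  refine .seq' (hK inp X σ hX (fun j hj => hreg j (hj.trans_le (by decide))) (fun a => hm.le hX a)
    30 (by decide)) fun τ hτ => .seq (.const (.add ⟨fun h => ?_, fun h => ?_⟩))
  · simp [hτ.1, Fm.val_eq_one h]
  · simp [hτ.1, Fm.val_eq_zero h]

end DSPProgram

/-! ### Correctness and running time of the whole program -/

namespace DSPProgram

open RAM CheckFormula

/-- The cube comes from the table: two nested loops of at most `X` rounds around an evaluation of
cost `d`. -/
theorem time_bound {X Y : ℕ} (hY : 1 ≤ Y) (hXY : X ≤ Y) {a b c d e : ℕ} (ha : a ≤ Y) (hb : b ≤ Y)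
    (hc : c ≤ Y) (hd : d ≤ Y) (he : e ≤ Y) :
    (1 + ((1 + 1) + (1 + (X * (((a + (1 + 1)) + 1) + 1) + 1)))) +
    (((b + (1 + 1)) + (1 + (X * (((c + (1 + 1)) + 1) + 1) + 1))) +
    ((1 + (1 + (1 + (1 + (X * (((1 + (1 + (1 + (X * ((d + (1 + (1 +
        (1 + 1)))) + 1) + 1)))) + (1 + 1)) + 1) + 1))))) + (e + (1 + 1)))) ≤ 64 * Y ^ 3 := by
  have h2 : Y ≤ Y ^ 2 := by nlinarith
  have h3 : Y ^ 2 ≤ Y ^ 3 := by nlinarith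
  have e1 : X * (((a + (1 + 1)) + 1) + 1) ≤ Y * (((Y + (1 + 1)) + 1) + 1) := by gcongr
  have e2 : X * (((c + (1 + 1)) + 1) + 1) ≤ Y * (((Y + (1 + 1)) + 1) + 1) := by gcongr
  have e3 : X * (((1 + (1 + (1 + (X * ((d + (1 + (1 + (1 + 1)))) + 1) + 1)))) + (1 + 1)) + 1) ≤
    Y * (((1 + (1 + (1 + (Y * ((Y + (1 + (1 + (1 + 1)))) + 1) + 1)))) + (1 + 1)) + 1) := by gcongr
  have e4 : Y * (((Y + (1 + 1)) + 1) + 1) = Y ^ 2 + 4 * Y := by ring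
  have e5 : Y * (((1 + (1 + (1 + (Y * ((Y + (1 + (1 + (1 + 1)))) + 1) + 1)))) + (1 + 1)) + 1) =
    Y ^ 3 + 5 * Y ^ 2 + 7 * Y := by ring
  omega

/-- The number of pieces into which every path is cut. -/
def numPieces (k l : ℕ) : ℕ := 8 * l ^ (2 * k)

/-- The number of codes. -/
def numCodes (n k l : ℕ) : ℕ := (n + l + 1) ^ (4 * (l * numPieces k l))

theorem exists_halts_progMain : ∃ K, ∀ (inp : ℕ → ℕ) (n k l : ℕ) (σ : State), 2 ≤ n → 1 ≤ l →
    σ.reg 1 = n → σ.reg 2 = l → σ.reg 16 = k → σ.reg 15 = 1 →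
    (∀ j < 14, j ≠ 1 → j ≠ 2 → σ.reg j = 0) → (∀ z, σ.mem z = 0) →
    Halts inp progMain σ (numCodes n k l ^ K) fun τ =>
      ((∃ y < numCodes n k l, (Inst.ofInput inp n l (numPieces k l)).Reached (numCodes n k l)
        (n - 1) y) → τ.reg 0 = 1) ∧
      (¬ (∃ y < numCodes n k l, (Inst.ofInput inp n l (numPieces k l)).Reached (numCodes n k l)
        (n - 1) y) → τ.reg 0 = 0) := by
  obtain ⟨a, ha⟩ := tmJ.exists_polyTime
  obtain ⟨b, hb⟩ := tmN.exists_polyTime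
  obtain ⟨c, hc⟩ := tmD.exists_polyTime
  obtain ⟨d, hd⟩ := update.exists_polyTime
  obtain ⟨e, he⟩ := final.exists_polyTime
  -- The `6` pays for the factor `64 = 2 ^ 6` in `time_bound`, and the common exponent dominates all
  -- five evaluations as well as `X` itself.
  refine ⟨6 + (a + b + c + d + e + 1) * 3, fun inp n k l σ hn hl h1 h2 h16 h15 h0 hm => ?_⟩
  have hl1 : 1 ≤ l ^ (2 * k) := Nat.one_le_pow _ _ hl
  have hJ : numPieces k l = 8 * l ^ (2 * k) := rfl
  have hJN : numPieces k l ≤ 4 * (l * numPieces k l) := by nlinarith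
  have hD : numCodes n k l = (n + l + 1) ^ (4 * (l * numPieces k l)) := rfl
  have hb1 : n + l + 1 ≤ numCodes n k l := by
    rw [hD]
    exact Nat.le_self_pow (by omega) _
  have hND : 4 * (l * numPieces k l) ≤ numCodes n k l := by
    rw [hD]
    exact (Nat.lt_pow_self (by omega)).le
  -- For `l ≥ 2` the number of pieces is already larger than `k`.
  have hkD : l ≠ 1 → k ≤ numCodes n k l := by
    intro hl'
    have e1 : k < l ^ k := Nat.lt_pow_self (by omega)
    have e2 : l ^ k ≤ l ^ (2 * k) := Nat.pow_le_pow_right hl (by omega)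
    omega
  generalize numCodes n k l = X at *
  have hX : 2 ≤ X := by omega
  generalize hJ' : numPieces k l = J at *
  have key : ∀ i, i ≤ a + b + c + d + e + 1 → X ^ i ≤ X ^ (a + b + c + d + e + 1) :=
    fun i h => Tm.pow_le_pow_sum hX h
  have hT : 64 * (X ^ (a + b + c + d + e + 1)) ^ 3 ≤ X ^ (6 + (a + b + c + d + e + 1) * 3) := by
    rw [pow_add X 6, pow_mul]
    have : 2 ^ 6 ≤ X ^ 6 := Nat.pow_le_pow_left hX 6
    gcongr
    simpa using this
  refine (Halts.seq' (halts_progJ ha hX h15 (by omega) (fun j hj => ?_) ?_ ?_ fun z => ?_)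
    fun τ hτ => .seq' (halts_progD hb hc hX ?_ (fun j hj => ?_) ?_ ?_ fun z => ?_)
    fun ρ hρ => .seq' (halts_progTable hd hX ?_ (fun j hj => ?_) fun z => ?_)
    fun π hπ => (halts_progAnswer he hX ?_ hπ.1 ?_).mono le_rfl ?_).mono ((time_bound (Y := X ^ (a + b + c + d +
      e + 1)) (Nat.one_le_pow _ _ (by omega)) (Nat.le_self_pow (by omega) _) (key a (by omega))
      (key b (by omega)) (key c (by omega)) (key d (by omega)) (key e (by omega))).trans hT)
      fun _ h => h
  · by_cases j1 : j = 1
    · subst j1; omega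
    · by_cases j2 : j = 2
      · subst j2; omega
      · rw [h0 j (by omega) j1 j2]; omega
  · rw [h2, h16]; exact hkD
  · rw [h2, h16, ← hJ]; omega
  · rw [hm]; omega
  all_goals obtain ⟨t3, tj, tm⟩ := hτ
  all_goals
    have t1 : τ.reg 1 = n := by rw [tj 1 (by omega) (by omega) (by omega) (by omega) (by omega), h1]
    have t2 : τ.reg 2 = l := by rw [tj 2 (by omega) (by omega) (by omega) (by omega) (by omega), h2]
    rw [h2, h16, ← hJ] at t3
  · rw [tj 15 (by omega) (by omega) (by omega) (by omega) (by omega), h15]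
  · by_cases j1 : j = 1
    · subst j1; omega
    · by_cases j2 : j = 2
      · subst j2; omega
      · by_cases j3 : j = 3
        · subst j3; omega
        · rw [tj j (by omega) (by omega) (by omega) (by omega) (by omega), h0 j (by omega) j1 j2]
          omega
  · rw [t2, t3]; exact hND
  · rw [t1, t2, t3, ← hD]
  · rw [tm, hm]; omega
  all_goals
    obtain ⟨r4, rj, rm⟩ := hρ
    rw [t1, t2, t3, ← hD] at r4
    have r1 : ρ.reg 1 = n := by rw [rj 1 (by omega) (by omega) (by omega), t1]
    have r2 : ρ.reg 2 = l := by rw [rj 2 (by omega) (by omega) (by omega), t2]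
    have r3 : ρ.reg 3 = J := by rw [rj 3 (by omega) (by omega) (by omega), t3]
  · rw [rj 15 (by omega) (by omega) (by omega),
      tj 15 (by omega) (by omega) (by omega) (by omega) (by omega), h15]
  · by_cases j1 : j = 1
    · subst j1; omega
    · by_cases j2 : j = 2
      · subst j2; omega
      · by_cases j3 : j = 3
        · subst j3; omega
        · by_cases j4 : j = 4
          · subst j4; omega
          · rw [rj j (by omega) j4 (by omega),
              tj j (by omega) (by omega) (by omega) (by omega) (by omega), h0 j (by omega) j1 j2]
            omega
  · rw [rm, tm, hm]
  all_goals
    obtain ⟨p14, pj, pf⟩ := hπ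
    have p1 : π.reg 1 = n := by rw [pj 1 (by omega), r1]
    have p2 : π.reg 2 = l := by rw [pj 2 (by omega), r2]
    have p3 : π.reg 3 = J := by rw [pj 3 (by omega), r3]
    have p4 : π.reg 4 = X := by rw [pj 4 (by omega), r4]
    have eI : inst inp π.reg = Inst.ofInput inp n l J := by simp [inst, p1, p2, p3]
    have eI' : inst inp ρ.reg = Inst.ofInput inp n l J := by simp [inst, r1, r2, r3]
  · omega
  · rw [eI, p4, p1]
    rwa [eI', r4, r1] at pf
  · rw [eI, p4, p1]
    exact fun κ hκ => hκ

theorem exists_halts_prog : ∃ K, ∀ (inp : ℕ → ℕ) (n k l : ℕ), inp 0 = n → inp 1 = k → inp 2 = l →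
    (n ≤ 1 ∨ l = 0 → Halts inp prog State.init 10 fun τ => τ.reg 0 = 1) ∧
    (2 ≤ n → 1 ≤ l → Halts inp prog State.init (numCodes n k l ^ K + 10) fun τ =>
      ((∃ y < numCodes n k l, (Inst.ofInput inp n l (numPieces k l)).Reached (numCodes n k l)
        (n - 1) y) → τ.reg 0 = 1) ∧
      (¬ (∃ y < numCodes n k l, (Inst.ofInput inp n l (numPieces k l)).Reached (numCodes n k l)
        (n - 1) y) → τ.reg 0 = 0)) := by
  obtain ⟨K, hK⟩ := exists_halts_progMain
  refine ⟨K, fun inp n k l h0 h1 h2 => ⟨fun h => ?_, fun hn hl => ?_⟩⟩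
  · refine (Halts.seq (.const (.seq (.const (.seq (.read (.seq (.read (.seq (.const (.seq (.read
      (.cond (T := 3) (fun hl => (Halts.seq (.sub (.cond (T := 1) (fun hn => ?_)
      fun hn => .const ?_))).mono (by omega) fun _ h => h) fun hl =>
        (Halts.const ?_).mono (by omega) fun _ h => h))))))))))))).mono (by omega) fun _ h => h
    · simp [State.init, h0, h2] at hn hl
      omega
    · simp
    · simp
  · refine (Halts.seq (.const (.seq (.const (.seq (.read (.seq (.read (.seq (.const (.seq (.read
      (.cond (T := 1 + (numCodes n k l ^ K + 1)) (fun hl' => (Halts.seq (.sub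
      (.cond (fun hn' => hK inp n k l _ hn hl ?_ ?_ ?_ ?_ ?_ ?_)
      fun hn' => ?_)))) fun hl' => ?_))))))))))))).mono (by omega) fun _ h => h
    · simp [State.init, h0]
    · simp [State.init, h2]
    · simp [State.init, h1]
    · simp
    · intro j hj j1 j2
      have e1 : j ≠ 15 := by omega
      have e2 : j ≠ 16 := by omega
      have e3 : j ≠ 17 := by omega
      have e4 : j ≠ 18 := by omega
      simp [State.init, j1, j2, e1, e2, e3, e4]
    · simp [State.init]
    · simp [State.init, h0] at hn'
      omega
    · simp [State.init, h2] at hl'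
      omega

end DSPProgram

/-! ### Cutting paths -/

namespace Cutting

/-- None of the cuts in `T` separates the positions `m₁ ≤ m₂`. -/
def Uncut (T : Finset ℕ) (m₁ m₂ : ℕ) : Prop := ∀ τ ∈ T, ¬ (m₁ < τ ∧ τ ≤ m₂)

theorem Uncut.subset {T T' : Finset ℕ} {m₁ m₂ : ℕ} (h : Uncut T m₁ m₂) (hT : T' ⊆ T) :
    Uncut T' m₁ m₂ := fun τ hτ => h τ (hT hτ)

/-- The first position with a given property. -/
noncomputable def first (P : ℕ → Prop) : ℕ := sInf {m | P m}

theorem first_spec {P : ℕ → Prop} {m : ℕ} (h : P m) : P (first P) ∧ first P ≤ m :=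
  ⟨Nat.sInf_mem (s := {m | P m}) ⟨m, h⟩, Nat.sInf_le h⟩

/-- A property inherited upwards that holds at the end of an uncut interval holds at its start. -/
theorem of_uncut {P : ℕ → Prop} {T : Finset ℕ} {n m₁ m₂ : ℕ}
    (hP : ∀ m m', m ≤ m' → m' ≤ n → P m → P m') (hT : first P ∈ T) (h : Uncut T m₁ m₂)
    (h12 : m₁ ≤ m₂) (h2 : m₂ ≤ n) (hm : P m₂) : P m₁ := by
  obtain ⟨h3, h4⟩ := first_spec hm
  have := h _ hT
  exact hP _ _ (by omega) (by omega) h3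

/-- Two paths in the plane, one monotone in both coordinates and the other one monotone in the
first and antitone in the second coordinate, can be cut so that the boxes spanned by uncut
intervals meet in a single line parallel to an axis only. -/
theorem exists_cut_pair {V : Type*} (p q : V → ℤ) (f g : ℕ → V) (n n' : ℕ)
    (hpf : ∀ m m', m ≤ m' → m' ≤ n → p (f m) ≤ p (f m'))
    (hqf : ∀ m m', m ≤ m' → m' ≤ n → q (f m) ≤ q (f m'))
    (hpg : ∀ m m', m ≤ m' → m' ≤ n' → p (g m) ≤ p (g m'))
    (hqg : ∀ m m', m ≤ m' → m' ≤ n' → q (g m') ≤ q (g m)) :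
    ∃ A B : Finset ℕ, A.card ≤ 2 ∧ B.card ≤ 2 ∧ ∃ (z : Bool) (d : ℤ),
      ∀ m₁ m₂ m₁' m₂', m₁ ≤ m₂ → m₂ ≤ n → m₁' ≤ m₂' → m₂' ≤ n' → Uncut A m₁ m₂ →
      Uncut B m₁' m₂' → ∀ w, p (f m₁) ≤ p w → p w ≤ p (f m₂) → q (f m₁) ≤ q w →
      q w ≤ q (f m₂) → p (g m₁') ≤ p w → p w ≤ p (g m₂') → q (g m₂') ≤ q w →
      q w ≤ q (g m₁') → (if z then p w else q w) = d := by
  classical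
  -- In the plane with coordinates `p`, `q`: `f m` is weakly north-east, respectively south-west, of
  -- some point of `g`. The first property is inherited by later positions and the second by earlier
  -- ones.
  let above : ℕ → Prop := fun m => ∃ m' ≤ n', p (g m') ≤ p (f m) ∧ q (g m') ≤ q (f m)
  let below : ℕ → Prop := fun m => ∃ m' ≤ n', p (f m) ≤ p (g m') ∧ q (f m) ≤ q (g m')
  have habove : ∀ m m', m ≤ m' → m' ≤ n → above m → above m' := by
    rintro m m' h h' ⟨r, hr, h1, h2⟩
    exact ⟨r, hr, h1.trans (hpf _ _ h h'), h2.trans (hqf _ _ h h')⟩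
  have hbelow : ∀ m m', m ≤ m' → m' ≤ n → ¬ below m → ¬ below m' := by
    rintro m m' h h' hb ⟨r, hr, h1, h2⟩
    exact hb ⟨r, hr, (hpf _ _ h h').trans h1, (hqf _ _ h h').trans h2⟩
  let v := Nat.findGreatest (fun m => ¬ above m) n
  let u := first fun m => ¬ below m
  -- A threshold that is never reached has the value `0`, at which `Uncut` forbids nothing. `B`
  -- marks where `g` passes the `p`-coordinates of the last position not above and of the first
  -- position not below.
  let A : Finset ℕ := {first above, first fun m => ¬ below m}
  let B : Finset ℕ := {first fun m' => p (f v) < p (g m'), first fun m' => p (f u) ≤ p (g m')}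
  have hA1 : first above ∈ A := by simp [A]
  have hA2 : (first fun m => ¬ below m) ∈ A := by simp [A]
  have hB1 : (first fun m' => p (f v) < p (g m')) ∈ B := by simp [B]
  have hB2 : (first fun m' => p (f u) ≤ p (g m')) ∈ B := by simp [B]
  -- an uncut interval whose box meets a box of the other path is above and below it
  have key : ∀ m₁ m₂ m₁' m₂', m₁ ≤ m₂ → m₂ ≤ n → m₁' ≤ m₂' → m₂' ≤ n' → Uncut A m₁ m₂ →
      Uncut B m₁' m₂' → ∀ w, p (f m₁) ≤ p w → p w ≤ p (f m₂) → q (f m₁) ≤ q w →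
      q w ≤ q (f m₂) → p (g m₁') ≤ p w → p w ≤ p (g m₂') → q (g m₂') ≤ q w →
      q w ≤ q (g m₁') → above m₁ ∧ below m₂ := by
    intro m₁ m₂ m₁' m₂' h12 h2 h12' h2' hA hB w w1 w2 w3 w4 w5 w6 w7 w8
    constructor
    -- If the piece is not above, `g m₂'` lies weakly south of `f v`. By the cut in `B` it does not
    -- lie strictly east of it either, for else so would `g m₁'` and then `w`. Hence `f v` would be
    -- above. The second half is the mirror argument at `u`.
    · by_contra hna
      have hna2 : ¬ above m₂ := fun h => hna (of_uncut habove hA1 hA h12 h2 h)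
      have hv : m₂ ≤ v := Nat.le_findGreatest h2 hna2
      have hvn : v ≤ n := Nat.findGreatest_le n
      have hv' : ¬ above v := Nat.findGreatest_spec (P := fun m => ¬ above m) h2 hna2
      refine hv' ⟨m₂', h2', ?_, w7.trans (w4.trans (hqf _ _ hv hvn))⟩
      by_contra hlt
      have := of_uncut (P := fun m' => p (f v) < p (g m')) (n := n')
        (fun m m' h h' hm => hm.trans_le (hpg _ _ h h')) hB1 hB h12' h2' (not_le.1 hlt)
      have := hpf _ _ hv hvn
      omega
    · by_contra hnb
      have hnb1 : ¬ below m₁ := of_uncut hbelow hA2 hA h12 h2 hnb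
      obtain ⟨hu', hu⟩ := first_spec (P := fun m => ¬ below m) hnb1
      have hpu : p (f u) ≤ p w := (hpf _ _ hu (by omega)).trans w1
      have hqu : q (f u) ≤ q w := (hqf _ _ hu (by omega)).trans w3
      exact hu' ⟨m₁', by omega, of_uncut (P := fun m' => p (f u) ≤ p (g m')) (n := n')
        (fun m m' h h' hm => le_trans hm (hpg _ _ h h')) hB2 hB h12' h2' (hpu.trans w6),
        hqu.trans w8⟩
  refine ⟨A, B, Finset.card_le_two, Finset.card_le_two, ?_⟩
  by_cases hex : ∃ m ≤ n, above m ∧ below m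
  · obtain ⟨m, hm, ha, hb⟩ := hex
    obtain ⟨hea, hem⟩ := first_spec (P := above) ha
    set e := first above
    let e' := Nat.findGreatest below n
    have heb : below e' := Nat.findGreatest_spec (P := below) hm hb
    have hen : e' ≤ n := Nat.findGreatest_le n
    have hme : m ≤ e' := Nat.le_findGreatest hm hb
    have hpe := hpf e e' (by omega) hen
    have hqe := hqf e e' (by omega) hen
    obtain ⟨y, hy, y1, y2⟩ := hea
    obtain ⟨y', hy', y1', y2'⟩ := heb
    have hloc : ∀ m₁ m₂, m₁ ≤ m₂ → m₂ ≤ n → above m₁ → below m₂ → e ≤ m₁ ∧ m₂ ≤ e' :=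
      fun m₁ m₂ h12 h2 h3 h4 => ⟨(first_spec (P := above) h3).2, Nat.le_findGreatest h2 h4⟩
    -- Here `g y ≤ f e` and `f e' ≤ g y'` in both coordinates. If `y ≤ y'`, antitonicity of `q`
    -- along `g` forces `q (f e') ≤ q (f e)`, so `q` is constant on the range from `e` to `e'`;
    -- otherwise the same holds for `p`.
    rcases le_total y y' with h | h
    · have hq := hqg _ _ h hy'
      refine ⟨false, q (f e), ?_⟩
      intro m₁ m₂ m₁' m₂' h12 h2 h12' h2' hA hB w w1 w2 w3 w4 w5 w6 w7 w8
      obtain ⟨k1, k2⟩ := key m₁ m₂ m₁' m₂' h12 h2 h12' h2' hA hB w w1 w2 w3 w4 w5 w6 w7 w8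
      obtain ⟨k3, k4⟩ := hloc _ _ h12 h2 k1 k2
      have := hqf _ _ k3 (by omega)
      have := hqf _ _ k4 hen
      simp only [Bool.false_eq_true, if_false]
      omega
    · have hp := hpg _ _ h hy
      refine ⟨true, p (f e), ?_⟩
      intro m₁ m₂ m₁' m₂' h12 h2 h12' h2' hA hB w w1 w2 w3 w4 w5 w6 w7 w8
      obtain ⟨k1, k2⟩ := key m₁ m₂ m₁' m₂' h12 h2 h12' h2' hA hB w w1 w2 w3 w4 w5 w6 w7 w8
      obtain ⟨k3, k4⟩ := hloc _ _ h12 h2 k1 k2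
      have := hpf _ _ k3 (by omega)
      have := hpf _ _ k4 hen
      simp only [if_true]
      omega
  · refine ⟨true, 0, ?_⟩
    intro m₁ m₂ m₁' m₂' h12 h2 h12' h2' hA hB w w1 w2 w3 w4 w5 w6 w7 w8
    obtain ⟨k1, k2⟩ := key m₁ m₂ m₁' m₂' h12 h2 h12' h2' hA hB w w1 w2 w3 w4 w5 w6 w7 w8
    exact (hex ⟨m₂, h2, habove _ _ h12 h2 k1, k2⟩).elim

end Cutting

/-! ### Choice of the clocks through linear relations between levels -/

namespace Cutting

/-- A system of paths in a graph with levels: along the path `f a` of colour `c a` the level of this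
colour increases by one in each step, and the other levels change by at most one. -/
structure PathSystem (V κ ι : Type*) where
  L : κ → V → ℤ
  c : ι → κ
  f : ι → ℕ → V
  len : ι → ℕ
  step : ∀ a m, m < len a → L (c a) (f a (m + 1)) = L (c a) (f a m) + 1
  lipschitz : ∀ a m h, m < len a → |L h (f a (m + 1)) - L h (f a m)| ≤ 1

namespace PathSystem

variable {V κ ι : Type*} (S : PathSystem V κ ι)

/-- Judging by its levels, the vertex `x` may lie between the positions `m₁` and `m₂` of the path
`a`. -/
def InBox (a : ι) (m₁ m₂ : ℕ) (x : V) : Prop := ∀ b,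
  |S.L (S.c b) x - S.L (S.c b) (S.f a m₁)| ≤ S.L (S.c a) x - S.L (S.c a) (S.f a m₁) ∧
  |S.L (S.c b) (S.f a m₂) - S.L (S.c b) x| ≤ S.L (S.c a) (S.f a m₂) - S.L (S.c a) x

theorem level_eq {a : ι} {m m' : ℕ} (h : m ≤ m') (h' : m' ≤ S.len a) :
    S.L (S.c a) (S.f a m') = S.L (S.c a) (S.f a m) + (m' - m : ℕ) := by
  induction m', h using Nat.le_induction with
  | base => simp
  | succ r hr ih =>
    rw [S.step a r (by omega), ih (by omega)]
    push_cast [Nat.sub_add_comm hr]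
    ring

theorem abs_level_sub_le {a : ι} {m m' : ℕ} (h : m ≤ m') (h' : m' ≤ S.len a) (j : κ) :
    |S.L j (S.f a m') - S.L j (S.f a m)| ≤ (m' - m : ℕ) := by
  induction m', h using Nat.le_induction with
  | base => simp
  | succ r hr ih =>
    have h1 := S.lipschitz a r j (by omega)
    have h2 := ih (by omega)
    rw [Nat.sub_add_comm hr]
    push_cast
    rw [abs_le] at *
    constructor <;> linarith [h1.1, h1.2, h2.1, h2.2]

theorem inBox_of_mem {a : ι} {m₁ m m₂ : ℕ} (h₁ : m₁ ≤ m) (h₂ : m ≤ m₂) (h : m₂ ≤ S.len a) :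
    S.InBox a m₁ m₂ (S.f a m) := by
  intro b
  have e1 := S.level_eq h₁ (h₂.trans h)
  have e2 := S.level_eq h₂ h
  have := S.abs_level_sub_le h₁ (h₂.trans h) (S.c b)
  have := S.abs_level_sub_le h₂ h (S.c b)
  constructor <;> linarith

/-- For a sign `e`, the difference of a level and `e` times another one is monotone along a path. -/
theorem monotone_sub {a : ι} {m m' : ℕ} (h : m ≤ m') (h' : m' ≤ S.len a) (j : κ) {e : ℤ}
    (he : e = 1 ∨ e = -1) : S.L (S.c a) (S.f a m) - e * S.L j (S.f a m) ≤
      S.L (S.c a) (S.f a m') - e * S.L j (S.f a m') := by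
  have e1 := S.level_eq h h'
  have e2 := abs_le.1 (S.abs_level_sub_le h h' j)
  rcases he with rfl | rfl <;> linarith [e2.1, e2.2]

/-- In the rotated coordinates `L_a ± L_b` the box is a rectangle spanned by its two ends. This is
the form needed both for the planar lemma and for the monotone functions `L_a - e * L_j`. -/
theorem InBox.sub_mem {a : ι} {m₁ m₂ : ℕ} {x : V} (h : S.InBox a m₁ m₂ x) (b : ι) {e : ℤ}
    (he : e = 1 ∨ e = -1) :
    S.L (S.c a) (S.f a m₁) - e * S.L (S.c b) (S.f a m₁) ≤ S.L (S.c a) x - e * S.L (S.c b) x ∧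
    S.L (S.c a) x - e * S.L (S.c b) x ≤
      S.L (S.c a) (S.f a m₂) - e * S.L (S.c b) (S.f a m₂) := by
  have h1 := abs_le.1 (h b).1
  have h2 := abs_le.1 (h b).2
  rcases he with rfl | rfl <;> constructor <;> linarith [h1.1, h1.2, h2.1, h2.2]

/-- The level functions of two paths satisfy this linear relation at `x`. -/
def Rel (E D : ι → ι → ℤ) (a b : ι) (x : V) : Prop :=
  S.L (S.c a) x = E a b * S.L (S.c b) x + D a b

/-- Any two paths can be cut so that boxes of uncut intervals meet in a single line only. -/
theorem exists_cut_lines [LinearOrder ι] : ∃ (A : ι → ι → Finset ℕ) (E D : ι → ι → ℤ),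
    (∀ a b, (A a b).card ≤ 2) ∧ (∀ a b, E a b = 1 ∨ E a b = -1) ∧
    (∀ a b, a ≠ b → ∀ x, S.Rel E D a b x → S.Rel E D b a x) ∧
    ∀ a b, a ≠ b → ∀ m₁ m₂ m₁' m₂', m₁ ≤ m₂ → m₂ ≤ S.len a → m₁' ≤ m₂' → m₂' ≤ S.len b →
      Uncut (A a b) m₁ m₂ → Uncut (A b a) m₁' m₂' →
      ∀ x, S.InBox a m₁ m₂ x → S.InBox b m₁' m₂' x → S.Rel E D a b x := by
  have hpair : ∀ a b, ∃ A B : Finset ℕ, A.card ≤ 2 ∧ B.card ≤ 2 ∧ ∃ e d : ℤ,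
      (e = 1 ∨ e = -1) ∧ ∀ m₁ m₂ m₁' m₂', m₁ ≤ m₂ → m₂ ≤ S.len a → m₁' ≤ m₂' →
      m₂' ≤ S.len b → Uncut A m₁ m₂ → Uncut B m₁' m₂' →
      ∀ x, S.InBox a m₁ m₂ x → S.InBox b m₁' m₂' x →
      S.L (S.c a) x = e * S.L (S.c b) x + d := by
    intro a b
    -- Since each path is the faster one in its own level, the sum increases along both, and the
    -- difference increases along `a` but decreases along `b`.
    obtain ⟨A, B, hA, hB, z, d, h⟩ := exists_cut_pair
      (fun x => S.L (S.c a) x + S.L (S.c b) x) (fun x => S.L (S.c a) x - S.L (S.c b) x)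
      (S.f a) (S.f b) (S.len a) (S.len b)
      (fun m m' h h' => by have := S.monotone_sub h h' (S.c b) (.inr rfl); linarith)
      (fun m m' h h' => by have := S.monotone_sub h h' (S.c b) (.inl rfl); linarith)
      (fun m m' h h' => by have := S.monotone_sub h h' (S.c a) (.inr rfl); linarith)
      (fun m m' h h' => by have := S.monotone_sub h h' (S.c a) (.inl rfl); linarith)
    -- A constant sum gives the sign `-1`, a constant difference the sign `1`.
    refine ⟨A, B, hA, hB, if z then -1 else 1, d, by cases z <;> simp, ?_⟩
    intro m₁ m₂ m₁' m₂' h12 h2 h12' h2' hA hB x hx hx'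
    obtain ⟨b1, b2⟩ := hx.sub_mem S b (.inr rfl)
    obtain ⟨b3, b4⟩ := hx.sub_mem S b (.inl rfl)
    obtain ⟨b5, b6⟩ := hx'.sub_mem S a (.inr rfl)
    obtain ⟨b7, b8⟩ := hx'.sub_mem S a (.inl rfl)
    have := h m₁ m₂ m₁' m₂' h12 h2 h12' h2' hA hB x (by linarith) (by linarith) (by linarith)
      (by linarith) (by linarith) (by linarith) (by linarith) (by linarith)
    cases z <;> simp at this ⊢ <;> linarith
  choose A B hA hB e d he h using hpair
  -- The relation is chosen once for every unordered pair and solved for the other level when the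
  -- order is reversed; this makes `Rel` symmetric.
  refine ⟨fun a b => if a < b then A a b else B b a, fun a b => if a < b then e a b else e b a,
    fun a b => if a < b then d a b else - (e b a * d b a), fun a b => ?_, fun a b => ?_, ?_, ?_⟩
  · dsimp only
    split_ifs
    · exact hA a b
    · exact hB b a
  · dsimp only
    split_ifs
    · exact he a b
    · exact he b a
  · intro a b hab x
    rcases lt_or_gt_of_ne hab with hlt | hlt
    · simp only [Rel, hlt, hlt.not_gt, if_true, if_false]
      rcases he a b with h | h <;> rw [h] <;> intro h' <;> linarith
    · simp only [Rel, hlt, hlt.not_gt, if_true, if_false]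
      rcases he b a with h | h <;> rw [h] <;> intro h' <;> linarith
  · intro a b hab m₁ m₂ m₁' m₂' h12 h2 h12' h2' uA uB x hx hx'
    rcases lt_or_gt_of_ne hab with hlt | hlt
    · simp only [Rel, hlt, hlt.not_gt, if_true, if_false] at uA uB ⊢
      exact h a b m₁ m₂ m₁' m₂' h12 h2 h12' h2' uA uB x hx hx'
    · simp only [Rel, hlt, hlt.not_gt, if_true, if_false] at uA uB ⊢
      have := h b a m₁' m₂' m₁ m₂ h12' h2' h12 h2 uB uA x hx' hx
      rcases he b a with h | h <;> rw [h] at this ⊢ <;> linarith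

/-- Two colours are adjacent at `x` if one of the chosen relations between them holds at `x`. -/
def colourGraph (E D : ι → ι → ℤ) (hs : ∀ a b, a ≠ b → ∀ x, S.Rel E D a b x → S.Rel E D b a x)
    (x : V) : SimpleGraph κ where
  Adj i j := i ≠ j ∧ ∃ a b, a ≠ b ∧ S.c a = i ∧ S.c b = j ∧ S.Rel E D a b x
  symm := ⟨fun _ _ ⟨h, a, b, hab, ha, hb, hr⟩ => ⟨h.symm, b, a, hab.symm, hb, ha, hs a b hab x hr⟩⟩
  loopless := ⟨fun _ h => h.1 rfl⟩

variable [Fintype ι] [DecidableEq κ]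

/-- The relations composed of at most `t` of the chosen relations: the triple `(j, e, d)` states that
the level of the initial colour is `e` times the level of the colour `j` plus `d`. -/
def composites (E D : ι → ι → ℤ) (i : κ) : ℕ → Finset (κ × ℤ × ℤ)
  | 0 => {(i, 1, 0)}
  | t + 1 => composites E D i t ∪ (composites E D i t ×ˢ Finset.univ.offDiag).image
      fun r => (S.c r.2.2, r.1.2.1 * E r.2.1 r.2.2, r.1.2.1 * D r.2.1 r.2.2 + r.1.2.2)

/-- One more step keeps a composite or extends it by an ordered pair of distinct paths, a factor of
at most `1 + l * (l - 1) ≤ l ^ 2`. -/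
theorem card_composites_le [Nonempty ι] (E D : ι → ι → ℤ) (i : κ) (t : ℕ) :
    (S.composites E D i t).card ≤ (Fintype.card ι ^ 2) ^ t := by
  induction t with
  | zero => simp [composites]
  | succ t ih =>
    have h1 : 1 ≤ Fintype.card ι := Fintype.card_pos
    have h2 : Fintype.card ι ≤ Fintype.card ι * Fintype.card ι := Nat.le_mul_self _
    calc _ ≤ (S.composites E D i t).card + (S.composites E D i t).card *
          (Fintype.card ι * Fintype.card ι - Fintype.card ι) := by
          refine (Finset.card_union_le _ _).trans (Nat.add_le_add_left ?_ _)
          refine Finset.card_image_le.trans ?_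
          rw [Finset.card_product, Finset.offDiag_card, Finset.card_univ]
      _ = (S.composites E D i t).card *
          (1 + (Fintype.card ι * Fintype.card ι - Fintype.card ι)) := by ring
      _ ≤ (S.composites E D i t).card * (Fintype.card ι ^ 2) := by
          rw [sq]; gcongr; omega
      _ ≤ _ := by rw [pow_succ]; exact Nat.mul_le_mul_right _ ih

theorem composites_mono (E D : ι → ι → ℤ) (i : κ) {t t' : ℕ} (h : t ≤ t') :
    S.composites E D i t ⊆ S.composites E D i t' := by
  induction t', h using Nat.le_induction with
  | base => exact subset_rfl
  | succ r _ ih => exact ih.trans (by simp only [composites]; exact Finset.subset_union_left)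

theorem composites_spec {E D : ι → ι → ℤ} (hE : ∀ a b, E a b = 1 ∨ E a b = -1) (a : ι) {t : ℕ} :
    ∀ r ∈ S.composites E D (S.c a) t, (∃ b, S.c b = r.1) ∧ (r.2.1 = 1 ∨ r.2.1 = -1) := by
  induction t with
  | zero =>
    intro r hr
    obtain rfl := Finset.mem_singleton.1 hr
    exact ⟨⟨a, rfl⟩, .inl rfl⟩
  | succ t ih =>
    intro r hr
    rcases Finset.mem_union.1 hr with hr | hr
    · exact ih r hr
    · obtain ⟨⟨r', a', b'⟩, hr', rfl⟩ := Finset.mem_image.1 hr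
      obtain ⟨-, h⟩ := ih r' (Finset.mem_product.1 hr').1
      refine ⟨⟨b', rfl⟩, ?_⟩
      rcases h with h | h <;> rcases hE a' b' with h' | h' <;> simp [h, h']

/-- If the composite relations from the colour `i` that hold at `x` also hold at `y`, then every
colour that is connected to `i` at `x` is connected to `i` at `y`, by a relation that holds at `x`
and at `y`. -/
theorem reachable_of_composites [Fintype κ] {E D : ι → ι → ℤ}
    (hE : ∀ a b, E a b = 1 ∨ E a b = -1)
    (hs : ∀ a b, a ≠ b → ∀ x, S.Rel E D a b x → S.Rel E D b a x) {a : ι} {x y : V}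
    (h : ∀ r ∈ S.composites E D (S.c a) (Fintype.card κ),
      S.L (S.c a) x = r.2.1 * S.L r.1 x + r.2.2 → S.L (S.c a) y = r.2.1 * S.L r.1 y + r.2.2)
    {j : κ} (hj : (S.colourGraph E D hs x).Reachable (S.c a) j) :
    (S.colourGraph E D hs y).Reachable (S.c a) j ∧
    ∃ r ∈ S.composites E D (S.c a) (Fintype.card κ), r.1 = j ∧
      S.L (S.c a) x = r.2.1 * S.L r.1 x + r.2.2 := by
  obtain ⟨p, hp⟩ := hj.exists_isPath
  have hlen := hp.length_lt
  have key : ∀ t ≤ p.length, (S.colourGraph E D hs y).Reachable (S.c a) (p.getVert t) ∧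
      ∃ r ∈ S.composites E D (S.c a) t, r.1 = p.getVert t ∧
        S.L (S.c a) x = r.2.1 * S.L r.1 x + r.2.2 := by
    intro t
    induction t with
    | zero =>
      intro _
      rw [p.getVert_zero]
      exact ⟨.refl _, _, Finset.mem_singleton_self _, rfl, by simp⟩
    | succ t ih =>
      intro ht
      obtain ⟨hr, r, hrm, hrj, hrx⟩ := ih (by omega)
      have hry := h r (S.composites_mono E D _ (by omega) hrm) hrx
      obtain ⟨hne, a', b', hab, ha, hb, hrel⟩ := p.adj_getVert_succ (i := t) (by omega)
      have hmem : (S.c b', r.2.1 * E a' b', r.2.1 * D a' b' + r.2.2) ∈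
          S.composites E D (S.c a) (t + 1) :=
        Finset.mem_union_right _ (Finset.mem_image.2 ⟨(r, a', b'),
          Finset.mem_product.2 ⟨hrm, by simpa using hab⟩, rfl⟩)
      have hx' : S.L (S.c a) x = r.2.1 * E a' b' * S.L (S.c b') x + (r.2.1 * D a' b' + r.2.2) := by
        rw [hrx, hrj, ← ha, hrel]
        ring
      have hy' := h _ (S.composites_mono E D _ (by omega) hmem) hx'
      refine ⟨hr.trans (SimpleGraph.Adj.reachable ⟨hne, a', b', hab, ha, hb, ?_⟩), _, hmem, hb,
        hx'⟩
      -- The composites of `t` and of `t + 1` relations both hold at `y`. Comparing them and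
      -- cancelling the sign leaves the last single relation at `y`, so the edge persists there.
      rw [hry, hrj, ← ha] at hy'
      simp only [Rel] at *
      have hr1 := (S.composites_spec hE a r hrm).2
      rcases hr1 with h1 | h1 <;> rw [h1] at hy' <;> linarith
  obtain ⟨h1, r, h2, h3, h4⟩ := key p.length le_rfl
  rw [p.getVert_length] at h1 h3
  exact ⟨h1, r, S.composites_mono E D _ (by omega) h2, h3, h4⟩

/-- Every path of the system can be cut into few pieces and every piece can be given one of the
paths as its clock so that the level of the clock changes along the piece by its length and pieces
with intersecting boxes have the same clock. -/
theorem exists_cuts [LinearOrder ι] [Fintype κ] [Nonempty ι] (hκ : 1 ≤ Fintype.card κ) :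
    ∃ (T : ι → Finset ℕ) (ρ : ι → ℕ → ι),
    (∀ a, (T a).card ≤ 4 * Fintype.card ι ^ (2 * Fintype.card κ)) ∧
    ∀ a m₁ m₂, m₁ ≤ m₂ → m₂ ≤ S.len a → Uncut (T a) m₁ m₂ →
      |S.L (S.c (ρ a m₁)) (S.f a m₂) - S.L (S.c (ρ a m₁)) (S.f a m₁)| = (m₂ - m₁ : ℕ) ∧
      ∀ b m₁' m₂', b ≠ a → m₁' ≤ m₂' → m₂' ≤ S.len b → Uncut (T b) m₁' m₂' →
        ∀ x, S.InBox a m₁ m₂ x → S.InBox b m₁' m₂' x → ρ a m₁ = ρ b m₁' := by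
  classical
  obtain ⟨A, E, D, hA, hE, hs, hbox⟩ := S.exists_cut_lines
  -- The clock is to depend on the component alone, as a set of colours, so that equal components
  -- give equal clocks.
  have hsel : ∀ s : Set κ, ∃ b : ι, (∃ b, S.c b ∈ s) → S.c b ∈ s := by
    intro s
    by_cases h : ∃ b, S.c b ∈ s
    · exact h.imp fun b hb _ => hb
    · exact ⟨Classical.arbitrary ι, fun h' => (h h').elim⟩
  choose sel hsel using hsel
  let comp : ι → V → Set κ := fun a x => {j | (S.colourGraph E D hs x).Reachable (S.c a) j}
  let G : ι → κ × ℤ × ℤ → V → ℤ := fun a r x => S.L (S.c a) x - r.2.1 * S.L r.1 x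
  let C : ι → Finset (κ × ℤ × ℤ) := fun a => S.composites E D (S.c a) (Fintype.card κ)
  let T₁ : ι → Finset ℕ := fun a => Finset.univ.biUnion (A a)
  -- For each composite the monotone function `G a r` is cut where it reaches the constant of the
  -- relation and, in `T₃`, where it exceeds it.
  let T₂ : ι → Finset ℕ := fun a => (C a).image fun r => first fun m => r.2.2 ≤ G a r (S.f a m)
  let T₃ : ι → Finset ℕ := fun a => (C a).image fun r => first fun m => r.2.2 < G a r (S.f a m)
  refine ⟨fun a => T₁ a ∪ T₂ a ∪ T₃ a, fun a m => sel (comp a (S.f a m)), fun a => ?_, ?_⟩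
  · have h0 : 1 ≤ Fintype.card ι := Fintype.card_pos
    have h1 : (T₁ a).card ≤ Fintype.card ι * 2 :=
      Finset.card_biUnion_le_card_mul _ _ _ fun b _ => hA a b
    have h2 : (C a).card ≤ Fintype.card ι ^ (2 * Fintype.card κ) := by
      rw [pow_mul]
      exact S.card_composites_le E D _ _
    have h3 : (T₂ a).card ≤ (C a).card := Finset.card_image_le
    have h4 : (T₃ a).card ≤ (C a).card := Finset.card_image_le
    -- With at least one colour, the `2 * l` cuts of `T₁` are at most `2 * l ^ (2 * k)`, as many as
    -- are allowed for `T₂` and `T₃` together.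
    have h5 : Fintype.card ι ≤ Fintype.card ι ^ (2 * Fintype.card κ) :=
      Nat.le_self_pow (by omega) _
    have h6 := Finset.card_union_le (T₁ a ∪ T₂ a) (T₃ a)
    have h7 := Finset.card_union_le (T₁ a) (T₂ a)
    dsimp only
    omega
  -- the truth of composite relations does not change on a box
  have hconst : ∀ a m₁ m₂, m₁ ≤ m₂ → m₂ ≤ S.len a → Uncut (T₁ a ∪ T₂ a ∪ T₃ a) m₁ m₂ →
      ∀ x, S.InBox a m₁ m₂ x → ∀ r ∈ C a, (S.L (S.c a) (S.f a m₁) =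
        r.2.1 * S.L r.1 (S.f a m₁) + r.2.2 ↔ S.L (S.c a) x = r.2.1 * S.L r.1 x + r.2.2) := by
    intro a m₁ m₂ h12 h2 hu x hx r hr
    obtain ⟨⟨b, hb⟩, he⟩ := S.composites_spec hE a r hr
    obtain ⟨b1, b2⟩ := hx.sub_mem S b he
    rw [hb] at b1 b2
    have u1 := of_uncut (P := fun m => r.2.2 ≤ G a r (S.f a m)) (n := S.len a)
      (fun m m' h h' hm => le_trans hm (S.monotone_sub h h' r.1 he))
      (T := T₁ a ∪ T₂ a ∪ T₃ a)
      (Finset.mem_union_left _ (Finset.mem_union_right _ (Finset.mem_image_of_mem _ hr)))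
      hu h12 h2
    have u2 := of_uncut (P := fun m => r.2.2 < G a r (S.f a m)) (n := S.len a)
      (fun m m' h h' hm => lt_of_lt_of_le hm (S.monotone_sub h h' r.1 he))
      (T := T₁ a ∪ T₂ a ∪ T₃ a)
      (Finset.mem_union_right _ (Finset.mem_image_of_mem _ hr)) hu h12 h2
    simp only [G] at u1 u2
    constructor
    · intro h
      have : ¬ r.2.2 < S.L (S.c a) (S.f a m₂) - r.2.1 * S.L r.1 (S.f a m₂) := fun h' => by
        have := u2 h'
        linarith
      linarith
    · intro h
      have := u1 (by linarith)
      linarith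
  -- The same composites hold at the start of the piece and at every `x` in its box, so reachability
  -- transfers in both directions.
  have hcomp : ∀ a m₁ m₂, m₁ ≤ m₂ → m₂ ≤ S.len a → Uncut (T₁ a ∪ T₂ a ∪ T₃ a) m₁ m₂ →
      ∀ x, S.InBox a m₁ m₂ x → comp a (S.f a m₁) = comp a x := by
    intro a m₁ m₂ h12 h2 hu x hx
    have := hconst a m₁ m₂ h12 h2 hu x hx
    refine Set.Subset.antisymm (fun j hj => ?_) (fun j hj => ?_)
    · exact (S.reachable_of_composites hE hs (fun r hr => (this r hr).1) hj).1
    · exact (S.reachable_of_composites hE hs (fun r hr => (this r hr).2) hj).1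
  intro a m₁ m₂ h12 h2 hu
  constructor
  · have hmem : S.c (sel (comp a (S.f a m₁))) ∈ comp a (S.f a m₁) :=
      hsel _ ⟨a, SimpleGraph.Reachable.refl _⟩
    obtain ⟨-, r, hr, hrj, hrx⟩ := S.reachable_of_composites hE hs (fun r hr => id) hmem
    have hr2 := (hconst a m₁ m₂ h12 h2 hu _ (S.inBox_of_mem h12 le_rfl h2) r hr).1 hrx
    rw [← hrj]
    have hl := S.level_eq h12 h2
    rcases (S.composites_spec hE a r hr).2 with h | h
    · rw [h] at hrx hr2
      rw [show S.L r.1 (S.f a m₂) - S.L r.1 (S.f a m₁) = ((m₂ - m₁ : ℕ) : ℤ) by linarith]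
      exact abs_of_nonneg (by positivity)
    · rw [h] at hrx hr2
      rw [show S.L r.1 (S.f a m₂) - S.L r.1 (S.f a m₁) = -((m₂ - m₁ : ℕ) : ℤ) by linarith,
        abs_neg]
      exact abs_of_nonneg (by positivity)
  · intro b m₁' m₂' hba h12' h2' hu' x hx hx'
    have hrel := hbox a b hba.symm m₁ m₂ m₁' m₂' h12 h2 h12' h2'
      (hu.subset fun τ hτ => Finset.mem_union_left _ (Finset.mem_union_left _
        (Finset.mem_biUnion.2 ⟨b, Finset.mem_univ _, hτ⟩)))
      (hu'.subset fun τ hτ => Finset.mem_union_left _ (Finset.mem_union_left _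
        (Finset.mem_biUnion.2 ⟨a, Finset.mem_univ _, hτ⟩))) x hx hx'
    dsimp only
    rw [hcomp a m₁ m₂ h12 h2 hu x hx, hcomp b m₁' m₂' h12' h2' hu' x hx']
    congr 1
    have hreach : (S.colourGraph E D hs x).Reachable (S.c a) (S.c b) := by
      by_cases hc : S.c a = S.c b
      · rw [hc]
      · exact SimpleGraph.Adj.reachable ⟨hc, a, b, hba.symm, rfl, rfl, hrel⟩
    ext j
    exact ⟨fun h => hreach.symm.trans h, fun h => hreach.trans h⟩

end PathSystem

end Cutting

/-! ### Ascending walks -/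

namespace KShortestGraph

variable {V : Type} {k : ℕ} (G : KShortestGraph V k)

/-- All edges of the walk lead one level up in the `i`-th partition. -/
def IsAscending (i : Fin k) {u v : V} (p : G.graph.Walk u v) : Prop :=
  ∀ d ∈ p.darts, (G.level i d.snd : ℤ) = G.level i d.fst + 1

variable {G}

theorem abs_level_sub_le_one {x y : V} (h : G.graph.Adj x y) (i : Fin k) :
    |((G.level i y : ℕ) : ℤ) - (G.level i x : ℕ)| ≤ 1 := by
  by_contra hc
  rw [abs_sub_comm] at hc
  exact G.not_adj_of_far i x y (not_le.1 hc) h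

theorem abs_level_sub_le_length {u v : V} (p : G.graph.Walk u v) (i : Fin k) :
    |((G.level i v : ℕ) : ℤ) - (G.level i u : ℕ)| ≤ p.length := by
  induction p with
  | nil => simp
  | cons h p ih =>
    have := abs_le.1 (abs_level_sub_le_one h i)
    have := abs_le.1 ih
    rw [SimpleGraph.Walk.length_cons, abs_le]
    push_cast
    constructor <;> linarith

/-- No edge raises a level by more than one, so a walk whose length equals its net gain cannot waste
a single step. -/
theorem isAscending_of_length {i : Fin k} {u v : V} (p : G.graph.Walk u v)
    (hp : (p.length : ℤ) = (G.level i v : ℕ) - (G.level i u : ℕ)) : G.IsAscending i p := by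
  induction p with
  | nil => simp [IsAscending]
  | cons h p ih =>
    have h1 := abs_le.1 (abs_level_sub_le_one h i)
    have h2 := abs_le.1 (abs_level_sub_le_length p i)
    rw [SimpleGraph.Walk.length_cons] at hp
    push_cast at hp
    intro d hd
    rw [SimpleGraph.Walk.darts_cons, List.mem_cons] at hd
    rcases hd with rfl | hd
    · simp only
      linarith
    · exact ih (by linarith) d hd

theorem IsAscending.length_eq {i : Fin k} {u v : V} {p : G.graph.Walk u v}
    (hp : G.IsAscending i p) : (p.length : ℤ) = (G.level i v : ℕ) - (G.level i u : ℕ) := by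
  induction p with
  | nil => simp
  | cons h p ih =>
    have h1 := ih fun d hd => hp d (by simp [hd])
    have h2 := hp ⟨(_, _), h⟩ (by simp)
    simp only at h2
    rw [SimpleGraph.Walk.length_cons]
    push_cast
    linarith

/-- The vertices of an ascending walk lie, judging by their levels, between its ends. -/
theorem IsAscending.inBox {i : Fin k} {u v x : V} {p : G.graph.Walk u v}
    (hp : G.IsAscending i p) (hx : x ∈ p.support) (h : Fin k) :
    |((G.level h x : ℕ) : ℤ) - (G.level h u : ℕ)| ≤ (G.level i x : ℕ) - (G.level i u : ℕ) ∧
    |((G.level h v : ℕ) : ℤ) - (G.level h x : ℕ)| ≤ (G.level i v : ℕ) - (G.level i x : ℕ) := by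
  classical
  have h1 : G.IsAscending i (p.takeUntil x hx) :=
    fun d hd => hp d (p.darts_takeUntil_subset_darts hx hd)
  have h2 : G.IsAscending i (p.dropUntil x hx) :=
    fun d hd => hp d (p.darts_dropUntil_subset_darts hx hd)
  exact ⟨h1.length_eq ▸ abs_level_sub_le_length _ h, h2.length_eq ▸ abs_level_sub_le_length _ h⟩

theorem IsAscending.isPath {i : Fin k} {u v : V} {p : G.graph.Walk u v}
    (hp : G.IsAscending i p) : p.IsPath := by
  induction p with
  | nil => simp
  | cons h p ih =>
    have h1 : G.IsAscending i p := fun d hd => hp d (by simp [hd])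
    have h2 := hp ⟨(_, _), h⟩ (by simp)
    rw [SimpleGraph.Walk.cons_isPath_iff]
    refine ⟨ih h1, fun hu => ?_⟩
    have h3 := (abs_nonneg _).trans (h1.inBox hu i).1
    simp only at h2
    linarith

/-- A strictly rising level forbids repeated vertices, so the path condition comes for free and
walks may be glued without checking it. -/
theorem isColourPath_iff {i : Fin k} {u v : V} {p : G.graph.Walk u v} :
    G.IsColourPath i p ↔ G.IsAscending i p := by
  constructor
  · intro h d hd
    obtain ⟨⟨-, h1⟩, h2⟩ := h.2 d hd
    have h2 : (G.level i d.fst : ℕ) ≤ G.level i d.snd := h2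
    omega
  · intro h
    refine ⟨h.isPath, fun d hd => ?_⟩
    have h1 := h d hd
    exact ⟨⟨d.adj, .inl (by exact_mod_cast h1)⟩, show (G.level i d.fst : ℕ) ≤ G.level i d.snd by
      omega⟩

theorem IsAscending.append {i : Fin k} {u v w : V} {p : G.graph.Walk u v} {q : G.graph.Walk v w}
    (hp : G.IsAscending i p) (hq : G.IsAscending i q) : G.IsAscending i (p.append q) := by
  intro d hd
  rw [SimpleGraph.Walk.darts_append, List.mem_append] at hd
  exact hd.elim (hp d) (hq d)

/-- A sequence of vertices that are adjacent from one time to the next is a walk. -/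
theorem exists_walk (x : ℕ → V) (t₀ d : ℕ)
    (h : ∀ τ, t₀ ≤ τ → τ < t₀ + d → G.graph.Adj (x τ) (x (τ + 1))) :
    ∃ p : G.graph.Walk (x t₀) (x (t₀ + d)), p.length = d ∧
      ∀ v ∈ p.support, ∃ τ, t₀ ≤ τ ∧ τ ≤ t₀ + d ∧ v = x τ := by
  induction d with
  | zero => exact ⟨.nil, rfl, fun v hv => ⟨t₀, le_rfl, le_rfl, by simpa using hv⟩⟩
  | succ d ih =>
    obtain ⟨p, hp, hs⟩ := ih fun τ h1 h2 => h τ h1 (by omega)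
    refine ⟨p.concat (h (t₀ + d) (by omega) (by omega)), by simp [hp], fun v hv => ?_⟩
    rw [SimpleGraph.Walk.support_concat, List.mem_append,
      List.mem_singleton] at hv
    rcases hv with hv | rfl
    · obtain ⟨τ, h1, h2, h3⟩ := hs v hv
      exact ⟨τ, h1, by omega, h3⟩
    · exact ⟨t₀ + d + 1, by omega, le_rfl, rfl⟩

/-! ### Certificates for solutions -/

variable {n l : ℕ} (G : KShortestGraph (Fin n) k) (s t : Fin l → Fin n) (c : Fin l → Fin k) (J : ℕ)

/-- The pebble on a piece from `u` to `w` with the clock `r` is on its way at time `τ`. -/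
def IsActive (u w : Fin n) (r : Fin l) (τ : ℕ) : Prop :=
  ((G.level (c r) u : ℕ) ≤ τ ∧ τ ≤ G.level (c r) w) ∨
  ((G.level (c r) w : ℕ) ≤ τ ∧ τ ≤ G.level (c r) u)

/-- The vertex `x` may, judging by its levels, lie on a path of the colour of the request `a` from
`u` to `w`. -/
def InBox (a : Fin l) (u w x : Fin n) : Prop := ∀ h,
  (G.level (c h) x : ℕ) + G.level (c a) u ≤ G.level (c h) u + G.level (c a) x ∧
  (G.level (c h) u : ℕ) + G.level (c a) u ≤ G.level (c h) x + G.level (c a) x ∧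
  (G.level (c h) w : ℕ) + G.level (c a) x ≤ G.level (c h) x + G.level (c a) w ∧
  (G.level (c h) x : ℕ) + G.level (c a) x ≤ G.level (c h) w + G.level (c a) w

/-- Every path is cut into `J` pieces; the `m`-th piece of the path `a` leads from `U a m` to
`W a m`, its clock is the colour of the request `R a m`, and at time `τ` its pebble is at
`X τ a m`. -/
structure IsCertificate (U W : Fin l → ℕ → Fin n) (R : Fin l → ℕ → Fin l)
    (X : ℕ → Fin l → ℕ → Fin n) : Prop where
  ends : ∀ a, (U a 0 = s a ∧ W a (J - 1) = t a) ∨ (U a 0 = t a ∧ W a (J - 1) = s a)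
  uniform : ∀ a, ∀ m < J, (G.level (c a) (U a m) : ℕ) ≤ G.level (c a) (W a m) ∧
    ((G.level (c (R a m)) (W a m) : ℕ) + G.level (c a) (U a m) =
      G.level (c (R a m)) (U a m) + G.level (c a) (W a m) ∨
    (G.level (c (R a m)) (W a m) : ℕ) + G.level (c a) (W a m) =
      G.level (c (R a m)) (U a m) + G.level (c a) (U a m))
  linked : ∀ a m, m + 1 < J → W a m = U a (m + 1) ∨ (G.graph.Adj (W a m) (U a (m + 1)) ∧
    (G.level (c a) (U a (m + 1)) : ℕ) = G.level (c a) (W a m) + 1)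
  onTime : ∀ τ < n, ∀ a, ∀ m < J, G.IsActive c (U a m) (W a m) (R a m) τ →
    (G.level (c (R a m)) (X τ a m) : ℕ) = τ ∧
    (τ = G.level (c (R a m)) (U a m) → X τ a m = U a m) ∧
    (τ = G.level (c (R a m)) (W a m) → X τ a m = W a m)
  move : ∀ τ, τ + 1 < n → ∀ a, ∀ m < J, G.IsActive c (U a m) (W a m) (R a m) τ →
    G.IsActive c (U a m) (W a m) (R a m) (τ + 1) → G.graph.Adj (X τ a m) (X (τ + 1) a m)
  apart : ∀ τ < n, ∀ a a', a' ≠ a → ∀ m < J, ∀ m' < J, R a m = R a' m' →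
    G.IsActive c (U a m) (W a m) (R a m) τ → G.IsActive c (U a' m') (W a' m') (R a' m') τ →
    X τ a m = X τ a' m' → X τ a m = s a ∨ X τ a m = t a
  box : ∀ a a', a' ≠ a → ∀ m < J, ∀ m' < J, R a m ≠ R a' m' → ∀ x,
    ¬ (G.InBox c a (U a m) (W a m) x ∧ G.InBox c a' (U a' m') (W a' m') x)

variable {G s t c J} {U W : Fin l → ℕ → Fin n} {R : Fin l → ℕ → Fin l}
  {X : ℕ → Fin l → ℕ → Fin n}

theorem level_lt (i : Fin k) (x : Fin n) : (G.level i x : ℕ) < n := by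
  have := Fintype.card_le_of_surjective _ (G.level_surjective i)
  simp only [Fintype.card_fin] at this
  exact (G.level i x).2.trans_le this

namespace IsCertificate

/-- The pebble's moves form a walk as long as the change of the clock, which by `uniform` is the
gain in the path's own level; hence the walk ascends. If the clock runs backwards, time leads from
`W a m` to `U a m` and the walk is reversed. -/
theorem exists_piece (hC : G.IsCertificate s t c J U W R X) (a : Fin l) {m : ℕ} (hm : m < J) :
    ∃ p : G.graph.Walk (U a m) (W a m), G.IsAscending (c a) p ∧ ∀ v ∈ p.support,
      ∃ τ < n, G.IsActive c (U a m) (W a m) (R a m) τ ∧ v = X τ a m := by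
  obtain ⟨h1, h2⟩ := hC.uniform a m hm
  have hu := level_lt (G := G) (c (R a m)) (U a m)
  have hw := level_lt (G := G) (c (R a m)) (W a m)
  have hUX := fun h => (hC.onTime _ hu a m hm h).2.1 rfl
  have hWX := fun h => (hC.onTime _ hw a m hm h).2.2 rfl
  rcases le_total (G.level (c (R a m)) (U a m) : ℕ) (G.level (c (R a m)) (W a m)) with h | h
  · obtain ⟨d, hd⟩ := Nat.exists_eq_add_of_le h
    obtain ⟨p, hp, hs⟩ := exists_walk (G := G) (fun τ => X τ a m)
      (G.level (c (R a m)) (U a m)) d fun τ h1 h2 => hC.move τ (by omega) a m hm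
        (.inl ⟨by omega, by omega⟩) (.inl ⟨by omega, by omega⟩)
    have e1 := hUX (.inl ⟨le_rfl, h⟩)
    have e2 : X (G.level (c (R a m)) (U a m) + d) a m = W a m := by
      rw [← hd]; exact hWX (.inl ⟨h, le_rfl⟩)
    refine ⟨p.copy e1 e2, isAscending_of_length _ ?_, fun v hv => ?_⟩
    · rw [SimpleGraph.Walk.length_copy, hp]
      omega
    · rw [SimpleGraph.Walk.support_copy] at hv
      obtain ⟨τ, h1, h2, h3⟩ := hs v hv
      exact ⟨τ, by omega, .inl ⟨h1, by omega⟩, h3⟩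
  · obtain ⟨d, hd⟩ := Nat.exists_eq_add_of_le h
    obtain ⟨p, hp, hs⟩ := exists_walk (G := G) (fun τ => X τ a m)
      (G.level (c (R a m)) (W a m)) d fun τ h1 h2 => hC.move τ (by omega) a m hm
        (.inr ⟨by omega, by omega⟩) (.inr ⟨by omega, by omega⟩)
    have e1 := hWX (.inr ⟨le_rfl, h⟩)
    have e2 : X (G.level (c (R a m)) (W a m) + d) a m = U a m := by
      rw [← hd]; exact hUX (.inr ⟨h, le_rfl⟩)
    refine ⟨(p.copy e1 e2).reverse, isAscending_of_length _ ?_, fun v hv => ?_⟩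
    · rw [SimpleGraph.Walk.length_reverse, SimpleGraph.Walk.length_copy, hp]
      omega
    · rw [SimpleGraph.Walk.support_reverse, List.mem_reverse, SimpleGraph.Walk.support_copy] at hv
      obtain ⟨τ, h1, h2, h3⟩ := hs v hv
      exact ⟨τ, by omega, .inr ⟨h1, by omega⟩, h3⟩

/-- The first pieces of a path join up to an ascending walk. -/
theorem exists_path (hC : G.IsCertificate s t c J U W R X) (a : Fin l) {m : ℕ} (hm : m < J) :
    ∃ p : G.graph.Walk (U a 0) (W a m), G.IsAscending (c a) p ∧ ∀ v ∈ p.support,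
      ∃ m' < J, G.InBox c a (U a m') (W a m') v ∧
        ∃ τ < n, G.IsActive c (U a m') (W a m') (R a m') τ ∧ v = X τ a m' := by
  have hpiece : ∀ m < J, ∃ p : G.graph.Walk (U a m) (W a m), G.IsAscending (c a) p ∧
      ∀ v ∈ p.support, ∃ m' < J, G.InBox c a (U a m') (W a m') v ∧
        ∃ τ < n, G.IsActive c (U a m') (W a m') (R a m') τ ∧ v = X τ a m' := by
    intro m hm
    obtain ⟨p, hp, hs⟩ := hC.exists_piece a hm
    refine ⟨p, hp, fun v hv => ⟨m, hm, fun h => ?_, hs v hv⟩⟩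
    obtain ⟨h1, h2⟩ := hp.inBox hv (c h)
    rw [abs_le] at h1 h2
    omega
  induction m with
  | zero => exact hpiece 0 hm
  | succ m ih =>
    obtain ⟨p, hp, hps⟩ := ih (by omega)
    obtain ⟨q, hq, hqs⟩ := hpiece (m + 1) hm
    rcases hC.linked a m hm with h | ⟨h, h'⟩
    · refine ⟨p.append (q.copy h.symm rfl), hp.append ?_, fun v hv => ?_⟩
      · intro d hd
        rw [SimpleGraph.Walk.darts_copy] at hd
        exact hq d hd
      · rw [SimpleGraph.Walk.mem_support_append_iff, SimpleGraph.Walk.support_copy] at hv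
        exact hv.elim (hps v) (hqs v)
    · refine ⟨p.append (.cons h q), hp.append ?_, fun v hv => ?_⟩
      · intro d hd
        rw [SimpleGraph.Walk.darts_cons, List.mem_cons] at hd
        rcases hd with rfl | hd
        · exact_mod_cast h'
        · exact hq d hd
      · rw [SimpleGraph.Walk.mem_support_append_iff, SimpleGraph.Walk.support_cons,
          List.mem_cons] at hv
        rcases hv with hv | rfl | hv
        · exact hps v hv
        · exact hps _ p.end_mem_support
        · exact hqs v hv

/-- Suppose two paths share `x`. If the two pieces have the same clock, both pebbles are at `x` at
the time given by its clock level, which `apart` allows at terminals only. If the clocks differ, `x`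
lies in both boxes, against `box`. -/
theorem hasDSPSolution (hC : G.IsCertificate s t c J U W R X) (hJ : 0 < J) :
    G.HasDSPSolution s t c := by
  have hpath : ∀ a, ∃ p : G.graph.Walk (s a) (t a),
      (G.IsColourPath (c a) p ∨ G.IsColourPath (c a) p.reverse) ∧ ∀ v ∈ p.support,
      ∃ m' < J, G.InBox c a (U a m') (W a m') v ∧
        ∃ τ < n, G.IsActive c (U a m') (W a m') (R a m') τ ∧ v = X τ a m' := by
    intro a
    obtain ⟨p, hp, hs⟩ := hC.exists_path a (m := J - 1) (by omega)
    rcases hC.ends a with ⟨h1, h2⟩ | ⟨h1, h2⟩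
    · rw [← h1, ← h2]
      exact ⟨p, .inl (isColourPath_iff.2 hp), hs⟩
    · rw [← h1, ← h2]
      refine ⟨p.reverse, .inr ?_, fun v hv => hs v (by simpa using hv)⟩
      rw [SimpleGraph.Walk.reverse_reverse]
      exact isColourPath_iff.2 hp
  choose P hP hs using hpath
  refine ⟨P, hP, fun a b hab x hxa hsa hta hxb => ?_⟩
  obtain ⟨m, hm, hbox, τ, hτ, hact, hx⟩ := hs a x hxa
  obtain ⟨m', hm', hbox', τ', hτ', hact', hx'⟩ := hs b x hxb
  by_cases hR : R a m = R b m'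
  · have e1 := (hC.onTime τ hτ a m hm hact).1
    have e2 := (hC.onTime τ' hτ' b m' hm' hact').1
    rw [← hx] at e1
    rw [← hx', ← hR, e1] at e2
    subst e2
    have := hC.apart τ hτ a b hab.symm m hm m' hm' hR hact hact' (hx.symm.trans hx')
    rw [← hx] at this
    exact this.elim hsa hta
  · exact hC.box a b hab.symm m hm m' hm' hR x ⟨hbox, hbox'⟩

end IsCertificate

end KShortestGraph

/-! ### From solutions to certificates -/

namespace Cutting

/-- A path is cut into pieces at few thresholds. -/
theorem exists_pieces (j : ℕ) : ∀ (T : Finset ℕ) (n : ℕ), T.card ≤ j → ∃ st en : ℕ → ℕ,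
    st 0 = 0 ∧ en j = n ∧ (∀ q ≤ j, st q ≤ en q ∧ en q ≤ n ∧ Uncut T (st q) (en q)) ∧
    ∀ q < j, en q = st (q + 1) ∨ en q + 1 = st (q + 1) := by
  induction j with
  | zero =>
    intro T n hT
    obtain rfl : T = ∅ := by simpa using hT
    exact ⟨fun _ => 0, fun _ => n, rfl, rfl, fun q _ => ⟨by simp, le_rfl, by simp [Uncut]⟩,
      fun q hq => by omega⟩
  | succ j ih =>
    intro T n hT
    by_cases hcut : Uncut T 0 n
    -- Surplus pieces are trivial, consisting of the last position only, so that the number of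
    -- pieces is always `j + 1`.
    · refine ⟨fun q => if q = 0 then 0 else n, fun _ => n, rfl, rfl, fun q _ => ?_, fun q _ => ?_⟩
      · by_cases hq : q = 0
        · simp [hq, hcut]
        · simp only [hq, if_false, le_refl, true_and]
          exact fun τ _ h => by omega
      · simp
    · obtain ⟨τ, hτ, hmax⟩ : ∃ τ ∈ T.filter (fun τ => 0 < τ ∧ τ ≤ n),
          ∀ τ' ∈ T.filter (fun τ => 0 < τ ∧ τ ≤ n), τ' ≤ τ := by
        refine Finset.exists_max_image _ id ?_
        simp only [Uncut, not_forall, not_not] at hcut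
        obtain ⟨τ, h1, h2⟩ := hcut
        exact ⟨τ, by simp [h1, h2]⟩
      simp only [Finset.mem_filter, and_imp] at hτ hmax
      -- The last effective threshold `τ` starts the last piece; the pieces before it end at `τ -
      -- 1`, one edge earlier.
      obtain ⟨st, en, h1, h2, h3, h4⟩ := ih (T.erase τ) (τ - 1) (by
        rw [Finset.card_erase_of_mem hτ.1]; omega)
      refine ⟨fun q => if q ≤ j then st q else τ, fun q => if q ≤ j then en q else n, by simp [h1],
        by simp, fun q hq => ?_, fun q hq => ?_⟩
      · by_cases hqj : q ≤ j
        · obtain ⟨h5, h6, h7⟩ := h3 q hqj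
          simp only [hqj, if_true]
          refine ⟨h5, by omega, fun τ' hτ' h => ?_⟩
          exact h7 τ' (Finset.mem_erase.2 ⟨by omega, hτ'⟩) h
        · simp only [hqj, if_false, le_refl, true_and]
          refine ⟨hτ.2.2, fun τ' hτ' h => ?_⟩
          have := hmax τ' hτ' (by omega) h.2
          omega
      · rcases Nat.lt_or_ge q j with hqj | hqj
        · simpa [hqj.le, Nat.succ_le_of_lt hqj] using h4 q hqj
        · obtain rfl : q = j := by omega
          simp only [le_refl, if_true, h2]
          right
          simp
          omega

/-- A level that changes along a piece by its length changes steadily. -/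
theorem PathSystem.steady {V κ ι : Type*} (S : PathSystem V κ ι) {a : ι} {m₁ m₂ : ℕ} {r : κ}
    (h2 : m₂ ≤ S.len a)
    (h : |S.L r (S.f a m₂) - S.L r (S.f a m₁)| = (m₂ - m₁ : ℕ)) :
    (∀ m, m₁ ≤ m → m ≤ m₂ → S.L r (S.f a m) = S.L r (S.f a m₁) + (m - m₁ : ℕ)) ∨
    (∀ m, m₁ ≤ m → m ≤ m₂ → S.L r (S.f a m) = S.L r (S.f a m₁) - (m - m₁ : ℕ)) := by
  rcases abs_eq (by positivity) |>.1 h with h | h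
  · left
    intro m hm hm'
    have e1 := abs_le.1 (S.abs_level_sub_le hm (hm'.trans h2) r)
    have e2 := abs_le.1 (S.abs_level_sub_le hm' h2 r)
    push_cast [Nat.cast_sub hm, Nat.cast_sub hm', Nat.cast_sub (hm.trans hm')] at *
    linarith
  · right
    intro m hm hm'
    have e1 := abs_le.1 (S.abs_level_sub_le hm (hm'.trans h2) r)
    have e2 := abs_le.1 (S.abs_level_sub_le hm' h2 r)
    push_cast [Nat.cast_sub hm, Nat.cast_sub hm', Nat.cast_sub (hm.trans hm')] at *
    linarith

end Cutting

namespace KShortestGraph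

variable {n k l : ℕ} {G : KShortestGraph (Fin n) k} {s t : Fin l → Fin n} {c : Fin l → Fin k}

/-- A solution, described by the vertices at all the positions of the paths. -/
theorem HasDSPSolution.exists_positions (h : G.HasDSPSolution s t c) :
    ∃ (f : Fin l → ℕ → Fin n) (len : Fin l → ℕ),
      (∀ a, (f a 0 = s a ∧ f a (len a) = t a) ∨ (f a 0 = t a ∧ f a (len a) = s a)) ∧
      (∀ a, ∀ m < len a, G.graph.Adj (f a m) (f a (m + 1)) ∧
        (G.level (c a) (f a (m + 1)) : ℕ) = G.level (c a) (f a m) + 1) ∧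
      ∀ a b, a ≠ b → ∀ m ≤ len a, ∀ m' ≤ len b, f a m = f b m' → f a m = s a ∨ f a m = t a := by
  obtain ⟨P, hP, hdisj⟩ := h
  have key : ∀ a, ∃ (f : ℕ → Fin n) (len : ℕ),
      ((f 0 = s a ∧ f len = t a) ∨ (f 0 = t a ∧ f len = s a)) ∧
      (∀ m < len, G.graph.Adj (f m) (f (m + 1)) ∧
        (G.level (c a) (f (m + 1)) : ℕ) = G.level (c a) (f m) + 1) ∧
      ∀ m, f m ∈ (P a).support := by
    have aux : ∀ (i : Fin k) {u v : Fin n} (p : G.graph.Walk u v), G.IsColourPath i p →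
        ∀ m < p.length, G.graph.Adj (p.getVert m) (p.getVert (m + 1)) ∧
          (G.level i (p.getVert (m + 1)) : ℕ) = G.level i (p.getVert m) + 1 := by
      intro i u v p hp m hm
      refine ⟨p.adj_getVert_succ hm, ?_⟩
      have := isColourPath_iff.1 hp (p.darts[m]'(by simpa using hm)) (List.getElem_mem _)
      simp only [SimpleGraph.Walk.darts_getElem_eq_getVert] at this
      exact_mod_cast this
    intro a
    rcases hP a with h | h
    · exact ⟨(P a).getVert, (P a).length, .inl ⟨by simp, by simp⟩, aux _ _ h,
        fun m => (P a).getVert_mem_support m⟩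
    · exact ⟨(P a).reverse.getVert, (P a).reverse.length,
        .inr ⟨by simp, (P a).reverse.getVert_length⟩, aux _ _ h,
        fun m => by simpa using (P a).reverse.getVert_mem_support m⟩
  choose f len h1 h2 h3 using key
  refine ⟨f, len, h1, h2, fun a b hab m _ m' _ hm => ?_⟩
  by_contra hc
  rw [not_or] at hc
  exact hdisj a b hab _ (h3 a m) hc.1 hc.2 (hm ▸ h3 b m')

/-- The pieces come from `exists_cuts`, and along each of them the clock runs steadily, so an active
time determines exactly one position for the pebble. -/
theorem HasDSPSolution.exists_isCertificate (h : G.HasDSPSolution s t c) (hl : 1 ≤ l) {j : ℕ}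
    (hj : 4 * l ^ (2 * k) ≤ j) : ∃ U W R X, G.IsCertificate s t c (j + 1) U W R X := by
  obtain ⟨f, len, hends, hstep, hdisj⟩ := h.exists_positions
  let S : Cutting.PathSystem (Fin n) (Fin k) (Fin l) :=
    { L := fun i x => ((G.level i x : ℕ) : ℤ)
      c := c
      f := f
      len := len
      step := fun a m hm => by exact_mod_cast (hstep a m hm).2
      lipschitz := fun a m h hm => abs_level_sub_le_one (hstep a m hm).1 h }
  have : Nonempty (Fin l) := ⟨⟨0, hl⟩⟩
  obtain ⟨T, ρ, hT, hρ⟩ := S.exists_cuts (by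
    rw [Fintype.card_fin]
    have := (c ⟨0, hl⟩).2
    omega)
  simp only [Fintype.card_fin] at hT
  choose st en hst hen hpc hlink using fun a =>
    Cutting.exists_pieces j (T a) (len a) ((hT a).trans hj)
  -- The clock runs steadily, forwards or backwards.
  have hlev : ∀ a, ∀ q ≤ j, (∀ m, st a q ≤ m → m ≤ en a q →
        (G.level (c (ρ a (st a q))) (f a m) : ℕ) =
          G.level (c (ρ a (st a q))) (f a (st a q)) + (m - st a q)) ∨
      (∀ m, st a q ≤ m → m ≤ en a q → (G.level (c (ρ a (st a q))) (f a m) : ℕ) + (m - st a q) =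
          G.level (c (ρ a (st a q))) (f a (st a q))) := by
    intro a q hq
    obtain ⟨h1, h2, h3⟩ := hpc a q hq
    refine (S.steady h2 (hρ a _ _ h1 h2 h3).1).imp (fun h m hm hm' => ?_) fun h m hm hm' => ?_
    · have : ((G.level (c (ρ a (st a q))) (f a m) : ℕ) : ℤ) =
          (G.level (c (ρ a (st a q))) (f a (st a q)) : ℕ) + (m - st a q : ℕ) := h m hm hm'
      omega
    · have : ((G.level (c (ρ a (st a q))) (f a m) : ℕ) : ℤ) =
          (G.level (c (ρ a (st a q))) (f a (st a q)) : ℕ) - (m - st a q : ℕ) := h m hm hm'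
      omega
  have hown : ∀ a, ∀ q ≤ j, ∀ m, st a q ≤ m → m ≤ en a q →
      (G.level (c a) (f a m) : ℕ) = G.level (c a) (f a (st a q)) + (m - st a q) := by
    intro a q hq m hm hm'
    have : ((G.level (c a) (f a m) : ℕ) : ℤ) =
      (G.level (c a) (f a (st a q)) : ℕ) + (m - st a q : ℕ) :=
        S.level_eq hm (hm'.trans (hpc a q hq).2.1)
    omega
  -- The sum of the two truncated differences is the distance of `τ` from the clock level at the
  -- start; one formula serves both directions of the clock.
  let pos : ℕ → Fin l → ℕ → ℕ := fun τ a q => st a q +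
    ((τ - G.level (c (ρ a (st a q))) (f a (st a q))) +
      (G.level (c (ρ a (st a q))) (f a (st a q)) - τ))
  -- The position of an active pebble.
  have hpos : ∀ τ a, ∀ q ≤ j, G.IsActive c (f a (st a q)) (f a (en a q)) (ρ a (st a q)) τ →
      st a q ≤ pos τ a q ∧ pos τ a q ≤ en a q ∧
      (G.level (c (ρ a (st a q))) (f a (pos τ a q)) : ℕ) = τ := by
    intro τ a q hq hact
    obtain ⟨h1, h2, h3⟩ := hpc a q hq
    have h4 : st a q ≤ pos τ a q := Nat.le_add_right _ _
    refine ⟨h4, ?_⟩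
    rcases hlev a q hq with h | h
    · have e := h _ h1 le_rfl
      have h6 : pos τ a q = st a q + (τ - G.level (c (ρ a (st a q))) (f a (st a q))) ∧
          (G.level (c (ρ a (st a q))) (f a (st a q)) : ℕ) ≤ τ ∧ pos τ a q ≤ en a q := by
        rcases hact with hact | hact <;> simp only [pos] <;> omega
      have := h _ h4 h6.2.2
      exact ⟨h6.2.2, by omega⟩
    · have e := h _ h1 le_rfl
      have h6 : pos τ a q = st a q + (G.level (c (ρ a (st a q))) (f a (st a q)) - τ) ∧
          τ ≤ (G.level (c (ρ a (st a q))) (f a (st a q)) : ℕ) ∧ pos τ a q ≤ en a q := by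
        rcases hact with hact | hact <;> simp only [pos] <;> omega
      have := h _ h4 h6.2.2
      exact ⟨h6.2.2, by omega⟩
  refine ⟨fun a q => f a (st a q), fun a q => f a (en a q), fun a q => ρ a (st a q),
    fun τ a q => f a (pos τ a q), ?_, ?_, ?_, ?_, ?_, ?_, ?_⟩
  · intro a
    simpa [hst, hen] using hends a
  · intro a q hq
    obtain ⟨h1, h2, h3⟩ := hpc a q (by omega)
    have e1 := hown a q (by omega) _ h1 le_rfl
    refine ⟨by omega, ?_⟩
    rcases hlev a q (by omega) with h | h
    · have := h _ h1 le_rfl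
      left
      omega
    · have := h _ h1 le_rfl
      right
      omega
  · intro a q hq
    rcases hlink a q (by omega) with h | h
    · left
      simp only [h]
    · right
      have h1 := (hpc a (q + 1) (by omega))
      simp only [← h] at h1 ⊢
      exact hstep a _ (by omega)
  · intro τ _ a q hq hact
    obtain ⟨h1, h2, h3⟩ := hpos τ a q (by omega) hact
    have h4 := (hpc a q (by omega)).1
    refine ⟨h3, fun h => ?_, fun h => ?_⟩
    · have : pos τ a q = st a q := by simp only [pos]; omega
      simp only [this]
    · have : pos τ a q = en a q := by
        rcases hlev a q (by omega) with h' | h'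
        · have := h' _ h4 le_rfl
          have := h' _ h1 h2
          omega
        · have := h' _ h4 le_rfl
          have := h' _ h1 h2
          omega
      simp only [this]
  · intro τ _ a q hq hact hact'
    obtain ⟨h1, h2, h3⟩ := hpos τ a q (by omega) hact
    obtain ⟨h1', h2', h3'⟩ := hpos (τ + 1) a q (by omega) hact'
    have h4 := (hpc a q (by omega)).2.1
    rcases hlev a q (by omega) with h | h
    · have e1 := h _ h1 h2
      have e2 := h _ h1' h2'
      have : pos (τ + 1) a q = pos τ a q + 1 := by omega
      simp only [this]
      exact (hstep a _ (by omega)).1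
    · have e1 := h _ h1 h2
      have e2 := h _ h1' h2'
      have : pos τ a q = pos (τ + 1) a q + 1 := by omega
      simp only [this]
      exact (hstep a _ (by omega)).1.symm
  · intro τ _ a a' haa q hq q' hq' _ hact hact' hx
    obtain ⟨-, h2, -⟩ := hpos τ a q (by omega) hact
    obtain ⟨-, h2', -⟩ := hpos τ a' q' (by omega) hact'
    exact hdisj a a' haa.symm _ (h2.trans (hpc a q (by omega)).2.1) _
      (h2'.trans (hpc a' q' (by omega)).2.1) hx
  · rintro a a' haa q hq q' hq' hR x ⟨hx, hx'⟩
    have hbox : ∀ a q, G.InBox c a (f a (st a q)) (f a (en a q)) x →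
        S.InBox a (st a q) (en a q) x := by
      intro a q h b
      obtain ⟨h1, h2, h3, h4⟩ := h b
      simp only [S, abs_le]
      omega
    obtain ⟨h1, h2, h3⟩ := hpc a q (by omega)
    obtain ⟨h1', h2', h3'⟩ := hpc a' q' (by omega)
    exact hR ((hρ a _ _ h1 h2 h3).2 a' _ _ haa h1' h2' h3' x (hbox a q hx) (hbox a' q' hx'))

end KShortestGraph

/-! ### Certificates as sequences of codes -/

theorem RAM.exists_digits {b : ℕ} (N : ℕ) : ∀ g : ℕ → ℕ, (∀ i < N, g i < b) →
    ∃ y < b ^ N, ∀ i < N, RAM.digit b y i = g i := by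
  induction N with
  | zero => exact fun g _ => ⟨0, by simp, fun i hi => by omega⟩
  | succ N ih =>
    intro g hg
    obtain ⟨y, hy, h⟩ := ih (fun i => g (i + 1)) fun i hi => hg _ (by omega)
    have h0 := hg 0 (by omega)
    refine ⟨g 0 + b * y, ?_, fun i hi => ?_⟩
    · calc g 0 + b * y < b * (y + 1) := by rw [mul_add]; omega
        _ ≤ b * b ^ N := Nat.mul_le_mul_left _ hy
        _ = b ^ (N + 1) := by ring
    · cases i with
      | zero => simp [RAM.digit, Nat.mod_eq_of_lt h0]
      | succ i =>
        rw [← h i (by omega), RAM.digit, RAM.digit, pow_succ', ← Nat.div_div_eq_div_mul,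
          Nat.add_mul_div_left _ _ (by omega), Nat.div_eq_of_lt h0, zero_add]

namespace KShortestGraph

variable {n k l : ℕ} {G : KShortestGraph (Fin n) k} {s t : Fin l → Fin n} {c : Fin l → Fin k}

/-- The machine's data of an instance are those of the `k`-DSP problem for `G`, `s`, `t`, `c`. -/
structure Represents (I : Inst) (G : KShortestGraph (Fin n) k) (s t : Fin l → Fin n)
    (c : Fin l → Fin k) : Prop where
  n_eq : I.n = n
  l_eq : I.l = l
  adj_iff : ∀ x y : Fin n, I.adj x y = 1 ↔ G.graph.Adj x y
  src_eq : ∀ a : Fin l, I.src a = s a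
  tgt_eq : ∀ a : Fin l, I.tgt a = t a
  lev_eq : ∀ (a : Fin l) (x : Fin n), I.lev a x = G.level (c a) x

/-- The digits of `y` are the given vertices and requests. -/
def Codes (I : Inst) (y : ℕ) (U W : Fin l → ℕ → Fin n) (R : Fin l → ℕ → Fin l)
    (X : Fin l → ℕ → Fin n) : Prop :=
  ∀ (a : Fin l), ∀ m < I.J, I.entry y a m = U a m ∧ I.exit y a m = W a m ∧ I.clock y a m = R a m ∧
    I.pebble y a m = X a m

variable {I : Inst} {U W : Fin l → ℕ → Fin n} {R : Fin l → ℕ → Fin l}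

theorem exists_codes (hI : Represents I G s t c) (X : Fin l → ℕ → Fin n) :
    ∃ y < I.base ^ (4 * (I.l * I.J)), Codes I y U W R X := by
  obtain ⟨y, hy, h⟩ := RAM.exists_digits (b := I.base) (4 * (I.l * I.J)) (fun i =>
    if h : i / 4 / I.J < l then
      if i % 4 = 0 then U ⟨_, h⟩ (i / 4 % I.J) else if i % 4 = 1 then W ⟨_, h⟩ (i / 4 % I.J) else
      if i % 4 = 2 then R ⟨_, h⟩ (i / 4 % I.J) else X ⟨_, h⟩ (i / 4 % I.J)
    else 0) fun i _ => by
      have e1 := hI.n_eq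
      have e2 := hI.l_eq
      simp only [Inst.base]
      split_ifs <;> omega
  refine ⟨y, hy, fun a m hm => ?_⟩
  have key : ∀ r < 4, RAM.digit I.base y (4 * (a * I.J + m) + r) =
      if r = 0 then (U a m : ℕ) else if r = 1 then W a m else if r = 2 then R a m else X a m := by
    intro r hr
    have h1 : a * I.J + m < I.l * I.J := by
      have : (a + 1) * I.J ≤ I.l * I.J := Nat.mul_le_mul_right _ (by rw [hI.l_eq]; exact a.2)
      linarith
    rw [h _ (by omega)]
    have h2 : (4 * (a * I.J + m) + r) / 4 = a * I.J + m := by omega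
    have h3 : (a * I.J + m) / I.J = a := by
      rw [Nat.mul_comm, Nat.mul_add_div (by omega), Nat.div_eq_of_lt hm, add_zero]
    have h4 : (a * I.J + m) % I.J = m := by
      rw [Nat.mul_comm, Nat.mul_add_mod, Nat.mod_eq_of_lt hm]
    have h5 : (4 * (a * I.J + m) + r) % 4 = r := by omega
    simp only [h2, h3, h4, h5, a.2, dif_pos, Fin.eta]
  exact ⟨key 0 (by omega), key 1 (by omega), key 2 (by omega), key 3 (by omega)⟩

theorem active_iff (hI : Represents I G s t c) {y : ℕ} {X : Fin l → ℕ → Fin n}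
    (hy : Codes I y U W R X) (τ : ℕ) (a : Fin l) {m : ℕ} (hm : m < I.J) :
    I.Active y τ a m ↔ G.IsActive c (U a m) (W a m) (R a m) τ := by
  obtain ⟨h1, h2, h3, -⟩ := hy a m hm
  rw [Inst.Active, h1, h2, h3, hI.lev_eq, hI.lev_eq, IsActive]

theorem inBox_iff (hI : Represents I G s t c) {y : ℕ} {X : Fin l → ℕ → Fin n}
    (hy : Codes I y U W R X) (a : Fin l) {m : ℕ} (hm : m < I.J) (x : Fin n) :
    I.InBox y a m x ↔ G.InBox c a (U a m) (W a m) x := by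
  obtain ⟨h1, h2, -, -⟩ := hy a m hm
  rw [Inst.InBox, h1, h2, hI.l_eq, InBox, Fin.forall_iff]
  simp only [hI.lev_eq]
  refine forall₂_congr fun h hh => ?_
  have := hI.lev_eq ⟨h, hh⟩
  simp only at this
  rw [this, this, this]

/-- Conditions of a certificate that do not involve time are tested afresh in every code; in the
converse direction the code at time `0` suffices for them, hence `0 < n`. -/
theorem isCertificate_iff (hI : Represents I G s t c) (hn : 0 < n) {Y : ℕ → ℕ}
    {X : ℕ → Fin l → ℕ → Fin n} (hJ : 0 < I.J) (hY : ∀ τ < n, Codes I (Y τ) U W R (X τ)) :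
    G.IsCertificate s t c I.J U W R X ↔
      (∀ τ < n, I.Good τ (Y τ)) ∧ ∀ τ, τ + 1 < n → I.Step (τ + 1) (Y τ) (Y (τ + 1)) := by
  have hfin : ∀ {p : ℕ → Prop}, (∀ a < I.l, p a) ↔ ∀ a : Fin l, p a := by
    intro p
    rw [hI.l_eq, Fin.forall_iff]
  constructor
  · intro hC
    refine ⟨fun τ hτ => hfin.2 fun a => ⟨?_, fun m hm => ?_⟩, fun τ hτ => hfin.2 fun a m hm => ?_⟩
    · rw [Inst.Ends, (hY τ hτ a 0 hJ).1, (hY τ hτ a (I.J - 1) (by omega)).2.1, hI.src_eq,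
        hI.tgt_eq]
      simpa only [Fin.ext_iff] using hC.ends a
    · obtain ⟨h1, h2, h3, h4⟩ := hY τ hτ a m hm
      refine ⟨?_, ?_, fun h => ?_, ?_, hfin.2 fun a' haa m' hm' => ⟨?_, ?_⟩⟩
      · rw [Inst.InRange, h1, h2, h3, h4, hI.n_eq, hI.l_eq]
        exact ⟨(U a m).2, (W a m).2, (R a m).2, (X τ a m).2⟩
      · rw [Inst.Uniform, h1, h2, h3]
        simp only [hI.lev_eq]
        exact hC.uniform a m hm
      · rw [h2, (hY τ hτ a (m + 1) h).1, hI.adj_iff, hI.lev_eq, hI.lev_eq]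
        simpa only [Fin.ext_iff] using hC.linked a m h
      · rw [Inst.OnTime, active_iff hI (hY τ hτ) τ a hm, h1, h2, h3, h4]
        simp only [hI.lev_eq, ← Fin.ext_iff]
        exact hC.onTime τ hτ a m hm
      · obtain ⟨h1', h2', h3', h4'⟩ := hY τ hτ a' m' hm'
        rw [active_iff hI (hY τ hτ) τ a hm, active_iff hI (hY τ hτ) τ a' hm', h3, h4, h3', h4',
          hI.src_eq, hI.tgt_eq]
        simp only [← Fin.ext_iff]
        exact hC.apart τ hτ a a' (fun h => haa (congrArg _ h)) m hm m' hm'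
      · obtain ⟨h1', h2', h3', h4'⟩ := hY τ hτ a' m' hm'
        rw [h3, h3', hI.n_eq]
        intro hR x hx
        have := hC.box a a' (fun h => haa (congrArg _ h)) m hm m' hm'
          (fun h => hR (congrArg _ h)) ⟨x, hx⟩
        rwa [← inBox_iff hI (hY τ hτ) a hm, ← inBox_iff hI (hY τ hτ) a' hm'] at this
    · obtain ⟨h1, h2, h3, h4⟩ := hY τ (by omega) a m hm
      obtain ⟨h1', h2', h3', h4'⟩ := hY (τ + 1) hτ a m hm
      rw [h1, h1', h2, h2', h3, h3', h4, h4', hI.adj_iff, active_iff hI (hY _ hτ) _ a hm,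
        active_iff hI (hY _ hτ) _ a hm]
      exact ⟨rfl, rfl, rfl, hC.move τ hτ a m hm⟩
  · rintro ⟨hg, hs⟩
    have hg := fun τ hτ => hfin.1 (hg τ hτ)
    have hg0 := hg 0 hn
    have hs := fun τ hτ => hfin.1 (hs τ hτ)
    refine ⟨fun a => ?_, fun a m hm => ?_, fun a m hm => ?_, fun τ hτ a m hm => ?_,
      fun τ hτ a m hm => ?_, fun τ hτ a a' haa m hm m' hm' => ?_,
      fun a a' haa m hm m' hm' hR x => ?_⟩
    · have := (hg0 a).1
      rw [Inst.Ends, (hY 0 hn a 0 hJ).1, (hY 0 hn a (I.J - 1) (by omega)).2.1, hI.src_eq,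
        hI.tgt_eq] at this
      simpa only [Fin.ext_iff] using this
    · obtain ⟨h1, h2, h3, h4⟩ := hY 0 hn a m hm
      have := ((hg0 a).2 m hm).2.1
      rw [Inst.Uniform, h1, h2, h3] at this
      simpa only [hI.lev_eq] using this
    · obtain ⟨h1, h2, h3, h4⟩ := hY 0 hn a m (by omega)
      have := ((hg0 a).2 m (by omega)).2.2.1 hm
      rw [h2, (hY 0 hn a (m + 1) hm).1, hI.adj_iff, hI.lev_eq, hI.lev_eq] at this
      simpa only [Fin.ext_iff] using this
    · obtain ⟨h1, h2, h3, h4⟩ := hY τ hτ a m hm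
      have := ((hg τ hτ a).2 m hm).2.2.2.1
      rw [Inst.OnTime, active_iff hI (hY τ hτ) τ a hm, h1, h2, h3, h4] at this
      simpa only [hI.lev_eq, ← Fin.ext_iff] using this
    · obtain ⟨h1, h2, h3, h4⟩ := hY τ (by omega) a m hm
      obtain ⟨h1', h2', h3', h4'⟩ := hY (τ + 1) hτ a m hm
      have := (hs τ hτ a m hm).2.2.2
      rwa [h4, h4', hI.adj_iff, active_iff hI (hY _ hτ) _ a hm,
        active_iff hI (hY _ hτ) _ a hm] at this
    · obtain ⟨h1, h2, h3, h4⟩ := hY τ hτ a m hm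
      obtain ⟨h1', h2', h3', h4'⟩ := hY τ hτ a' m' hm'
      have := (((hg τ hτ a).2 m hm).2.2.2.2 a' (by rw [hI.l_eq]; exact a'.2)
        (fun h => haa (Fin.ext h)) m' hm').1
      rw [active_iff hI (hY τ hτ) τ a hm, active_iff hI (hY τ hτ) τ a' hm', h3, h4, h3', h4',
        hI.src_eq, hI.tgt_eq] at this
      simpa only [← Fin.ext_iff] using this
    · obtain ⟨h1, h2, h3, h4⟩ := hY 0 hn a m hm
      obtain ⟨h1', h2', h3', h4'⟩ := hY 0 hn a' m' hm'
      have := (((hg0 a).2 m hm).2.2.2.2 a' (by rw [hI.l_eq]; exact a'.2)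
        (fun h => haa (Fin.ext h)) m' hm').2
      rw [h3, h3', hI.n_eq] at this
      rw [← inBox_iff hI (hY 0 hn) a hm, ← inBox_iff hI (hY 0 hn) a' hm']
      exact this (fun h => hR (Fin.ext h)) x x.2

theorem exists_reached_iff (hI : Represents I G s t c) (hn : 0 < n) (hl : 0 < l) (hJ : 0 < I.J) :
    (∃ y < I.base ^ (4 * (I.l * I.J)), I.Reached (I.base ^ (4 * (I.l * I.J))) (n - 1) y) ↔
      ∃ U W R X, G.IsCertificate s t c I.J U W R X := by
  constructor
  · rintro ⟨y, hy, hr⟩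
    obtain ⟨Y, -, hg, hs⟩ := (I.reached_iff _ _ y hy).1 hr
    -- Every step preserves ends and clocks, so the code at time `0` fixes them for the whole
    -- history.
    have hconst : ∀ τ < n, ∀ a < I.l, ∀ m < I.J, I.entry (Y τ) a m = I.entry (Y 0) a m ∧
        I.exit (Y τ) a m = I.exit (Y 0) a m ∧ I.clock (Y τ) a m = I.clock (Y 0) a m := by
      intro τ
      induction τ with
      | zero => exact fun _ a _ m _ => ⟨rfl, rfl, rfl⟩
      | succ τ ih =>
        intro hτ a ha m hm
        obtain ⟨h1, h2, h3, -⟩ := hs τ (by omega) a ha m hm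
        exact h1 ▸ h2 ▸ h3 ▸ ih (by omega) a ha m hm
    have : NeZero n := ⟨hn.ne'⟩
    have : NeZero l := ⟨hl.ne'⟩
    refine ⟨fun a m => Fin.ofNat n (I.entry (Y 0) a m), fun a m => Fin.ofNat n (I.exit (Y 0) a m),
      fun a m => Fin.ofNat l (I.clock (Y 0) a m), fun τ a m => Fin.ofNat n (I.pebble (Y τ) a m),
      (isCertificate_iff hI hn (Y := Y) hJ fun τ hτ a m hm => ?_).2
        ⟨fun τ hτ => (hg τ (by omega)).2, fun τ hτ => hs τ (by omega)⟩⟩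
    have ha : (a : ℕ) < I.l := by rw [hI.l_eq]; exact a.2
    obtain ⟨h1, h2, h3⟩ := hconst τ hτ a ha m hm
    obtain ⟨r1, r2, r3, r4⟩ := (((hg τ (by omega)).2 a ha).2 m hm).1
    rw [hI.n_eq] at r1 r2 r4
    rw [hI.l_eq] at r3
    rw [← h1, ← h2, ← h3]
    simp only [Fin.ofNat, Nat.mod_eq_of_lt r1, Nat.mod_eq_of_lt r2, Nat.mod_eq_of_lt r3,
      Nat.mod_eq_of_lt r4, and_self]
  · rintro ⟨U, W, R, X, hC⟩
    choose Y hYD hY using fun τ => exists_codes (U := U) (W := W) (R := R) hI (X τ)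
    obtain ⟨hg, hs⟩ := (isCertificate_iff hI hn hJ fun τ _ => hY τ).1 hC
    exact ⟨Y (n - 1), hYD _, (I.reached_iff _ _ _ (hYD _)).2 ⟨Y, rfl,
      fun τ hτ => ⟨hYD τ, hg τ (by omega)⟩, fun τ hτ => hs τ (by omega)⟩⟩

theorem exists_reached_iff_hasDSPSolution (hI : Represents I G s t c) (hn : 0 < n) (hl : 0 < l)
    (hJ : 4 * l ^ (2 * k) + 1 ≤ I.J) :
    (∃ y < I.base ^ (4 * (I.l * I.J)), I.Reached (I.base ^ (4 * (I.l * I.J))) (n - 1) y) ↔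
      G.HasDSPSolution s t c := by
  rw [exists_reached_iff hI hn hl (by omega)]
  constructor
  · rintro ⟨U, W, R, X, hC⟩
    exact hC.hasDSPSolution (by omega)
  · intro h
    obtain ⟨U, W, R, X, hC⟩ := h.exists_isCertificate hl (j := I.J - 1) (by omega)
    rw [Nat.sub_add_cancel (by omega)] at hC
    exact ⟨U, W, R, X, hC⟩

end KShortestGraph

/-! ### Reading the encoded instance -/

theorem List.getD_append_add {α : Type*} (w r : List α) (d : α) {m : ℕ} (hm : w.length = m)
    (j : ℕ) : (w ++ r).getD (m + j) d = r.getD j d := by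
  rw [List.getD_append_right _ _ _ _ (by omega), hm, Nat.add_sub_cancel_left]

theorem List.getD_ofFn_append {α : Type*} {m : ℕ} (f : Fin m → α) (r : List α) (d : α)
    (i : Fin m) : (List.ofFn f ++ r).getD i d = f i := by
  rw [List.getD_append _ _ _ _ (by simp), List.getD_eq_getElem _ _ (by simp)]
  simp

section Encoding

variable {n k l : ℕ} (G : KShortestGraph (Fin n) k) (s t : Fin l → Fin n) (c : Fin l → Fin k)

theorem encodeDSP_header : (encodeDSP G s t c).getD 0 0 = n ∧ (encodeDSP G s t c).getD 1 0 = k ∧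
    (encodeDSP G s t c).getD 2 0 = l := by
  simp [encodeDSP]

open Classical in
theorem encodeDSP_adj (x y : Fin n) : (encodeDSP G s t c).getD (3 + (x * n + y)) 0 =
    if G.graph.Adj x y then 1 else 0 := by
  have hxy : (x * n + y : ℕ) < n * n := by
    have : (x + 1 : ℕ) * n ≤ n * n := Nat.mul_le_mul_right _ x.2
    have := y.2
    linarith
  have hn : 0 < n := x.pos
  rw [encodeDSP]
  simp only [List.append_assoc]
  rw [List.getD_append_add [n, k, l] _ 0 (m := 3) rfl, List.getD_ofFn_append _ _ 0 ⟨_, hxy⟩]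
  have h1 : Fin.divNat ⟨x * n + y, hxy⟩ = x := by
    ext
    simp only [Fin.coe_divNat]
    rw [Nat.mul_comm, Nat.mul_add_div hn, Nat.div_eq_of_lt y.2, add_zero]
  have h2 : Fin.modNat ⟨x * n + y, hxy⟩ = y := by
    ext
    simp only [Fin.coe_modNat]
    rw [Nat.mul_comm, Nat.mul_add_mod, Nat.mod_eq_of_lt y.2]
  rw [h1, h2]

theorem encodeDSP_src (a : Fin l) :
    (encodeDSP G s t c).getD (3 + n * n + a) 0 = s a := by
  rw [encodeDSP]
  simp only [List.append_assoc, Nat.add_assoc]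
  rw [List.getD_append_add [n, k, l] _ 0 (m := 3) rfl,
    List.getD_append_add _ _ 0 List.length_ofFn, List.getD_ofFn_append]

theorem encodeDSP_tgt (a : Fin l) :
    (encodeDSP G s t c).getD (3 + n * n + l + a) 0 = t a := by
  rw [encodeDSP]
  simp only [List.append_assoc, Nat.add_assoc]
  rw [List.getD_append_add [n, k, l] _ 0 (m := 3) rfl,
    List.getD_append_add _ _ 0 List.length_ofFn, List.getD_append_add _ _ 0 List.length_ofFn,
    List.getD_ofFn_append]

theorem encodeDSP_colour (a : Fin l) :
    (encodeDSP G s t c).getD (3 + n * n + 2 * l + a) 0 = c a := by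
  rw [encodeDSP]
  simp only [List.append_assoc, Nat.add_assoc, Nat.two_mul]
  rw [List.getD_append_add [n, k, l] _ 0 (m := 3) rfl,
    List.getD_append_add _ _ 0 List.length_ofFn, List.getD_append_add _ _ 0 List.length_ofFn,
    List.getD_append_add _ _ 0 List.length_ofFn, List.getD_ofFn_append]

theorem encodeDSP_level (i : Fin k) (x : Fin n) :
    (encodeDSP G s t c).getD (3 + n * n + 3 * l + x + n * i) 0 = G.level i x := by
  have hix : (n * i + x : ℕ) < k * n := by
    have : n * (i + 1 : ℕ) ≤ n * k := Nat.mul_le_mul_left _ i.2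
    have := x.2
    linarith
  have e : 3 + n * n + 3 * l + x + n * i = 3 + (n * n + (l + (l + (l + (n * i + x))))) := by ring
  rw [encodeDSP, e]
  simp only [List.append_assoc]
  rw [List.getD_append_add [n, k, l] _ 0 (m := 3) rfl,
    List.getD_append_add _ _ 0 List.length_ofFn, List.getD_append_add _ _ 0 List.length_ofFn,
    List.getD_append_add _ _ 0 List.length_ofFn, List.getD_append_add _ _ 0 List.length_ofFn,
    List.getD_eq_getElem _ _ (by simpa using hix), List.getElem_ofFn]
  have h1 : Fin.divNat ⟨n * i + x, hix⟩ = i := by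
    ext
    simp only [Fin.coe_divNat]
    rw [Nat.mul_add_div x.pos, Nat.div_eq_of_lt x.2, add_zero]
  have h2 : Fin.modNat ⟨n * i + x, hix⟩ = x := by
    ext
    simp only [Fin.coe_modNat]
    rw [Nat.mul_add_mod, Nat.mod_eq_of_lt x.2]
  rw [h1, h2]

theorem represents_ofInput (hn : 1 ≤ n) (J : ℕ) : KShortestGraph.Represents
    (Inst.ofInput (fun j => (encodeDSP G s t c).getD j 0) n l J) G s t c where
  n_eq := rfl
  l_eq := rfl
  adj_iff x y := by
    classical
    simp only [Inst.ofInput, encodeDSP_adj]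
    split_ifs with h
    · simp [h, hn]
    · simp [h]
  src_eq a := by
    simp only [Inst.ofInput, encodeDSP_src]
    exact min_eq_right (s a).2.le
  tgt_eq a := by
    simp only [Inst.ofInput, encodeDSP_tgt]
    exact min_eq_right (t a).2.le
  lev_eq a x := by
    simp only [Inst.ofInput, encodeDSP_colour, encodeDSP_level]
    exact min_eq_right (KShortestGraph.level_lt _ _).le

end Encoding

/-! ### Trivial instances and the final bound -/

namespace KShortestGraph

theorem hasDSPSolution_of_trivial {n k l : ℕ} (G : KShortestGraph (Fin n) k)
    (s t : Fin l → Fin n) (c : Fin l → Fin k) (h : n ≤ 1 ∨ l = 0) : G.HasDSPSolution s t c := by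
  rcases h with h | rfl
  · have : Subsingleton (Fin n) := Fin.subsingleton_iff_le_one.2 h
    refine ⟨fun j => SimpleGraph.Walk.nil.copy rfl (Subsingleton.elim (s j) (t j)), fun j => .inl ?_,
      fun i j _ x _ hx => (hx (Subsingleton.elim _ _)).elim⟩
    rw [isColourPath_iff]
    intro d hd
    simp at hd
  · exact ⟨fun j => j.elim0, fun j => j.elim0, fun j => j.elim0⟩

end KShortestGraph

theorem DSPProgram.numCodes_pow_le {n k l : ℕ} (hn : 2 ≤ n) (hl : 1 ≤ l) (hk : 1 ≤ k) (K : ℕ) :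
    numCodes n k l ^ K ≤ n ^ (96 * K * l ^ 5 ^ k) := by
  -- There may be many more requests than vertices, so the base of the code is bounded by a power of
  -- `n` whose exponent grows with `l`.
  have h1 : n + l + 1 ≤ n ^ (l + 2) := by
    have e1 : l + 1 ≤ n ^ l := (Nat.lt_pow_self (by omega) : l < n ^ l)
    have e2 : n ^ l * 4 ≤ n ^ (l + 2) := by
      rw [pow_add]
      exact Nat.mul_le_mul_left _ (by nlinarith)
    have e3 : n ≤ n ^ (l + 1) := Nat.le_self_pow (by omega) n
    have e4 : n ^ (l + 1) * 2 ≤ n ^ (l + 2) := by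
      rw [pow_succ n (l + 1)]
      exact Nat.mul_le_mul_left _ hn
    omega
  -- The exponent `2 * k + 2` collects `2 * k` from the number of pieces, one from the number of
  -- paths and one from the base.
  have h2 : 2 * k + 2 ≤ 5 ^ k := by
    induction k, hk using Nat.le_induction with
    | base => norm_num
    | succ k hk ih => rw [pow_succ]; omega
  have h3 : (l + 2) * (4 * (l * numPieces k l)) ≤ 96 * l ^ 5 ^ k := by
    calc (l + 2) * (4 * (l * (8 * l ^ (2 * k)))) ≤ 3 * l * (4 * (l * (8 * l ^ (2 * k)))) := by
          gcongr; omega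
      _ = 96 * l ^ (2 * k + 2) := by ring
      _ ≤ 96 * l ^ 5 ^ k := Nat.mul_le_mul_left _ (Nat.pow_le_pow_right hl h2)
  calc numCodes n k l ^ K ≤ ((n ^ (l + 2)) ^ (4 * (l * numPieces k l))) ^ K := by
        rw [numCodes]; gcongr
    _ = n ^ ((l + 2) * (4 * (l * numPieces k l)) * K) := by rw [← pow_mul, ← pow_mul, ← mul_assoc]
    _ ≤ n ^ (96 * K * l ^ 5 ^ k) := by
        refine Nat.pow_le_pow_right (by omega) ?_
        calc _ ≤ 96 * l ^ 5 ^ k * K := Nat.mul_le_mul_right _ h3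
          _ = _ := by ring

/-- There is one program and one constant `C` such that, for every `k`-shortest graph with `n`
vertices, all `l` requests and every colouring of the requests, the program decides within
`C * n ^ (C * l ^ (5 ^ k))` steps whether the `k`-DSP problem has a solution. -/
theorem theorem2 :
    ∃ (p : RAM.Prog) (C : ℕ), ∀ (n k l : ℕ) (G : KShortestGraph (Fin n) k)
      (s t : Fin l → Fin n) (c : Fin l → Fin k),
      RAM.DecidesWithin p (encodeDSP G s t c) (C * n ^ (C * l ^ (5 ^ k)))
        (G.HasDSPSolution s t c) := by
  obtain ⟨K, hK⟩ := DSPProgram.exists_halts_prog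
  -- As a factor, `11` covers the main run together with ten steps of overhead; `96 * K` is the
  -- constant in the exponent.
  refine ⟨DSPProgram.prog, 96 * K + 11, fun n k l G s t c => ?_⟩
  obtain ⟨h0, h1, h2⟩ := encodeDSP_header G s t c
  obtain ⟨htriv, hmain⟩ := hK (fun j => (encodeDSP G s t c).getD j 0) n k l h0 h1 h2
  by_cases h : n ≤ 1 ∨ l = 0
  · obtain ⟨T, hT, τ, hex, hτ⟩ := htriv h
    -- Without vertices there are no requests either, and the bound reads `0 ^ 0 = 1`.
    have hpow : 1 ≤ n ^ ((96 * K + 11) * l ^ 5 ^ k) := by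
      rcases Nat.eq_zero_or_pos n with rfl | hn
      · obtain rfl : l = 0 := by
          by_contra hl
          exact (s ⟨0, by omega⟩).elim0
        simp
      · exact Nat.one_le_pow _ _ hn
    refine ⟨T, by nlinarith, τ, hex, fun _ => hτ, fun hno => ?_⟩
    exact (hno (G.hasDSPSolution_of_trivial s t c h)).elim
  · obtain ⟨hn, hl⟩ : 2 ≤ n ∧ 1 ≤ l := by omega
    have hk : 1 ≤ k := (c ⟨0, hl⟩).pos
    obtain ⟨T, hT, τ, hex, hτ⟩ := hmain hn hl
    have hle : DSPProgram.numCodes n k l ^ K ≤ n ^ ((96 * K + 11) * l ^ 5 ^ k) :=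
      (DSPProgram.numCodes_pow_le hn hl hk K).trans
        (Nat.pow_le_pow_right (by omega) (Nat.mul_le_mul_right _ (by omega)))
    have hpow : 1 ≤ n ^ ((96 * K + 11) * l ^ 5 ^ k) := Nat.one_le_pow _ _ (by omega)
    have hiff := KShortestGraph.exists_reached_iff_hasDSPSolution
      (represents_ofInput G s t c (by omega) (DSPProgram.numPieces k l)) (by omega) hl (by
        have : 1 ≤ l ^ (2 * k) := Nat.one_le_pow _ _ hl
        simp only [Inst.ofInput, DSPProgram.numPieces]
        omega)
    refine ⟨T, by nlinarith, τ, hex, fun hQ => hτ.1 (hiff.2 hQ), fun hQ => hτ.2 fun hr => ?_⟩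
    exact hQ (hiff.1 hr)
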